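/- **Lemma (Uniform rate of convergence).** Let $d\ge 1$, $\mathcal Y=[0,1]$, $\mathcal X=[0,1]^d$, and let $(y_i,\mathbf x_i)$, $i\ge 1$, be i.i.d. with law supported on $\mathcal Y\times\mathcal X$ and a joint density $f$ that is continuous and bounded away from zero there. Let $F(y|\mathbf x)=\int_0^y f(t,\mathbf x)\,dt\big/\int_0^1 f(t,\mathbf x)\,dt$ be the conditional distribution function, and for $\mu\in\mathbb N$, $\boldsymbol\nu\in\mathbb N^d$ put $\theta_{\mu,\boldsymbol\nu}(y,\mathbf x)=\frac{\partial^\mu}{\partial y^\mu}\frac{\partial^{\boldsymbol\nu}}{\partial\mathbf x^{\boldsymbol\nu}}F(y|\mathbf x)$ (one-sided derivatives at the boundary). Assume that $\theta_{2,\mathbf 0}$ exists and is continuous on $\mathcal Y\times\mathcal X$. Let $K:\mathbb R\to[0,\infty)$ be symmetric, supported on $[-1,1]$, Lipschitz continuous, with $\int K=1$; let $G$ be continuously differentiable on $[0,1]$ with derivative $g>0$ on $[0,1]$. Fix $\mathfrak p,\mathfrak q\in\mathbb N$. For a bandwidth $h=h_n>0$ define, for $\mathbf m\in\mathbb N^d$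 with $|\mathbf m|\le\mathfrak q$ and $0\le k\le\mathfrak p$, $$\hat{\boldsymbol\gamma}(y,\mathbf x)\in\operatorname*{argmin}_{\boldsymbol\gamma}\sum_{i=1}^n\Big(\mathbb 1(y_i\le y)-\sum_{|\mathbf m|\le\mathfrak q}\tfrac{(\mathbf x_i-\mathbf x)^{\mathbf m}}{\mathbf m!}\gamma_{\mathbf m}\Big)^2\frac1{h^d}\prod_{j=1}^dK\Big(\frac{x_{ij}-x_j}{h}\Big),$$ and, for $|\boldsymbol\nu|\le\mathfrak q$ and $\mu\le\mathfrak p$, $\check\theta_{\mu,\boldsymbol\nu}(y,\mathbf x)=\check\beta_\mu(y,\mathbf x)$, where $$\check{\boldsymbol\beta}(y,\mathbf x)\in\operatorname*{argmin}_{\mathbf b\in\mathbb R^{\mathfrak p+1}}\int_0^1\Big(\hat\gamma_{\boldsymbol\nu}(u,\mathbf x)-\sum_{k=0}^{\mathfrak p}\tfrac{(u-y)^k}{k!}b_k\Big)^2\frac1hK\Big(\frac{u-y}{h}\Big)g(u)\,du$$ (an arbitrary choice being made where a minimizer is not unique). For nonnegative random $a_n$ and deterministic $b_n$ write $a_n=O_{\mathbb{TC}}(b_n)$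 if for every $\mathfrak c_1>0$ there is $\mathfrak c_2>0$ with $\limsup_{n\to\infty}n^{\mathfrak c_1}\mathbb P[a_n\ge\mathfrak c_2b_n]<\infty$. Let $\mu\le\mathfrak p$ and $|\boldsymbol\nu|\le\mathfrak q$. Suppose that $h\to0$ and $nh^{d+1}/\log n\to\infty$, and that $\theta_{\mu',\boldsymbol\nu'}$ exists and is continuous on $\mathcal Y\times\mathcal X$ for all $\mu'+|\boldsymbol\nu'|=\max\{\mathfrak q+1+\mu,\ \mathfrak p+1+|\boldsymbol\nu|\}$. Then: (i) if $\mu=0$, $$\sup_{y\in\mathcal Y,\mathbf x\in\mathcal X}|\check\theta_{0,\boldsymbol\nu}(y,\mathbf x)-\theta_{0,\boldsymbol\nu}(y,\mathbf x)|=O_{\mathbb{TC}}\left(h^{\mathfrak q+1-|\boldsymbol\nu|}+h^{\mathfrak p+1}+\sqrt{\frac{\log n}{nh^{d+2|\boldsymbol\nu|}}}\right);$$ (ii) if $\mu>0$, $$\sup_{y\in\mathcal Y,\mathbf x\in\mathcal X}|\check\theta_{\mu,\boldsymbol\nu}(y,\mathbf x)-\theta_{\mu,\boldsymbol\nu}(y,\mathbf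 x)|=O_{\mathbb{TC}}\left(h^{\mathfrak q+1-|\boldsymbol\nu|}+h^{\mathfrak p+1-\mu}+\sqrt{\frac{\log n}{nh^{d+2\mu+2|\boldsymbol\nu|-1}}}\right).$$ -/

import Mathlib

open Set Filter Topology MeasureTheory ProbabilityTheory
open scoped ENNReal

noncomputable section

namespace LPCDE

/-! ### The target parameter -/

/-- The support `[0,1]` of the scalar variable. -/
def unitY : Set ℝ := Icc 0 1

/-- The support `[0,1]^d` of the conditioning variable. -/
def unitX (d : ℕ) : Set (Fin d → ℝ) := Icc 0 1

/-- Conditional distribution function `F(y|x) = ∫₀^y f(t,x) dt / ∫₀^1 f(t,x) dt` on `[0,1]^{1+d}`,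
for a joint density `f`. -/
def condDistFun {d : ℕ} (f : ℝ → (Fin d → ℝ) → ℝ) (y : ℝ) (x : Fin d → ℝ) : ℝ :=
  (∫ t in (0 : ℝ)..y, f t x) / ∫ t in (0 : ℝ)..1, f t x

/-- The restriction of `F` to the coordinate line through `(y, x)`; the coordinate `none` is `y`
and the coordinate `some j` is `x_j`. -/
def line {d : ℕ} (F : ℝ → (Fin d → ℝ) → ℝ) (i : Option (Fin d)) (y : ℝ) (x : Fin d → ℝ) : ℝ → ℝ :=
  match i with
  | none => fun t => F t x
  | some j => fun t => F y (Function.update x j t)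

/-- The coordinate of the point `(y, x)` in a given direction. -/
def coord {d : ℕ} (i : Option (Fin d)) (y : ℝ) (x : Fin d → ℝ) : ℝ :=
  match i with
  | none => y
  | some j => x j

/-- First-order partial derivative on the closed unit cube (one-sided on its faces). -/
def pderiv {d : ℕ} (i : Option (Fin d)) (F : ℝ → (Fin d → ℝ) → ℝ) (y : ℝ) (x : Fin d → ℝ) : ℝ :=
  derivWithin (line F i y x) (Icc 0 1) (coord i y x)

/-- Iterated partial derivative; the head of the list is the derivative taken last. -/
def iterPderiv {d : ℕ} :
    List (Option (Fin d)) → (ℝ → (Fin d → ℝ) → ℝ) → ℝ → (Fin d → ℝ) → ℝ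
  | [], F => F
  | i :: l, F => pderiv i (iterPderiv l F)

/-- All the successive derivatives in an iterated partial derivative exist on the unit cube. -/
def IterPderivExists {d : ℕ} : List (Option (Fin d)) → (ℝ → (Fin d → ℝ) → ℝ) → Prop
  | [], _ => True
  | i :: l, F => IterPderivExists l F ∧ ∀ y ∈ unitY, ∀ x ∈ unitX d,
      DifferentiableWithinAt ℝ (line (iterPderiv l F) i y x) (Icc 0 1) (coord i y x)

/-- The directions of `∂_y^μ ∂_{x_1}^{ν_1} ⋯ ∂_{x_d}^{ν_d}`. -/
def dirs {d : ℕ} (μ : ℕ) (ν : Fin d → ℕ) : List (Option (Fin d)) :=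
  List.replicate μ none ++ (List.finRange d).flatMap fun j => List.replicate (ν j) (some j)

/-- `θ_{μ,ν}(y,x) = ∂_y^μ ∂_x^ν F(y|x)`. -/
def theta {d : ℕ} (f : ℝ → (Fin d → ℝ) → ℝ) (μ : ℕ) (ν : Fin d → ℕ) (y : ℝ) (x : Fin d → ℝ) : ℝ :=
  iterPderiv (dirs μ ν) (condDistFun f) y x

/-- `θ_{μ,ν}` exists and is continuous on `[0,1]^{1+d}`. -/
def ThetaExistsContinuous {d : ℕ} (f : ℝ → (Fin d → ℝ) → ℝ) (μ : ℕ) (ν : Fin d → ℕ) : Prop :=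
  IterPderivExists (dirs μ ν) (condDistFun f) ∧
    ContinuousOn (fun z : ℝ × (Fin d → ℝ) => theta f μ ν z.1 z.2) (unitY ×ˢ unitX d)

/-! ### Assumptions -/

/-- Data generating process: `Z i = (y_i, x_i)` are independent with common law supported on
`[0,1]^{1+d}`, whose joint density `f` is continuous and bounded away from zero there, and
`θ_{2,0}` exists and is continuous. -/
structure IsDGP {Ω : Type*} [MeasurableSpace Ω] (P : Measure Ω) {d : ℕ}
    (Z : ℕ → Ω → ℝ × (Fin d → ℝ)) (f : ℝ → (Fin d → ℝ) → ℝ) : Prop where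
  measurable : ∀ i, Measurable (Z i)
  indep : iIndepFun Z P
  law : ∀ i, P.map (Z i) =
    (volume.restrict (unitY ×ˢ unitX d)).withDensity fun z => ENNReal.ofReal (f z.1 z.2)
  density_continuous :
    ContinuousOn (fun z : ℝ × (Fin d → ℝ) => f z.1 z.2) (unitY ×ˢ unitX d)
  density_bounded_below : ∃ c : ℝ, 0 < c ∧ ∀ y ∈ unitY, ∀ x ∈ unitX d, c ≤ f y x
  theta_two : ThetaExistsContinuous f 2 0

/-- The kernel is nonnegative, symmetric, supported on `[-1,1]`, Lipschitz continuous, and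
integrates to one. -/
structure IsKernel (K : ℝ → ℝ) : Prop where
  nonneg : ∀ u, 0 ≤ K u
  symm : ∀ u, K (-u) = K u
  support : ∀ u, 1 < |u| → K u = 0
  lipschitz : ∃ C, LipschitzWith C K
  integral_eq_one : ∫ u, K u = 1

/-- The Lebesgue density `g` of the weighting function `G` on `[0,1]`. -/
def weightDensity (G : ℝ → ℝ) (u : ℝ) : ℝ := derivWithin G unitY u

/-- The weighting function is continuously differentiable on `[0,1]`, with positive density. -/
structure IsWeighting (G : ℝ → ℝ) : Prop where
  contDiff : ContDiffOn ℝ 1 G unitY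
  density_pos : ∀ u ∈ unitY, 0 < weightDensity G u

/-! ### The estimator -/

/-- A minimizer of a real function, when there is one. -/
def argmin {E : Type*} [Inhabited E] (Q : E → ℝ) : E :=
  open Classical in if h : ∃ b, ∀ b', Q b ≤ Q b' then h.choose else default

/-- The multi-indices `m` in `d` variables with `|m| ≤ q`. -/
def multiIndices (d q : ℕ) : Finset (Fin d → ℕ) :=
  (Finset.Iic fun _ => q).filter fun m => ∑ j, m j ≤ q

theorem mem_multiIndices {d q : ℕ} {m : Fin d → ℕ} : m ∈ multiIndices d q ↔ ∑ j, m j ≤ q := by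
  simp only [multiIndices, Finset.mem_filter, Finset.mem_Iic, and_iff_right_iff_imp]
  intro h j
  exact (Finset.single_le_sum (fun _ _ => Nat.zero_le _) (Finset.mem_univ j)).trans h

/-- The entry `u^m / m!` of the expansion `q(u)`. -/
def monomialX {d : ℕ} (m : Fin d → ℕ) (u : Fin d → ℝ) : ℝ :=
  ∏ j, u j ^ m j / (m j).factorial

/-- `L_h(a; x) = L((a - x)/h) / h^d` with the product kernel `L(u) = K(u_1) ⋯ K(u_d)`. -/
def scaledKernelX {d : ℕ} (K : ℝ → ℝ) (h : ℝ) (a x : Fin d → ℝ) : ℝ :=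
  (∏ j, K ((a j - x j) / h)) / h ^ d

/-- `K_h(u; y) = K((u - y)/h) / h`. -/
def scaledKernelY (K : ℝ → ℝ) (h u y : ℝ) : ℝ := K ((u - y) / h) / h

/-- The least squares criterion of the local polynomial regression of `1(y_i ≤ y)` on `x_i`. -/
def criterionX {d : ℕ} (q : ℕ) (K : ℝ → ℝ) (h : ℝ) (n : ℕ) (z : ℕ → ℝ × (Fin d → ℝ))
    (y : ℝ) (x : Fin d → ℝ) (c : multiIndices d q → ℝ) : ℝ :=
  ∑ i ∈ Finset.range n,
    ((if (z i).1 ≤ y then 1 else 0) - ∑ m : multiIndices d q, monomialX m.1 ((z i).2 - x) * c m) ^ 2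
      * scaledKernelX K h (z i).2 x

/-- The coefficient vector `γ̂(y, x)`. -/
def gammaHat {d : ℕ} (q : ℕ) (K : ℝ → ℝ) (h : ℝ) (n : ℕ) (z : ℕ → ℝ × (Fin d → ℝ))
    (y : ℝ) (x : Fin d → ℝ) : multiIndices d q → ℝ :=
  argmin (criterionX q K h n z y x)

/-- The weighted least squares criterion, in the `y`-direction, of the local polynomial smoothing
of the estimate `e_νᵀ γ̂(u, x)` of `∂_x^ν F(u|x)`. -/
def criterionY {d : ℕ} (p q : ℕ) (K G : ℝ → ℝ) (h : ℝ) (n : ℕ) (z : ℕ → ℝ × (Fin d → ℝ))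
    (ν : multiIndices d q) (y : ℝ) (x : Fin d → ℝ) (b : Fin (p + 1) → ℝ) : ℝ :=
  ∫ u in unitY,
    (gammaHat q K h n z u x ν - ∑ k : Fin (p + 1), (u - y) ^ (k : ℕ) / (k : ℕ).factorial * b k) ^ 2
      * scaledKernelY K h u y * weightDensity G u

/-- The coefficient vector `β̌(y, x)`. -/
def betaCheck {d : ℕ} (p q : ℕ) (K G : ℝ → ℝ) (h : ℝ) (n : ℕ) (z : ℕ → ℝ × (Fin d → ℝ))
    (ν : multiIndices d q) (y : ℝ) (x : Fin d → ℝ) : Fin (p + 1) → ℝ :=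
  argmin (criterionY p q K G h n z ν y x)

/-- The estimator `θ̌_{μ,ν}(y, x) = e_μᵀ β̌(y, x)` based on the first `n` observations. -/
def thetaCheck {d : ℕ} (p q : ℕ) (K G : ℝ → ℝ) (h : ℝ) (n : ℕ) (z : ℕ → ℝ × (Fin d → ℝ))
    (μ : Fin (p + 1)) (ν : multiIndices d q) (y : ℝ) (x : Fin d → ℝ) : ℝ :=
  betaCheck p q K G h n z ν y x μ

/-- The uniform estimation error `sup_{y,x} |θ̌_{μ,ν}(y,x) - θ_{μ,ν}(y,x)|`, in `[0,∞]`. -/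
def uniformError {d : ℕ} (p q : ℕ) (K G : ℝ → ℝ) (f : ℝ → (Fin d → ℝ) → ℝ) (h : ℝ) (n : ℕ)
    (z : ℕ → ℝ × (Fin d → ℝ)) (μ : Fin (p + 1)) (ν : multiIndices d q) : ℝ≥0∞ :=
  ⨆ y ∈ unitY, ⨆ x ∈ unitX d,
    ENNReal.ofReal |thetaCheck p q K G h n z μ ν y x - theta f μ ν.1 y x|

/-! ### Tail-controlled stochastic order -/

/-- `a_n = O_TC(b_n)`: for every `c₁ > 0` there is `c₂` such that
`limsup n^{c₁} P[a_n ≥ c₂ b_n] < ∞`. -/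
def IsBigOTC {Ω : Type*} [MeasurableSpace Ω] (P : Measure Ω) (a : ℕ → Ω → ℝ≥0∞) (b : ℕ → ℝ) :
    Prop :=
  ∀ c₁ : ℝ, 0 < c₁ → ∃ c₂ : ℝ, 0 < c₂ ∧
    limsup (fun n : ℕ => ENNReal.ofReal ((n : ℝ) ^ c₁) *
      P {ω | ENNReal.ofReal (c₂ * b n) ≤ a n ω}) atTop < ⊤

end LPCDE

end

open LPCDE

/-! Both stages of the estimator are weighted least squares, hence linear in the indicators, and the
two smoothings commute. Up to the factor h^(μ+|ν|), the estimator at (y, x) is Σ_m a_m (1/n) Σ_i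
k_m(x_i) ∫ w(u) 1(y_i ≤ u) du, where k_m is a rescaled monomial times the kernel around x, w is the
equivalent kernel of the second stage (`exists_dual_weight`) and a is a row of the inverse of the
empirical Gram matrix of the first stage (`gammaHat_normal_equations`, `Coercive.exists_dual`). The
mass of w and the entries of a are bounded uniformly in h and in the point, faces of the cube
included, because the rescaled Gram matrices are uniformly coercive: from any point of the cube,
some box of size h pointing inwards stays in the cube (`exists_local_gram_bound`).

Each indicator is split into its conditional mean F(u|x_i) and a centered noise.

Bias. The function ∫ w(u) F(u|·) du is expanded around x up to degree q, and the first stage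
reproduces the polynomial part exactly. Since w annihilates polynomials of degree less than μ, the
remainder is O(h^(μ+q+1)), so that dividing by h^(μ+|ν|) leaves h^(q+1-|ν|)
(`SmoothOfOrder.exists_bias_x`). The remaining coefficient ∫ w θ_{0,ν} equals h^μ θ_{μ,ν} up to
O(h^(p+1)) (`SmoothOfOrder.exists_bias_y`). Continuity is assumed at a single total order and for
one order of differentiation only. The lower derivatives are bounded by interpolation between a
function and its top derivative (`exists_intermediate_deriv_bound`), and the Taylor formula in
several variables is arranged so as to use only that order of differentiation
(`exists_ordered_taylor_bound`).

Stochastic error. The noise terms are centered, of size h^(-d) and second moment h^(-d). When μ > 0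
the weight w integrates to zero, so the smoothed noise is O(h) unless y_i is within h of y, and the
second moment drops to h^(1-d) (`exists_zeta_bounds`); this is the source of the `- 1` in the
exponent of (ii). A Bernstein-type inequality on a polynomially fine grid
(`exists_uniform_deviation_bound`) bounds all deviations by √(V log n / n), with V the second
moment, outside an event of probability O(n^(-c₁)), for any prescribed c₁. The rate n h^(d+1) / log
n → ∞ keeps this inequality in its Gaussian regime. The same inequality makes the empirical Gram
matrix close to its expectation, hence coercive. On the good event `exists_error_bound` is
deterministic. -/

noncomputable section

namespace LPCDE

/-! ### Quadratic forms and least squares -/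

section Quadratic

variable {ι : Type*} [Fintype ι]

/-- The quadratic form of `S` is bounded below by `l` times the squared Euclidean norm. -/
def Coercive (l : ℝ) (S : ι → ι → ℝ) : Prop :=
  ∀ c : ι → ℝ, l * ∑ i, c i ^ 2 ≤ ∑ i, ∑ j, c i * S i j * c j

theorem Coercive.eq_zero {l : ℝ} {S : ι → ι → ℝ} (hS : Coercive l S) (hl : 0 < l) {c : ι → ℝ}
    (hc : ∑ i, ∑ j, c i * S i j * c j ≤ 0) : c = 0 := by
  have h1 : ∑ i, c i ^ 2 ≤ 0 := by
    have := (hS c).trans hc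
    by_contra! h2
    nlinarith [mul_pos hl h2]
  have h2 := (Finset.sum_eq_zero_iff_of_nonneg (fun i _ => sq_nonneg (c i))).1
    (le_antisymm h1 (Finset.sum_nonneg fun i _ => sq_nonneg (c i)))
  ext i
  simpa using h2 i (Finset.mem_univ i)

theorem Coercive.exists_solution {l : ℝ} {S : ι → ι → ℝ} (hS : Coercive l S) (hl : 0 < l)
    (b : ι → ℝ) : ∃ a : ι → ℝ, ∀ i, ∑ j, S i j * a j = b i := by
  classical
  have hinj : Function.Injective (Matrix.mulVecLin (Matrix.of S)) := by
    rw [← LinearMap.ker_eq_bot, LinearMap.ker_eq_bot']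
    intro c hc
    refine hS.eq_zero hl (le_of_eq ?_)
    have h3 : ∀ i, ∑ j, S i j * c j = 0 := fun i => by
      simpa [Matrix.mulVec, dotProduct] using congrFun hc i
    simp_rw [mul_assoc, ← Finset.mul_sum, h3, mul_zero, Finset.sum_const_zero]
  obtain ⟨a, ha⟩ := LinearMap.injective_iff_surjective.1 hinj b
  exact ⟨a, fun i => by simpa [Matrix.mulVec, dotProduct] using congrFun ha i⟩

/-- The rows of the inverse of a coercive form are bounded. -/
theorem Coercive.exists_dual {l : ℝ} {S : ι → ι → ℝ} (hS : Coercive l S) (hl : 0 < l)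
    (hsymm : ∀ i j, S i j = S j i) (k : ι) :
    ∃ a : ι → ℝ, (∀ i, |a i| ≤ 1 / l) ∧
      ∀ c b : ι → ℝ, (∀ i, ∑ j, S i j * c j = b i) → c k = ∑ i, a i * b i := by
  classical
  obtain ⟨a, ha⟩ := hS.exists_solution hl (Pi.single k 1)
  -- The vector a is a row of the inverse. Coercivity tested on it reads l |a|² ≤ a k, which gives
  -- first a k ≤ 1/l and then |a|² ≤ 1/l².
  have hq : ∑ i, ∑ j, a i * S i j * a j = a k := by
    simp_rw [mul_assoc, ← Finset.mul_sum, ha]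
    simp [Pi.single_apply]
  have h1 := hS a
  rw [hq] at h1
  have hle : ∀ i, a i ^ 2 ≤ ∑ i, a i ^ 2 := fun i =>
    Finset.single_le_sum (f := fun i => a i ^ 2) (fun i _ => sq_nonneg _) (Finset.mem_univ i)
  have hk : a k ≤ 1 / l := by
    rw [le_div_iff₀ hl]
    by_contra! h2
    have h3 := mul_le_mul_of_nonneg_left (hle k) hl.le
    have h4 : 0 < a k := by
      by_contra! h5
      nlinarith
    nlinarith
  refine ⟨a, fun i => ?_, fun c b hcb => ?_⟩
  · refine abs_le_of_sq_le_sq ?_ (by positivity)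
    have h3 : a i ^ 2 * l ≤ 1 / l := by
      nlinarith [mul_le_mul_of_nonneg_left (hle i) hl.le]
    calc a i ^ 2 ≤ (1 / l) / l := by rwa [le_div_iff₀ hl]
      _ = (1 / l) ^ 2 := by ring
  · have h5 : ∑ i, a i * b i = ∑ i, ∑ j, a i * (S i j * c j) := by
      simp_rw [← hcb, Finset.mul_sum]
    rw [h5, Finset.sum_comm]
    have h6 : ∀ j, ∑ i, a i * (S i j * c j) = (Pi.single k 1 : ι → ℝ) j * c j := fun j => by
      rw [← ha j, Finset.sum_mul]
      exact Finset.sum_congr rfl fun i _ => by rw [hsymm i j]; ring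
    simp_rw [h6]
    simp [Pi.single_apply]

/-- A minimizer of a strictly convex quadratic function solves the normal equations. -/
theorem argmin_quadratic {l A : ℝ} {S : ι → ι → ℝ} {b : ι → ℝ} {Q : (ι → ℝ) → ℝ}
    (hS : Coercive l S) (hl : 0 < l) (hsymm : ∀ i j, S i j = S j i)
    (hQ : ∀ c, Q c = A - 2 * ∑ i, b i * c i + ∑ i, ∑ j, c i * S i j * c j) (i : ι) :
    ∑ j, S i j * argmin Q j = b i := by
  obtain ⟨a, ha⟩ := hS.exists_solution hl b
  -- Completing the square at the solution a. It shows that a minimum exists, so `argmin` does not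
  -- take its default value, and that the minimizer is unique.
  have key : ∀ c, Q c = Q a + ∑ i, ∑ j, (c i - a i) * S i j * (c j - a j) := by
    intro c
    have e1 : ∀ c' : ι → ℝ, ∑ i, ∑ j, c' i * S i j * a j = ∑ i, b i * c' i := fun c' => by
      simp_rw [mul_assoc, ← Finset.mul_sum, ha, mul_comm]
    have e2 : ∑ i, ∑ j, a i * S i j * c j = ∑ i, b i * c i := by
      rw [Finset.sum_comm, ← e1 c]
      exact Finset.sum_congr rfl fun i _ => Finset.sum_congr rfl fun j _ => by
        rw [hsymm i j]; ring
    have e3 : ∑ i, ∑ j, (c i - a i) * S i j * (c j - a j)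
        = ∑ i, ∑ j, c i * S i j * c j - ∑ i, ∑ j, c i * S i j * a j
          - ∑ i, ∑ j, a i * S i j * c j + ∑ i, ∑ j, a i * S i j * a j := by
      simp_rw [← Finset.sum_sub_distrib, ← Finset.sum_add_distrib]
      exact Finset.sum_congr rfl fun i _ => Finset.sum_congr rfl fun j _ => by ring
    rw [hQ, hQ, e3, e2, e1, e1]
    ring
  have hex : ∃ c, ∀ c', Q c ≤ Q c' := ⟨a, fun c' => by
    rw [key c']
    have := hS (fun i => c' i - a i)
    have h0 : 0 ≤ l * ∑ i, (c' i - a i) ^ 2 :=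
      mul_nonneg hl.le (Finset.sum_nonneg fun i _ => sq_nonneg _)
    linarith⟩
  have hmin : ∀ c', Q (argmin Q) ≤ Q c' := by
    unfold argmin
    rw [dif_pos hex]
    exact hex.choose_spec
  have h1 := hmin a
  rw [key (argmin Q)] at h1
  have h2 := hS.eq_zero hl (c := fun i => argmin Q i - a i) (by linarith)
  have h3 : argmin Q = a := by
    ext i
    have := congrFun h2 i
    simp only [Pi.zero_apply] at this
    linarith
  rw [h3, ha]

/-- By |c_i c_j| ≤ (c_i² + c_j²)/2, an entrywise error ε moves the form by at most ε · card ι ·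
|c|². This carries coercivity from the expected Gram matrix to the empirical one. -/
theorem Coercive.perturb {l ε : ℝ} {S T : ι → ι → ℝ} (hS : Coercive l S)
    (hT : ∀ i j, |T i j - S i j| ≤ ε) : Coercive (l - ε * Fintype.card ι) T := by
  intro c
  rcases isEmpty_or_nonempty ι with he | ⟨⟨i0⟩⟩
  · simp
  have hε : 0 ≤ ε := (abs_nonneg _).trans (hT i0 i0)
  have h1 : ∑ i, ∑ j, c i * S i j * c j - ∑ i, ∑ j, c i * T i j * c j
      ≤ ε * Fintype.card ι * ∑ i, c i ^ 2 := by
    rw [← Finset.sum_sub_distrib]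
    simp_rw [← Finset.sum_sub_distrib]
    calc ∑ i, ∑ j, (c i * S i j * c j - c i * T i j * c j)
        ≤ ∑ i, ∑ j, ε * ((c i ^ 2 + c j ^ 2) / 2) := by
          refine Finset.sum_le_sum fun i _ => Finset.sum_le_sum fun j _ => ?_
          have e : c i * S i j * c j - c i * T i j * c j = -((T i j - S i j) * (c i * c j)) := by
            ring
          rw [e]
          refine (neg_le_abs _).trans ?_
          rw [abs_mul]
          refine mul_le_mul (hT i j) ?_ (abs_nonneg _) hε
          rw [abs_mul]
          nlinarith [sq_nonneg (|c i| - |c j|), sq_abs (c i), sq_abs (c j)]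
      _ = ε * Fintype.card ι * ∑ i, c i ^ 2 := by
          simp_rw [← Finset.mul_sum, ← Finset.sum_div, Finset.sum_add_distrib, Finset.sum_const,
            Finset.card_univ, nsmul_eq_mul, ← Finset.mul_sum]
          ring
  have := hS c
  nlinarith

/-- The Gram matrix of functions that are linearly independent on an open set is coercive. -/
theorem exists_gram_lower_bound {X : Type*} [TopologicalSpace X] [MeasurableSpace X]
    [OpensMeasurableSpace X] (m : Measure X) [m.IsOpenPosMeasure] {B : Set X} (hB : IsOpen B)
    (φ : ι → X → ℝ) (hφ : ∀ i, Continuous (φ i))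
    (hint : ∀ i j, IntegrableOn (fun x => φ i x * φ j x) B m)
    (hind : ∀ c : ι → ℝ, (∀ x ∈ B, ∑ i, c i * φ i x = 0) → c = 0) :
    ∃ l : ℝ, 0 < l ∧ ∀ c : ι → ℝ, l * ∑ i, c i ^ 2 ≤ ∫ x in B, (∑ i, c i * φ i x) ^ 2 ∂m := by
  set q : (ι → ℝ) → ℝ := fun c => ∫ x in B, (∑ i, c i * φ i x) ^ 2 ∂m with hq
  have hexp : ∀ (c : ι → ℝ) (x : X),
      (∑ i, c i * φ i x) ^ 2 = ∑ i, ∑ j, c i * c j * (φ i x * φ j x) := fun c x => by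
    rw [sq, Finset.sum_mul_sum]
    exact Finset.sum_congr rfl fun i _ => Finset.sum_congr rfl fun j _ => by ring
  have hint2 : ∀ c : ι → ℝ, IntegrableOn (fun x => (∑ i, c i * φ i x) ^ 2) B m := fun c => by
    simp_rw [hexp]
    exact integrable_finsetSum _ fun i _ => integrable_finsetSum _ fun j _ =>
      (hint i j).const_mul _
  have hq2 : ∀ c, q c = ∑ i, ∑ j, c i * c j * ∫ x in B, φ i x * φ j x ∂m := fun c => by
    simp only [hq, hexp]
    rw [integral_finsetSum _ fun i _ => integrable_finsetSum _ fun j _ =>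
      (hint i j).const_mul _]
    refine Finset.sum_congr rfl fun i _ => ?_
    rw [integral_finsetSum _ fun j _ => (hint i j).const_mul _]
    exact Finset.sum_congr rfl fun j _ => integral_const_mul _ _
  have hcont : Continuous q := by
    rw [funext hq2]
    fun_prop
  have hpos : ∀ c, c ≠ 0 → 0 < q c := fun c hc => by
    refine lt_of_le_of_ne (integral_nonneg fun x => sq_nonneg _) fun h0 => hc (hind c ?_)
    have h1 := (integral_eq_zero_iff_of_nonneg (fun x => sq_nonneg _) (hint2 c)).1 h0.symm
    have h2 := Measure.eqOn_open_of_ae_eq h1 hB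
      ((continuous_finsetSum _ fun i _ => continuous_const.mul (hφ i)).pow 2).continuousOn
      (by exact continuousOn_const)
    intro x hx
    simpa using h2 hx
  have hhom : ∀ (t : ℝ) c, q (t • c) = t ^ 2 * q c := fun t c => by
    rw [hq2, hq2, Finset.mul_sum]
    refine Finset.sum_congr rfl fun i _ => ?_
    rw [Finset.mul_sum]
    exact Finset.sum_congr rfl fun j _ => by simp only [Pi.smul_apply, smul_eq_mul]; ring
  -- The form is continuous and positive off 0, hence bounded below on the compact unit sphere,
  -- which is empty when `ι` is; homogeneity extends the bound.
  obtain ⟨l, hl, hlq⟩ : ∃ l : ℝ, 0 < l ∧ ∀ c ∈ Metric.sphere (0 : ι → ℝ) 1, l ≤ q c := by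
    rcases (Metric.sphere (0 : ι → ℝ) 1).eq_empty_or_nonempty with he | hne
    · exact ⟨1, one_pos, by simp [he]⟩
    · obtain ⟨c0, hc0, hmin⟩ := (isCompact_sphere (0 : ι → ℝ) 1).exists_isMinOn hne
        hcont.continuousOn
      refine ⟨q c0, hpos c0 ?_, fun c hc => hmin hc⟩
      rintro rfl
      simp at hc0
  have hmain : ∀ c, l * ‖c‖ ^ 2 ≤ q c := fun c => by
    rcases eq_or_ne c 0 with rfl | hc
    · have : q 0 = 0 := by simp [hq2]
      simp [this]
    · have hn : ‖c‖ ≠ 0 := norm_ne_zero_iff.2 hc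
      have h1 := hlq (‖c‖⁻¹ • c) (by simp [norm_smul, hn])
      rw [hhom] at h1
      have h2 : 0 < ‖c‖ ^ 2 := by positivity
      calc l * ‖c‖ ^ 2 ≤ (‖c‖⁻¹ ^ 2 * q c) * ‖c‖ ^ 2 := mul_le_mul_of_nonneg_right h1 h2.le
        _ = q c := by field_simp
  -- The sphere is that of the sup norm, so the Euclidean norm costs a factor `card ι`; the `+ 1`
  -- keeps the constant positive when `ι` is empty.
  refine ⟨l / (Fintype.card ι + 1), by positivity, fun c => le_trans ?_ (hmain c)⟩
  rw [div_mul_eq_mul_div, div_le_iff₀ (by positivity), mul_assoc]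
  refine mul_le_mul_of_nonneg_left ?_ hl.le
  calc ∑ i, c i ^ 2 ≤ ∑ _i : ι, ‖c‖ ^ 2 := Finset.sum_le_sum fun i _ => by
        rw [← sq_abs]
        exact pow_le_pow_left₀ (abs_nonneg _) (norm_le_pi_norm c i) 2
    _ = ‖c‖ ^ 2 * Fintype.card ι := by simp [mul_comm]
    _ ≤ ‖c‖ ^ 2 * (Fintype.card ι + 1) := by nlinarith [sq_nonneg ‖c‖]

end Quadratic

/-! ### Monomials -/

theorem monomial_linearIndependent_on_Ioo {N : ℕ} {α β : ℝ} (hαβ : α < β) (c : Fin N → ℝ)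
    (hc : ∀ t ∈ Ioo α β, ∑ k, c k * (t ^ (k : ℕ) / (k : ℕ).factorial) = 0) : c = 0 := by
  set P : Polynomial ℝ :=
    ∑ k : Fin N, Polynomial.monomial (k : ℕ) (c k / (k : ℕ).factorial) with hP
  have hP0 : P = 0 := by
    refine Polynomial.eq_zero_of_infinite_isRoot P ((Ioo_infinite hαβ).mono fun t ht => ?_)
    have := hc t ht
    simp only [mem_ofPred_eq, Polynomial.IsRoot, hP, Polynomial.eval_finsetSum,
      Polynomial.eval_monomial]
    rw [← this]
    exact Finset.sum_congr rfl fun k _ => by ring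
  ext k
  have h1 : P.coeff k = c k / (k : ℕ).factorial := by
    simp [hP, Polynomial.finsetSum_coeff, Polynomial.coeff_monomial, Fin.val_inj]
  rw [hP0] at h1
  have h2 : ((k : ℕ).factorial : ℝ) ≠ 0 := by positivity
  simpa [h2] using h1.symm

/-- A polynomial vanishing on a product of infinite sets is zero, and the factorials only rescale
its coefficients. -/
theorem monomialX_linearIndependent_on_box {d q : ℕ} {s : Fin d → Set ℝ}
    (hs : ∀ j, (s j).Infinite) (c : multiIndices d q → ℝ)
    (hc : ∀ u ∈ Set.pi univ s, ∑ m, c m * monomialX m.1 u = 0) : c = 0 := by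
  classical
  set w : (Fin d → ℕ) → ℝ := fun m => ∏ j, ((m j).factorial : ℝ) with hw
  have hwpos : ∀ m, w m ≠ 0 := fun m => Finset.prod_ne_zero_iff.2 fun j _ => by positivity
  have hmono : ∀ m (u : Fin d → ℝ), monomialX m u = (∏ j, u j ^ m j) / w m := fun m u => by
    simp [monomialX, hw, Finset.prod_div_distrib]
  set e := (Finsupp.equivFunOnFinite : (Fin d →₀ ℕ) ≃ (Fin d → ℕ)).symm
  set P : MvPolynomial (Fin d) ℝ :=
    ∑ m : multiIndices d q, MvPolynomial.monomial (e m.1) (c m / w m.1) with hP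
  have hP0 : P = 0 := by
    refine MvPolynomial.funext_set s hs fun u hu => ?_
    have := hc u hu
    simp only [hP, map_sum, MvPolynomial.eval_monomial, map_zero]
    rw [← this]
    refine Finset.sum_congr rfl fun m _ => ?_
    rw [hmono, Finsupp.prod_fintype _ _ (by simp)]
    simp only [e, Finsupp.equivFunOnFinite_symm_apply_apply]
    ring
  ext k
  have h1 : P.coeff (e k.1) = c k / w k.1 := by
    simp [hP, MvPolynomial.coeff_sum, MvPolynomial.coeff_monomial]
  rw [hP0] at h1
  simpa [hwpos k.1] using h1.symm

/-! ### Taylor expansions along ordered partial derivatives -/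

/-- The sequence φ lists successive derivatives. The derivative of the remainder is the remainder of
the shifted sequence, so the mean value inequality adds one power of |b - a| per step. Only a bound
on `φ N` enters, not its continuity; the price is the lost factor 1/N!. -/
theorem abs_sub_taylor_le {B : ℝ} (N : ℕ) : ∀ φ : ℕ → ℝ → ℝ,
    (∀ l < N, ∀ t ∈ Icc (0 : ℝ) 1, HasDerivWithinAt (φ l) (φ (l + 1) t) (Icc 0 1) t) →
    (∀ t ∈ Icc (0 : ℝ) 1, |φ N t| ≤ B) → ∀ a ∈ Icc (0 : ℝ) 1, ∀ b ∈ Icc (0 : ℝ) 1,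
    |φ 0 b - ∑ l ∈ Finset.range N, (b - a) ^ l / l.factorial * φ l a| ≤ B * |b - a| ^ N := by
  induction N with
  | zero => intro φ _ hB a _ b hb; simpa using hB b hb
  | succ N ih =>
    intro φ hφ hB a ha b hb
    set R : ℝ → ℝ := fun t => φ 0 t - ∑ l ∈ Finset.range (N + 1), (t - a) ^ l / l.factorial * φ l a
      with hR
    set R' : ℝ → ℝ := fun t => φ 1 t - ∑ l ∈ Finset.range N, (t - a) ^ l / l.factorial * φ (l + 1) a
      with hR'
    have hsub : uIcc a b ⊆ Icc 0 1 := uIcc_subset_Icc ha hb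
    have hder : ∀ t ∈ uIcc a b, HasDerivWithinAt R (R' t) (uIcc a b) t := fun t ht => by
      refine ((hφ 0 (Nat.succ_pos N) t (hsub ht)).mono hsub).sub ?_
      have h1 : HasDerivAt (fun t : ℝ => ∑ l ∈ Finset.range (N + 1),
          (t - a) ^ l / l.factorial * φ l a)
          (∑ l ∈ Finset.range N, (t - a) ^ l / l.factorial * φ (l + 1) a) t := by
        simp_rw [Finset.sum_range_succ' (fun l => (_ - a) ^ l / (l.factorial : ℝ) * φ l a)]
        simp only [pow_zero]
        refine HasDerivAt.add_const _ (HasDerivAt.fun_sum fun l _ => ?_)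
        have h2 := (((hasDerivAt_id t).sub_const a).pow (l + 1)).div_const
          (((l + 1).factorial : ℕ) : ℝ)
        convert! h2.mul_const (φ (l + 1) a) using 1
        simp only [id, mul_one, Nat.add_sub_cancel, Nat.factorial_succ, Nat.cast_mul]
        have : ((l + 1 : ℕ) : ℝ) ≠ 0 := by positivity
        field_simp
      exact h1.hasDerivWithinAt
    have hbd : ∀ t ∈ uIcc a b, ‖R' t‖ ≤ B * |b - a| ^ N := fun t ht => by
      have h1 := ih (fun l => φ (l + 1)) (fun l hl s hs => hφ (l + 1) (by omega) s hs) hB a ha t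
        (hsub ht)
      refine h1.trans ?_
      have hB0 : 0 ≤ B := (abs_nonneg _).trans (hB a ha)
      exact mul_le_mul_of_nonneg_left
        (pow_le_pow_left₀ (abs_nonneg _) (abs_sub_left_of_mem_uIcc ht) N) hB0
    have h1 := Convex.norm_image_sub_le_of_norm_hasDerivWithin_le hder hbd (convex_uIcc a b)
      left_mem_uIcc right_mem_uIcc
    have h2 : R a = 0 := by
      simp [hR, Finset.sum_range_succ']
    rw [h2, sub_zero, Real.norm_eq_abs, Real.norm_eq_abs] at h1
    rw [pow_succ, ← mul_assoc]
    exact h1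

/-- If a function and its `N`-th derivative are bounded on `[0,1]`, so are the derivatives of lower
order. -/
theorem exists_intermediate_deriv_bound (N : ℕ) : ∃ C : ℝ, 0 ≤ C ∧ ∀ (A B : ℝ) (φ : ℕ → ℝ → ℝ),
    (∀ l < N, ∀ t ∈ Icc (0 : ℝ) 1, HasDerivWithinAt (φ l) (φ (l + 1) t) (Icc 0 1) t) →
    (∀ t ∈ Icc (0 : ℝ) 1, |φ 0 t| ≤ A) → (∀ t ∈ Icc (0 : ℝ) 1, |φ N t| ≤ B) →
    ∀ l ≤ N, ∀ t ∈ Icc (0 : ℝ) 1, |φ l t| ≤ C * (A + B) := by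
  -- The coefficients of a polynomial of degree less than N are controlled by its L² norm on (0,1).
  -- This is applied to the Taylor polynomial at 0, which is within B of `φ 0` and hence bounded by
  -- A + B.
  obtain ⟨l0, hl0, hq⟩ := exists_gram_lower_bound (volume : Measure ℝ) (isOpen_Ioo (a := 0) (b := 1))
    (fun (k : Fin N) (t : ℝ) => t ^ (k : ℕ) / (k : ℕ).factorial) (fun k => by fun_prop)
    (fun i j => (Continuous.integrableOn_Icc (a := 0) (b := 1) (by fun_prop)).mono_set
      Ioo_subset_Icc_self) (monomial_linearIndependent_on_Ioo one_pos)
  have h00 : (0 : ℝ) ∈ Icc (0 : ℝ) 1 := ⟨le_rfl, zero_le_one⟩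
  refine ⟨N * (1 / Real.sqrt l0) + 1, by positivity, fun A B φ hφ hA hB l hl t ht => ?_⟩
  have hA0 : 0 ≤ A := (abs_nonneg _).trans (hA 0 h00)
  have hB0 : 0 ≤ B := (abs_nonneg _).trans (hB 0 h00)
  have hpow : ∀ t ∈ Icc (0 : ℝ) 1, ∀ n : ℕ, |t - 0| ^ n ≤ 1 := fun t ht n => by
    rw [sub_zero, abs_of_nonneg ht.1]
    exact pow_le_one₀ ht.1 ht.2
  have h1 : ∀ t ∈ Icc (0 : ℝ) 1,
      |∑ k : Fin N, φ k 0 * (t ^ (k : ℕ) / (k : ℕ).factorial)| ≤ A + B := fun t ht => by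
    have h2 := abs_sub_taylor_le N φ hφ hB 0 h00 t ht
    have h3 : ∑ k : Fin N, φ k 0 * (t ^ (k : ℕ) / (k : ℕ).factorial)
        = ∑ l ∈ Finset.range N, (t - 0) ^ l / l.factorial * φ l 0 := by
      rw [Finset.sum_range fun l => (t - 0) ^ l / (l.factorial : ℝ) * φ l 0]
      exact Finset.sum_congr rfl fun k _ => by rw [sub_zero, mul_comm]
    rw [h3]
    have h4 := hA t ht
    have h5 : B * |t - 0| ^ N ≤ B := mul_le_of_le_one_right hB0 (hpow t ht N)
    have h6 := abs_sub_abs_le_abs_sub (∑ l ∈ Finset.range N, (t - 0) ^ l / l.factorial * φ l 0)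
      (φ 0 t)
    rw [abs_sub_comm] at h6
    linarith
  have h2 : ∀ k < N, |φ k 0| ≤ 1 / Real.sqrt l0 * (A + B) := fun k hk => by
    have h3 := hq (fun k => φ k 0)
    have h4 : ∫ t in Ioo (0 : ℝ) 1, (∑ k : Fin N, φ k 0 * (t ^ (k : ℕ) / (k : ℕ).factorial)) ^ 2
        ≤ (A + B) ^ 2 := by
      have h5 := norm_setIntegral_le_of_norm_le_const (μ := volume) (s := Ioo (0 : ℝ) 1)
        (C := (A + B) ^ 2)
        (f := fun t : ℝ => (∑ k : Fin N, φ k 0 * (t ^ (k : ℕ) / (k : ℕ).factorial)) ^ 2)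
        (by simp) (fun t ht => by
          rw [Real.norm_eq_abs, abs_pow]
          exact pow_le_pow_left₀ (abs_nonneg _) (h1 t (Ioo_subset_Icc_self ht)) 2)
      simpa using (le_abs_self _).trans h5
    have h5 : φ k 0 ^ 2 ≤ ∑ k : Fin N, φ k 0 ^ 2 :=
      Finset.single_le_sum (f := fun k : Fin N => φ k 0 ^ 2) (fun i _ => sq_nonneg _)
        (Finset.mem_univ (⟨k, hk⟩ : Fin N))
    refine abs_le_of_sq_le_sq ?_ (by positivity)
    rw [mul_pow, div_pow, Real.sq_sqrt hl0.le, one_pow, div_mul_eq_mul_div, one_mul,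
      le_div_iff₀ hl0]
    nlinarith
  -- Expanding `φ l` itself around 0 carries the bounds on the derivatives at 0 to all of [0,1].
  rcases hl.lt_or_eq with hl | rfl
  · have h3 := abs_sub_taylor_le (N - l) (fun j => φ (l + j))
      (fun j hj s hs => hφ (l + j) (by omega) s hs)
      (by rw [Nat.add_sub_cancel' hl.le]; exact hB) 0 h00 t ht
    have h4 : |∑ j ∈ Finset.range (N - l), (t - 0) ^ j / j.factorial * φ (l + j) 0|
        ≤ N * (1 / Real.sqrt l0 * (A + B)) := by
      refine (Finset.abs_sum_le_sum_abs _ _).trans ?_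
      calc _ ≤ ∑ _j ∈ Finset.range (N - l), (1 / Real.sqrt l0 * (A + B)) := by
            refine Finset.sum_le_sum fun j hj => ?_
            have hj' := Finset.mem_range.1 hj
            rw [abs_mul, abs_div, abs_pow, Nat.abs_cast]
            refine (mul_le_of_le_one_left (abs_nonneg _) ?_).trans (h2 (l + j) (by omega))
            refine div_le_one_of_le₀ ((hpow t ht j).trans ?_) (by positivity)
            exact_mod_cast Nat.one_le_iff_ne_zero.2 (Nat.factorial_ne_zero j)
        _ = ((N - l : ℕ) : ℝ) * (1 / Real.sqrt l0 * (A + B)) := by simp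
        _ ≤ _ := by
            refine mul_le_mul_of_nonneg_right ?_ (by positivity)
            exact_mod_cast Nat.sub_le N l
    have h5 : B * |t - 0| ^ (N - l) ≤ B := mul_le_of_le_one_right hB0 (hpow t ht _)
    have h6 := abs_sub_abs_le_abs_sub (φ (l + 0) t)
      (∑ j ∈ Finset.range (N - l), (t - 0) ^ j / j.factorial * φ (l + j) 0)
    simp only [add_zero] at h3 h6
    linarith
  · have h3 := hB t ht
    have h4 : 0 ≤ l * (1 / Real.sqrt l0) * (A + B) := by positivity
    linarith

/-- `D m`, `|m| ≤ N`, is a family of partial derivatives on the unit cube, of which `D (m + e_j)` is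
known to be the derivative of `D m` only if `m` involves no coordinate before the `j`-th. -/
def OrderedPartials {d : ℕ} (N : ℕ) (D : (Fin d → ℕ) → (Fin d → ℝ) → ℝ) : Prop :=
  ∀ (m : Fin d → ℕ) (j : Fin d), (∀ i < j, m i = 0) → ∑ i, m i < N → ∀ x ∈ unitX d,
    HasDerivWithinAt (fun t => D m (Function.update x j t)) (D (m + Pi.single j 1) x)
      (Icc 0 1) (x j)

theorem mem_unitX {d : ℕ} {x : Fin d → ℝ} : x ∈ unitX d ↔ ∀ j, x j ∈ Icc (0 : ℝ) 1 := by
  simp only [unitX, mem_Icc, Pi.le_def, Pi.zero_apply, Pi.one_apply, forall_and]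

theorem sum_multiIndices_succ {d q : ℕ} (g : (Fin (d + 1) → ℕ) → ℝ) :
    ∑ m ∈ multiIndices (d + 1) q, g m
      = ∑ l ∈ Finset.range (q + 1), ∑ m ∈ multiIndices d (q - l), g (Fin.snoc m l) := by
  rw [Finset.sum_sigma']
  symm
  refine Finset.sum_bij' (fun a _ => Fin.snoc a.2 a.1) (fun m _ => ⟨m (Fin.last d), Fin.init m⟩)
    ?_ ?_ ?_ ?_ ?_
  · rintro ⟨l, m⟩ hm
    simp only [Finset.mem_sigma, Finset.mem_range, mem_multiIndices] at hm ⊢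
    rw [Fin.sum_univ_castSucc]
    simp only [Fin.snoc_castSucc, Fin.snoc_last]
    omega
  · intro m hm
    simp only [Finset.mem_sigma, Finset.mem_range, mem_multiIndices] at hm ⊢
    rw [Fin.sum_univ_castSucc] at hm
    simp only [Fin.init]
    omega
  · rintro ⟨l, m⟩ _
    simp
  · intro m _
    simp
  · intro a _
    rfl

theorem monomialX_snoc {d : ℕ} (m : Fin d → ℕ) (l : ℕ) (u : Fin (d + 1) → ℝ) :
    monomialX (Fin.snoc m l) u
      = u (Fin.last d) ^ l / l.factorial * monomialX m (Fin.init u) := by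
  simp only [monomialX]
  rw [Fin.prod_univ_castSucc, mul_comm]
  simp only [Fin.snoc_castSucc, Fin.snoc_last, Fin.init]

/-- Induction on the dimension, splitting off the last coordinate. It must be expanded first, with
the other coordinates those of a, since a derivative in it is available only where no earlier
coordinate has been differentiated. Each coefficient `D (snoc 0 l)` is then expanded to degree q - l
in the other coordinates, the last one being frozen at its value in x. All remainders have total
order q + 1. -/
theorem exists_ordered_taylor_bound (d : ℕ) : ∀ q : ℕ, ∃ C : ℝ, 0 ≤ C ∧
    ∀ (D : (Fin d → ℕ) → (Fin d → ℝ) → ℝ) (B δ : ℝ), OrderedPartials (q + 1) D → 0 ≤ B →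
      (∀ m, ∑ i, m i = q + 1 → ∀ x ∈ unitX d, |D m x| ≤ B) →
      ∀ x ∈ unitX d, ∀ a ∈ unitX d, (∀ j, |a j - x j| ≤ δ) → 0 ≤ δ →
        |D 0 a - ∑ m ∈ multiIndices d q, monomialX m (a - x) * D m x| ≤ C * B * δ ^ (q + 1) := by
  induction d with
  | zero =>
    intro q
    refine ⟨0, le_rfl, fun D B δ _ _ _ x _ a _ _ _ => ?_⟩
    have h1 : multiIndices 0 q = {0} := by
      ext m
      simp [mem_multiIndices, Subsingleton.elim m 0]
    rw [h1, Finset.sum_singleton, Subsingleton.elim a x]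
    simp [monomialX]
  | succ d ih =>
    intro q
    choose C hC0 hC using ih
    refine ⟨1 + ∑ l ∈ Finset.range (q + 1), C (q - l),
      add_nonneg zero_le_one (Finset.sum_nonneg fun l _ => hC0 _), ?_⟩
    intro D B δ hD hB0 hB x hx a ha hax hδ
    have hx' := mem_unitX.1 hx
    have ha' := mem_unitX.1 ha
    set r := x (Fin.last d) with hr
    have hmemsnoc : ∀ z ∈ unitX d, ∀ t ∈ Icc (0 : ℝ) 1, (Fin.snoc z t : Fin (d + 1) → ℝ) ∈
        unitX (d + 1) := fun z hz t ht => by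
      rw [mem_unitX]
      intro j
      refine Fin.lastCases ?_ (fun i => ?_) j
      · simpa using ht
      · simpa using mem_unitX.1 hz i
    have hai : Fin.init a ∈ unitX d := mem_unitX.2 fun j => ha' _
    have hxi : Fin.init x ∈ unitX d := mem_unitX.2 fun j => hx' _
    -- the last coordinate
    have h1 := abs_sub_taylor_le (B := B) (q + 1)
      (fun l t => D (Fin.snoc 0 l) (Fin.snoc (Fin.init a) t))
      (fun l hl t ht => by
        have h2 := hD (Fin.snoc 0 l) (Fin.last d)
          (fun i hi => by
            obtain ⟨i', rfl⟩ := Fin.exists_castSucc_eq.2 hi.ne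
            simp)
          (by rw [Fin.sum_univ_castSucc]; simpa using hl) _ (hmemsnoc _ hai t ht)
        have h3 : (Fin.snoc (0 : Fin d → ℕ) l : Fin (d + 1) → ℕ) + Pi.single (Fin.last d) 1
            = Fin.snoc 0 (l + 1) := by
          ext j
          refine Fin.lastCases ?_ (fun i => ?_) j
          · simp
          · simp [Fin.castSucc_ne_last]
        have h4 : ∀ s : ℝ, Function.update (Fin.snoc (Fin.init a) t : Fin (d + 1) → ℝ) (Fin.last d) s
            = Fin.snoc (Fin.init a) s := fun s =>
          Fin.update_snoc_last _ _ _
        simp_rw [h3, h4] at h2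
        simpa using h2)
      (fun t ht => hB _ (by rw [Fin.sum_univ_castSucc]; simp) _ (hmemsnoc _ hai t ht))
      r (hx' _) (a (Fin.last d)) (ha' _)
    have h0 : (Fin.snoc (0 : Fin d → ℕ) 0 : Fin (d + 1) → ℕ) = 0 := by
      ext j
      refine Fin.lastCases ?_ (fun i => ?_) j <;> simp
    rw [h0, Fin.snoc_init_self] at h1
    have h1' : |D 0 a - ∑ l ∈ Finset.range (q + 1), (a (Fin.last d) - r) ^ l / l.factorial *
        D (Fin.snoc 0 l) (Fin.snoc (Fin.init a) r)| ≤ B * δ ^ (q + 1) :=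
      h1.trans (mul_le_mul_of_nonneg_left (pow_le_pow_left₀ (abs_nonneg _) (hax _) _) hB0)
    -- the first coordinates
    have h2 : ∀ l ∈ Finset.range (q + 1),
        |D (Fin.snoc 0 l) (Fin.snoc (Fin.init a) r)
          - ∑ m ∈ multiIndices d (q - l), monomialX m (Fin.init a - Fin.init x) *
            D (Fin.snoc m l) x| ≤ C (q - l) * B * δ ^ (q - l + 1) := fun l hl => by
      have hl' : l < q + 1 := Finset.mem_range.1 hl
      have h3 := hC (q - l) (fun m z => D (Fin.snoc m l) (Fin.snoc z r)) B δ
        (fun m j hm hs z hz => by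
          have h4 := hD (Fin.snoc m l) j.castSucc
            (fun i hi => by
              obtain ⟨i', rfl⟩ := Fin.exists_castSucc_eq.2
                (hi.trans (Fin.castSucc_lt_last j)).ne
              simpa using hm i' (by simpa using hi))
            (by
              rw [Fin.sum_univ_castSucc]
              simp only [Fin.snoc_castSucc, Fin.snoc_last]
              omega) _ (hmemsnoc _ hz r (hx' _))
          have h5 : (Fin.snoc m l : Fin (d + 1) → ℕ) + Pi.single j.castSucc 1
              = Fin.snoc (m + Pi.single j 1) l := by
            ext i
            refine Fin.lastCases ?_ (fun i => ?_) i
            · simp [(Fin.castSucc_ne_last j).symm]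
            · simp [Pi.single_apply]
          rw [h5] at h4
          simpa [Fin.snoc_update] using h4) hB0
        (fun m hm z hz => hB _ (by
          rw [Fin.sum_univ_castSucc]
          simp only [Fin.snoc_castSucc, Fin.snoc_last]
          omega) _ (hmemsnoc _ hz r (hx' _))) (Fin.init x) hxi (Fin.init a) hai
        (fun j => hax _) hδ
      have h6 : (Fin.snoc (Fin.init x) r : Fin (d + 1) → ℝ) = x := by
        rw [hr, Fin.snoc_init_self]
      simpa only [h6] using h3
    rw [sum_multiIndices_succ]
    simp_rw [monomialX_snoc]
    have h3 : ∀ l ∈ Finset.range (q + 1),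
        |(a (Fin.last d) - r) ^ l / l.factorial * D (Fin.snoc 0 l) (Fin.snoc (Fin.init a) r)
          - ∑ m ∈ multiIndices d (q - l), (a - x) (Fin.last d) ^ l / l.factorial *
            monomialX m (Fin.init (a - x)) * D (Fin.snoc m l) x| ≤ C (q - l) * (B * δ ^ (q + 1)) := by
      intro l hl
      have hl' : l < q + 1 := Finset.mem_range.1 hl
      have e1 : Fin.init (a - x) = Fin.init a - Fin.init x := rfl
      have e2 : (a - x) (Fin.last d) = a (Fin.last d) - r := rfl
      simp_rw [e1, e2, mul_assoc]
      rw [← Finset.mul_sum, ← mul_sub, abs_mul]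
      have h4 : |(a (Fin.last d) - r) ^ l / (l.factorial : ℝ)| ≤ δ ^ l := by
        rw [abs_div, abs_pow, Nat.abs_cast]
        refine (div_le_self (by positivity) ?_).trans
          (pow_le_pow_left₀ (abs_nonneg _) (hax _) _)
        exact_mod_cast Nat.one_le_iff_ne_zero.2 (Nat.factorial_ne_zero l)
      calc _ ≤ δ ^ l * (C (q - l) * B * δ ^ (q - l + 1)) :=
            mul_le_mul h4 (h2 l hl) (abs_nonneg _) (by positivity)
        _ = C (q - l) * (B * (δ ^ l * δ ^ (q - l + 1))) := by ring
        _ = _ := by rw [← pow_add, show l + (q - l + 1) = q + 1 by omega]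
    rw [← sub_add_sub_cancel _ (∑ l ∈ Finset.range (q + 1), (a (Fin.last d) - r) ^ l / l.factorial *
        D (Fin.snoc 0 l) (Fin.snoc (Fin.init a) r)), ← Finset.sum_sub_distrib]
    refine (abs_add_le _ _).trans ?_
    have h5 := (Finset.abs_sum_le_sum_abs _ _).trans (Finset.sum_le_sum h3)
    rw [← Finset.sum_mul] at h5
    linarith

/-! ### The derivatives of the conditional distribution function -/

section Theta

variable {d : ℕ}

/-- The blocks before that of j are empty, so one more derivative in x_j comes at the head of the
list, that is, it is the derivative taken last. -/
theorem flatMap_replicate_add_single (m : Fin d → ℕ) (j : Fin d) (L : List (Fin d))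
    (hL : L.Pairwise (· < ·)) (hm : ∀ i ∈ L, i < j → m i = 0) :
    (L.flatMap fun i => List.replicate ((m + Pi.single j 1 : Fin d → ℕ) i) (some i))
      = if j ∈ L then some j :: L.flatMap fun i => List.replicate (m i) (some i)
        else L.flatMap fun i => List.replicate (m i) (some i) := by
  induction L with
  | nil => simp
  | cons a L ih =>
    rw [List.pairwise_cons] at hL
    have ih' := ih hL.2 fun i hi => hm i (List.mem_cons_of_mem _ hi)
    rw [List.flatMap_cons, ih', List.flatMap_cons]
    by_cases haj : a = j
    · subst haj
      have h1 : a ∉ L := fun h => lt_irrefl _ (hL.1 a h)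
      rw [if_neg h1, if_pos (List.mem_cons_self)]
      simp [List.replicate_succ]
    · have h1 : (m + Pi.single j 1 : Fin d → ℕ) a = m a := by simp [haj]
      rw [h1]
      by_cases hj : j ∈ L
      · rw [if_pos hj, if_pos (List.mem_cons_of_mem _ hj), hm a List.mem_cons_self (hL.1 j hj)]
        simp
      · rw [if_neg hj, if_neg (by simp [hj, Ne.symm haj])]

theorem dirs_succ (μ : ℕ) (m : Fin d → ℕ) : dirs (μ + 1) m = none :: dirs μ m := by
  simp [dirs, List.replicate_succ]

theorem dirs_add_single {m : Fin d → ℕ} {j : Fin d} (hm : ∀ i < j, m i = 0) :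
    dirs 0 (m + Pi.single j 1) = some j :: dirs 0 m := by
  have := flatMap_replicate_add_single m j (List.finRange d) (List.pairwise_lt_finRange d)
    (fun i _ hi => hm i hi)
  rw [if_pos (List.mem_finRange j)] at this
  simpa [dirs] using this

theorem IterPderivExists.of_dirs_add {F : ℝ → (Fin d → ℝ) → ℝ} {μ : ℕ} {m : Fin d → ℕ} (k : ℕ)
    (h : IterPderivExists (dirs (μ + k) m) F) : IterPderivExists (dirs μ m) F := by
  induction k with
  | zero => exact h
  | succ k ih =>
    rw [← add_assoc, dirs_succ] at h
    exact ih h.1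

variable {f : ℝ → (Fin d → ℝ) → ℝ} {s : ℕ}

/-- All the `θ_{μ,m}` of order `s` exist and are continuous. -/
def SmoothOfOrder (f : ℝ → (Fin d → ℝ) → ℝ) (s : ℕ) : Prop :=
  ∀ (μ : ℕ) (m : Fin d → ℕ), μ + ∑ j, m j = s → ThetaExistsContinuous f μ m

theorem theta_zero_zero : theta f 0 0 = condDistFun f := by
  have : dirs 0 (0 : Fin d → ℕ) = [] := by simp [dirs]
  funext y x
  simp [theta, this, iterPderiv]

/-- Derivatives in y are taken last, so padding with them up to order s produces a list of
directions that ends with `dirs μ m`. -/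
theorem SmoothOfOrder.exists_of_le (hs : SmoothOfOrder f s) {μ : ℕ} {m : Fin d → ℕ}
    (h : μ + ∑ j, m j ≤ s) : IterPderivExists (dirs μ m) (condDistFun f) := by
  have h1 := (hs (μ + (s - (μ + ∑ j, m j))) m (by omega)).1
  exact h1.of_dirs_add

theorem SmoothOfOrder.hasDerivWithinAt_y (hs : SmoothOfOrder f s) {μ : ℕ} {m : Fin d → ℕ}
    (h : μ + ∑ j, m j < s) {y : ℝ} (hy : y ∈ unitY) {x : Fin d → ℝ} (hx : x ∈ unitX d) :
    HasDerivWithinAt (fun t => theta f μ m t x) (theta f (μ + 1) m y x) (Icc 0 1) y := by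
  have h1 := hs.exists_of_le (μ := μ + 1) (m := m) (by omega)
  rw [dirs_succ] at h1
  have h2 := (h1.2 y hy x hx).hasDerivWithinAt
  have h3 : theta f (μ + 1) m y x
      = derivWithin (line (iterPderiv (dirs μ m) (condDistFun f)) none y x) (Icc 0 1)
        (coord none y x) := by
    rw [theta, dirs_succ]
    rfl
  rw [h3]
  exact h2

theorem SmoothOfOrder.hasDerivWithinAt_x (hs : SmoothOfOrder f s) {m : Fin d → ℕ} {j : Fin d}
    (hm : ∀ i < j, m i = 0) (h : ∑ j, m j < s) {y : ℝ} (hy : y ∈ unitY) {x : Fin d → ℝ}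
    (hx : x ∈ unitX d) :
    HasDerivWithinAt (fun t => theta f 0 m y (Function.update x j t))
      (theta f 0 (m + Pi.single j 1) y x) (Icc 0 1) (x j) := by
  have h1 := hs.exists_of_le (μ := 0) (m := m + Pi.single j 1)
    (by simp only [Pi.add_apply, Finset.sum_add_distrib, Finset.sum_pi_single', Finset.mem_univ,
      if_true]; omega)
  rw [dirs_add_single hm] at h1
  have h2 := (h1.2 y hy x hx).hasDerivWithinAt
  have h3 : theta f 0 (m + Pi.single j 1) y x
      = derivWithin (line (iterPderiv (dirs 0 m) (condDistFun f)) (some j) y x) (Icc 0 1)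
        (coord (some j) y x) := by
    rw [theta, dirs_add_single hm]
    rfl
  rw [h3]
  exact h2

theorem SmoothOfOrder.continuousOn_y (hs : SmoothOfOrder f s) {μ : ℕ} {m : Fin d → ℕ}
    (h : μ + ∑ j, m j ≤ s) {x : Fin d → ℝ} (hx : x ∈ unitX d) :
    ContinuousOn (fun t => theta f μ m t x) unitY := by
  rcases h.lt_or_eq with h | h
  · exact fun y hy => (hs.hasDerivWithinAt_y h hy hx).continuousWithinAt
  · exact (hs μ m h).2.comp (f := fun t : ℝ => (t, x)) (by fun_prop) fun t ht => ⟨ht, hx⟩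

theorem update_mem_unitX {x : Fin d → ℝ} (hx : x ∈ unitX d) (j : Fin d) {t : ℝ}
    (ht : t ∈ Icc (0 : ℝ) 1) : Function.update x j t ∈ unitX d := by
  rw [mem_unitX]
  intro i
  rcases eq_or_ne i j with rfl | hij
  · simpa using ht
  · simpa [hij] using mem_unitX.1 hx i

theorem isCompact_cube : IsCompact (unitY ×ˢ unitX d) := isCompact_Icc.prod isCompact_Icc

theorem SmoothOfOrder.exists_bound_top (hs : SmoothOfOrder f s) {μ : ℕ} {m : Fin d → ℕ}
    (h : μ + ∑ j, m j = s) : ∃ B, ∀ y ∈ unitY, ∀ x ∈ unitX d, |theta f μ m y x| ≤ B := by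
  obtain ⟨B, hB⟩ := isCompact_cube.exists_bound_of_continuousOn (hs μ m h).2
  exact ⟨B, fun y hy x hx => hB (y, x) ⟨hy, hx⟩⟩

/-- Derivatives of lower order are not known to be continuous, so compactness alone does not bound
them. Induction on n, the number of last coordinates that m may involve. With m0 free of the
coordinate j, the derivatives of θ_{0,m0} along the j-th line are the θ_{0,m0+l e_j}; the case l = 0
is bounded by induction and l = s - |m0| by compactness, and the rest is interpolation. -/
theorem SmoothOfOrder.exists_bound_x (hs : SmoothOfOrder f s)
    (h0 : ∃ A, ∀ y ∈ unitY, ∀ x ∈ unitX d, |condDistFun f y x| ≤ A) (n : ℕ) :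
    ∀ m : Fin d → ℕ, (∀ i : Fin d, (i : ℕ) + n < d → m i = 0) → ∑ j, m j ≤ s →
      ∃ B, ∀ y ∈ unitY, ∀ x ∈ unitX d, |theta f 0 m y x| ≤ B := by
  induction n with
  | zero =>
    intro m hm _
    have : m = 0 := funext fun i => hm i (by simp)
    rw [this, theta_zero_zero]
    exact h0
  | succ n ih =>
    intro m hm hms
    by_cases hnd : d ≤ n
    · exact ih m (fun i hi => by omega) hms
    set j : Fin d := ⟨d - 1 - n, by omega⟩ with hj
    set m0 : Fin d → ℕ := Function.update m j 0 with hm0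
    have hm_eq : m = m0 + Pi.single j (m j) := by
      ext i
      rcases eq_or_ne i j with rfl | hij
      · simp [hm0]
      · simp [hm0, hij]
    have hm0z : ∀ i : Fin d, (i : ℕ) + n < d → m0 i = 0 := fun i hi => by
      rcases eq_or_ne i j with rfl | hij
      · simp [hm0]
      · have h2 : (i : ℕ) ≠ d - 1 - n := fun h => hij (Fin.ext h)
        simp only [hm0, Function.update_of_ne hij]
        exact hm i (by omega)
    have hsum : ∀ l : ℕ, ∑ i, (m0 + Pi.single j l : Fin d → ℕ) i = ∑ i, m0 i + l := fun l => by
      simp only [Pi.add_apply, Finset.sum_add_distrib, Finset.sum_pi_single', Finset.mem_univ,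
        if_true]
    have hms' : ∑ i, m0 i + m j ≤ s := by rw [← hsum, ← hm_eq]; exact hms
    obtain ⟨A, hA⟩ := ih m0 hm0z (by omega)
    obtain ⟨N, hN⟩ : ∃ N, N = s - ∑ i, m0 i := ⟨_, rfl⟩
    obtain ⟨B, hB⟩ := hs.exists_bound_top (μ := 0) (m := m0 + Pi.single j N)
      (by rw [hsum]; omega)
    obtain ⟨C, _, hC⟩ := exists_intermediate_deriv_bound N
    refine ⟨C * (A + B), fun y hy x hx => ?_⟩
    have hlt : ∀ i < j, m0 i = 0 := fun i hi => hm0z i (by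
      have : (i : ℕ) < d - 1 - n := hi
      omega)
    have hB' : ∀ t ∈ Icc (0 : ℝ) 1,
        |theta f 0 (m0 + Pi.single j N) y (Function.update x j t)| ≤ B := fun t ht =>
      hB y hy _ (update_mem_unitX hx j ht)
    have h1 := hC A B (fun l t => theta f 0 (m0 + Pi.single j l) y (Function.update x j t))
      (fun l hl t ht => by
        have h2 := hs.hasDerivWithinAt_x (m := m0 + Pi.single j l) (j := j)
          (fun i hi => by simp [hlt i hi, hi.ne]) (by rw [hsum]; omega) hy
          (update_mem_unitX hx j ht)
        rw [add_assoc, ← Pi.single_add] at h2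
        simpa only [Function.update_idem, Function.update_self] using h2)
      (fun t ht => by
        simpa using hA y hy _ (update_mem_unitX hx j ht))
      hB' (m j) (by omega) (x j)
      (mem_unitX.1 hx j)
    rw [← hm_eq] at h1
    simpa using h1

/-- One more interpolation, in y, between μ = 0 and the top order; the finitely many bounds are then
added. -/
theorem SmoothOfOrder.exists_bound (hs : SmoothOfOrder f s)
    (h0 : ∃ A, ∀ y ∈ unitY, ∀ x ∈ unitX d, |condDistFun f y x| ≤ A) :
    ∃ B, 0 ≤ B ∧ ∀ (μ : ℕ) (m : Fin d → ℕ), μ + ∑ j, m j ≤ s →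
      ∀ y ∈ unitY, ∀ x ∈ unitX d, |theta f μ m y x| ≤ B := by
  have h1 : ∀ (μ : ℕ) (m : Fin d → ℕ), μ + ∑ j, m j ≤ s →
      ∃ B, ∀ y ∈ unitY, ∀ x ∈ unitX d, |theta f μ m y x| ≤ B := by
    intro μ m h
    obtain ⟨A, hA⟩ := hs.exists_bound_x h0 d m (fun i hi => by omega) (by omega)
    obtain ⟨B, hB⟩ := hs.exists_bound_top (μ := s - ∑ j, m j) (m := m) (by omega)
    obtain ⟨C, _, hC⟩ := exists_intermediate_deriv_bound (s - ∑ j, m j)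
    exact ⟨C * (A + B), fun y hy x hx => hC A B (fun l t => theta f l m t x)
      (fun l hl t ht => hs.hasDerivWithinAt_y (by omega) ht hx) (fun t ht => hA t ht x hx)
      (fun t ht => hB t ht x hx) μ (by omega) y hy⟩
  choose! g hg using h1
  refine ⟨∑ μ ∈ Finset.range (s + 1), ∑ m ∈ multiIndices d s, |g μ m|,
    Finset.sum_nonneg fun _ _ => Finset.sum_nonneg fun _ _ => abs_nonneg _, ?_⟩
  intro μ m h y hy x hx
  calc |theta f μ m y x| ≤ |g μ m| := (hg μ m h y hy x hx).trans (le_abs_self _)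
    _ ≤ ∑ m ∈ multiIndices d s, |g μ m| :=
        Finset.single_le_sum (f := fun m => |g μ m|) (fun _ _ => abs_nonneg _)
          (mem_multiIndices.2 (by omega))
    _ ≤ _ := Finset.single_le_sum (f := fun μ => ∑ m ∈ multiIndices d s, |g μ m|)
          (fun _ _ => Finset.sum_nonneg fun _ _ => abs_nonneg _)
          (Finset.mem_range.2 (by omega))

/-! ### Smoothing bias -/

/-- A weight on `[0,1]` concentrated on `[y - h, y + h]`, with total variation at most `W`. -/
structure IsLocalWeight (w : ℝ → ℝ) (y h W : ℝ) : Prop where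
  integrable : IntegrableOn w unitY
  mass : ∫ u in unitY, |w u| ≤ W
  support : ∀ u ∈ unitY, h < |u - y| → w u = 0

theorem measurableSet_unitY : MeasurableSet unitY := measurableSet_Icc

theorem IsLocalWeight.integrable_mul {w : ℝ → ℝ} {y h W : ℝ} (hw : IsLocalWeight w y h W)
    {φ : ℝ → ℝ} (hφ : ContinuousOn φ unitY) : IntegrableOn (fun u => w u * φ u) unitY :=
  IntegrableOn.mul_continuousOn hw.integrable hφ isCompact_Icc

theorem IsLocalWeight.abs_integral_le {w : ℝ → ℝ} {y h W b : ℝ} (hw : IsLocalWeight w y h W)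
    {φ : ℝ → ℝ} (hb0 : 0 ≤ b) (hb : ∀ u ∈ unitY, |u - y| ≤ h → |φ u| ≤ b) :
    |∫ u in unitY, w u * φ u| ≤ b * W := by
  have h1 : ∀ u ∈ unitY, ‖w u * φ u‖ ≤ b * |w u| := fun u hu => by
    rw [Real.norm_eq_abs, abs_mul, mul_comm]
    by_cases h2 : |u - y| ≤ h
    · exact mul_le_mul_of_nonneg_right (hb u hu h2) (abs_nonneg _)
    · rw [hw.support u hu (not_le.1 h2)]
      simp
  have h2 := norm_integral_le_of_norm_le (μ := volume.restrict unitY)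
    (hw.integrable.norm.const_mul b)
    ((ae_restrict_mem measurableSet_unitY).mono fun u hu => h1 u hu)
  refine h2.trans ?_
  rw [integral_const_mul]
  exact mul_le_mul_of_nonneg_left hw.mass hb0

theorem IsLocalWeight.mass_nonneg {w : ℝ → ℝ} {y h W : ℝ} (hw : IsLocalWeight w y h W) : 0 ≤ W :=
  (integral_nonneg fun _ => abs_nonneg _).trans hw.mass

theorem IsLocalWeight.taylor {w : ℝ → ℝ} {y h W B : ℝ} (hw : IsLocalWeight w y h W) (hy : y ∈ unitY)
    (hh : 0 ≤ h) (N : ℕ) (φ : ℕ → ℝ → ℝ)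
    (hφ : ∀ l < N, ∀ t ∈ Icc (0 : ℝ) 1, HasDerivWithinAt (φ l) (φ (l + 1) t) (Icc 0 1) t)
    (hcont : ContinuousOn (φ 0) unitY) (hB : ∀ t ∈ Icc (0 : ℝ) 1, |φ N t| ≤ B) :
    |(∫ u in unitY, w u * φ 0 u)
      - ∑ l ∈ Finset.range N, φ l y / l.factorial * ∫ u in unitY, w u * (u - y) ^ l|
      ≤ B * h ^ N * W := by
  have hB0 : 0 ≤ B := (abs_nonneg _).trans (hB y hy)
  have hpi : ∀ l : ℕ, IntegrableOn (fun u => w u * (u - y) ^ l) unitY := fun l =>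
    hw.integrable_mul (by fun_prop)
  have h1 : (∫ u in unitY, w u * φ 0 u)
      - ∑ l ∈ Finset.range N, φ l y / l.factorial * ∫ u in unitY, w u * (u - y) ^ l
      = ∫ u in unitY, w u * (φ 0 u - ∑ l ∈ Finset.range N, (u - y) ^ l / l.factorial * φ l y) := by
    simp_rw [← integral_const_mul]
    rw [← integral_finsetSum _ fun l _ => (hpi l).const_mul _,
      ← integral_sub (hw.integrable_mul hcont)
        (integrable_finsetSum _ fun l _ => (hpi l).const_mul _)]
    refine integral_congr_ae (Eventually.of_forall fun u => ?_)
    simp only [mul_sub, Finset.mul_sum]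
    congr 1
    exact Finset.sum_congr rfl fun l _ => by ring
  rw [h1]
  refine hw.abs_integral_le (by positivity) fun u hu huy => ?_
  exact (abs_sub_taylor_le N φ hφ hB y hy u hu).trans
    (mul_le_mul_of_nonneg_left (pow_le_pow_left₀ (abs_nonneg _) huy N) hB0)

/-- Dominated convergence for the difference quotients, which the mean value inequality bounds by B.
No regularity of `G'` beyond this bound is needed, which matters since the derivatives of lower
order are only known to be bounded. -/
theorem hasDerivWithinAt_weighted_integral {w : ℝ → ℝ} (hw : IntegrableOn w unitY) {B : ℝ}
    {G G' : ℝ → ℝ → ℝ}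
    (hG : ∀ u ∈ unitY, ∀ t ∈ Icc (0 : ℝ) 1, HasDerivWithinAt (G u) (G' u t) (Icc 0 1) t)
    (hB : ∀ u ∈ unitY, ∀ t ∈ Icc (0 : ℝ) 1, |G' u t| ≤ B)
    (hcont : ∀ t ∈ Icc (0 : ℝ) 1, ContinuousOn (fun u => G u t) unitY) {t : ℝ}
    (ht : t ∈ Icc (0 : ℝ) 1) :
    HasDerivWithinAt (fun t => ∫ u in unitY, w u * G u t) (∫ u in unitY, w u * G' u t)
      (Icc 0 1) t := by
  have hint : ∀ t ∈ Icc (0 : ℝ) 1, IntegrableOn (fun u => w u * G u t) unitY := fun t ht =>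
    IntegrableOn.mul_continuousOn hw (hcont t ht) isCompact_Icc
  rw [hasDerivWithinAt_iff_tendsto_slope]
  have hev : ∀ᶠ r in 𝓝[Icc 0 1 \ {t}] t, r ∈ Icc (0 : ℝ) 1 :=
    eventually_nhdsWithin_of_forall fun r hr => hr.1
  have h1 : ∀ᶠ r in 𝓝[Icc 0 1 \ {t}] t,
      ∫ u in unitY, w u * slope (G u) t r = slope (fun t => ∫ u in unitY, w u * G u t) t r := by
    filter_upwards [hev] with r hr
    simp only [slope_def_field]
    rw [← integral_sub (hint r hr) (hint t ht), ← integral_div]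
    exact integral_congr_ae (Eventually.of_forall fun u => by ring)
  refine Tendsto.congr' h1 ?_
  refine tendsto_integral_filter_of_dominated_convergence (fun u => B * |w u|) ?_ ?_
    (hw.norm.const_mul B) ?_
  · filter_upwards [hev] with r hr
    have h2 : (fun u => w u * slope (G u) t r) = fun u => (w u * G u r - w u * G u t) / (r - t) := by
      funext u
      rw [slope_def_field]
      ring
    rw [h2]
    exact (((hint r hr).sub (hint t ht)).div_const _).aestronglyMeasurable
  · filter_upwards [hev] with r hr
    filter_upwards [ae_restrict_mem measurableSet_unitY] with u hu
    have h2 := Convex.norm_image_sub_le_of_norm_hasDerivWithin_le (hG u hu) (hB u hu)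
      (convex_Icc 0 1) ht hr
    rw [Real.norm_eq_abs, abs_mul, mul_comm]
    refine mul_le_mul_of_nonneg_right ?_ (abs_nonneg _)
    rw [slope_def_field, abs_div]
    refine div_le_of_le_mul₀ (abs_nonneg _) ?_ h2
    exact (abs_nonneg _).trans (hB u hu t ht)
  · filter_upwards [ae_restrict_mem measurableSet_unitY] with u hu
    exact ((hasDerivWithinAt_iff_tendsto_slope.1 (hG u hu t ht))).const_mul _

/-- The remainder of the expansion of `F(u|a)` in `a`, smoothed in `u` by a weight that is orthogonal
to polynomials of degree less than `μ`. -/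
theorem SmoothOfOrder.exists_bias_x (hs : SmoothOfOrder f s)
    (h0 : ∃ A, ∀ y ∈ unitY, ∀ x ∈ unitX d, |condDistFun f y x| ≤ A) {q μ : ℕ}
    (hq : q + 1 + μ ≤ s) :
    ∃ C, 0 ≤ C ∧ ∀ (w : ℝ → ℝ) (y h W : ℝ), IsLocalWeight w y h W → y ∈ unitY → 0 ≤ h →
      (∀ k < μ, ∫ u in unitY, w u * (u - y) ^ k = 0) →
      ∀ x ∈ unitX d, ∀ a ∈ unitX d, (∀ j, |a j - x j| ≤ h) →
        |(∫ u in unitY, w u * condDistFun f u a)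
          - ∑ m ∈ multiIndices d q, monomialX m (a - x) * ∫ u in unitY, w u * theta f 0 m u x|
          ≤ C * W * h ^ (μ + q + 1) := by
  obtain ⟨B, hB0, hB⟩ := hs.exists_bound h0
  obtain ⟨C, hC0, hC⟩ := exists_ordered_taylor_bound d q
  refine ⟨C * B, by positivity, fun w y h W hw hy hh hmom x hx a ha hax => ?_⟩
  -- The Taylor formula is applied after smoothing, to the family of the ∫ w θ_{0,m}. Its members of
  -- order q + 1 are O(h^μ): in the expansion of θ_{0,m} in y to order μ, the moments of w kill
  -- every polynomial term.
  have h1 := hC (fun m z => ∫ u in unitY, w u * theta f 0 m u z) (B * h ^ μ * W) h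
    (fun m j hm hms z hz => by
      have h2 := hasDerivWithinAt_weighted_integral hw.integrable (B := B)
        (G := fun u t => theta f 0 m u (Function.update z j t))
        (G' := fun u t => theta f 0 (m + Pi.single j 1) u (Function.update z j t))
        (fun u hu t ht => by
          simpa using hs.hasDerivWithinAt_x hm (by omega) hu (update_mem_unitX hz j ht))
        (fun u hu t ht => hB 0 _ (by
          simp only [Pi.add_apply, Finset.sum_add_distrib, Finset.sum_pi_single', Finset.mem_univ,
            if_true]
          omega) u hu _ (update_mem_unitX hz j ht))
        (fun t ht => hs.continuousOn_y (by omega) (update_mem_unitX hz j ht))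
        (mem_unitX.1 hz j)
      simpa using h2)
    (by have := hw.mass_nonneg; positivity)
    (fun m hm z hz => by
      have h2 := hw.taylor hy hh μ (B := B) (fun l t => theta f l m t z)
        (fun l hl t ht => hs.hasDerivWithinAt_y (by omega) ht hz)
        (hs.continuousOn_y (by omega) hz)
        (fun t ht => hB μ m (by omega) t ht z hz)
      rw [Finset.sum_eq_zero (fun l hl => by rw [hmom l (Finset.mem_range.1 hl), mul_zero]),
        sub_zero] at h2
      exact h2) x hx a ha hax hh
  rw [theta_zero_zero] at h1
  refine h1.trans (le_of_eq ?_)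
  ring

theorem SmoothOfOrder.exists_bias_y (hs : SmoothOfOrder f s)
    (h0 : ∃ A, ∀ y ∈ unitY, ∀ x ∈ unitX d, |condDistFun f y x| ≤ A) {p : ℕ} {ν : Fin d → ℕ}
    (hp : p + 1 + ∑ j, ν j ≤ s) :
    ∃ C, 0 ≤ C ∧ ∀ (w : ℝ → ℝ) (y h W : ℝ), IsLocalWeight w y h W → y ∈ unitY → 0 ≤ h →
      ∀ x ∈ unitX d,
        |(∫ u in unitY, w u * theta f 0 ν u x) - ∑ l ∈ Finset.range (p + 1),
          theta f l ν y x / l.factorial * ∫ u in unitY, w u * (u - y) ^ l|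
          ≤ C * W * h ^ (p + 1) := by
  obtain ⟨B, hB0, hB⟩ := hs.exists_bound h0
  refine ⟨B, hB0, fun w y h W hw hy hh x hx => ?_⟩
  refine (hw.taylor hy hh (p + 1) (B := B) (fun l t => theta f l ν t x)
    (fun l hl t ht => hs.hasDerivWithinAt_y (by omega) ht hx) (hs.continuousOn_y (by omega) hx)
    (fun t ht => hB _ ν (by omega) t ht x hx)).trans (le_of_eq ?_)
  ring

end Theta

/-! ### Exponential inequality and uniform deviations -/

section Deviation

variable {Ω : Type*} [MeasurableSpace Ω] {P : Measure Ω} [IsProbabilityMeasure P]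

/-- From exp v ≤ 1 + v + v² for |v| ≤ 1, where the linear term has mean zero. The second moment, not
the sup bound, enters the exponent. -/
theorem mgf_le_of_bounded {X : Ω → ℝ} (hX : Measurable X) {M V t : ℝ} (hM : ∀ ω, |X ω| ≤ M)
    (hmean : ∫ ω, X ω ∂P = 0) (hvar : ∫ ω, X ω ^ 2 ∂P ≤ V) (ht : 0 ≤ t) (htM : t * M ≤ 1) :
    mgf X P t ≤ Real.exp (t ^ 2 * V) := by
  have hint : Integrable X P :=
    Integrable.of_bound hX.aestronglyMeasurable M (Eventually.of_forall hM)
  have hint2 : Integrable (fun ω => X ω ^ 2) P :=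
    Integrable.of_bound (hX.pow_const 2).aestronglyMeasurable (M ^ 2)
      (Eventually.of_forall fun ω => by
        rw [Real.norm_eq_abs, abs_pow]
        exact pow_le_pow_left₀ (abs_nonneg _) (hM ω) 2)
  have hle : ∀ ω, Real.exp (t * X ω) ≤ 1 + t * X ω + t ^ 2 * X ω ^ 2 := fun ω => by
    have h1 : |t * X ω| ≤ 1 := by
      rw [abs_mul, abs_of_nonneg ht]
      exact (mul_le_mul_of_nonneg_left (hM ω) ht).trans htM
    have h2 := (abs_le.1 (Real.abs_exp_sub_one_sub_id_le h1)).2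
    rw [mul_pow] at h2
    linarith
  have hi1 : Integrable (fun ω => 1 + t * X ω) P := (integrable_const 1).add (hint.const_mul t)
  have hi : Integrable (fun ω => 1 + t * X ω + t ^ 2 * X ω ^ 2) P :=
    hi1.add (hint2.const_mul (t ^ 2))
  calc mgf X P t ≤ ∫ ω, (1 + t * X ω + t ^ 2 * X ω ^ 2) ∂P := by
        refine integral_mono_of_nonneg (Eventually.of_forall fun ω => (Real.exp_pos _).le) hi
          (Eventually.of_forall hle)
    _ = 1 + t ^ 2 * ∫ ω, X ω ^ 2 ∂P := by
        rw [integral_add hi1 (hint2.const_mul (t ^ 2)),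
          integral_add (integrable_const 1) (hint.const_mul t), integral_const_mul,
          integral_const_mul, hmean]
        simp
    _ ≤ t ^ 2 * V + 1 := by nlinarith [sq_nonneg t]
    _ ≤ Real.exp (t ^ 2 * V) := Real.add_one_le_exp _

theorem measure_sum_ge_le_exp {X : ℕ → Ω → ℝ} (hX : ∀ i, Measurable (X i)) (hind : iIndepFun X P)
    {M V t : ℝ} (hM : ∀ i ω, |X i ω| ≤ M) (hmean : ∀ i, ∫ ω, X i ω ∂P = 0)
    (hvar : ∀ i, ∫ ω, X i ω ^ 2 ∂P ≤ V) (ht : 0 ≤ t) (htM : t * M ≤ 1) (n : ℕ) (ε : ℝ) :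
    P.real {ω | n * ε ≤ ∑ i ∈ Finset.range n, X i ω}
      ≤ Real.exp (n * (t ^ 2 * V - t * ε)) := by
  have hbd : ∀ ω, |(∑ i ∈ Finset.range n, X i) ω| ≤ n * M := fun ω => by
    rw [Finset.sum_apply]
    refine (Finset.abs_sum_le_sum_abs _ _).trans ((Finset.sum_le_sum fun i _ => hM i ω).trans ?_)
    simp
  have hint : Integrable (fun ω => Real.exp (t * (∑ i ∈ Finset.range n, X i) ω)) P := by
    refine Integrable.of_bound (C := Real.exp (t * (n * M))) ?_ (Eventually.of_forall fun ω => ?_)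
    · simp only [Finset.sum_apply]
      exact ((Finset.measurable_sum _ fun i _ => hX i).const_mul t).exp.aestronglyMeasurable
    · rw [Real.norm_eq_abs, Real.abs_exp]
      exact Real.exp_le_exp.2 (mul_le_mul_of_nonneg_left ((le_abs_self _).trans (hbd ω)) ht)
  have h1 := measure_ge_le_exp_mul_mgf (n * ε) ht hint
  rw [hind.mgf_sum hX] at h1
  simp only [Finset.sum_apply] at h1
  refine h1.trans ?_
  calc Real.exp (-t * (n * ε)) * ∏ i ∈ Finset.range n, mgf (X i) P t
      ≤ Real.exp (-t * (n * ε)) * ∏ _i ∈ Finset.range n, Real.exp (t ^ 2 * V) := by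
        refine mul_le_mul_of_nonneg_left (Finset.prod_le_prod (fun i _ => mgf_nonneg) fun i _ => ?_)
          (Real.exp_pos _).le
        exact mgf_le_of_bounded (hX i) (hM i) (hmean i) (hvar i) ht htM
    _ = Real.exp (n * (t ^ 2 * V - t * ε)) := by
        rw [Finset.prod_const, Finset.card_range, ← Real.exp_nat_mul, ← Real.exp_add]
        congr 1
        ring

variable {E : Type*} [MeasurableSpace E] {Z : ℕ → Ω → E} {Q : Measure E}

/-- The Chernoff bound for the centered variables and for their opposites. Centering may double the
sup bound, whence `2 * M`, but does not increase the second moment. -/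
theorem measure_deviation_le_exp (hZ : ∀ i, Measurable (Z i)) (hind : iIndepFun Z P)
    (hlaw : ∀ i, P.map (Z i) = Q) {ξ : E → ℝ} (hξ : Measurable ξ) {M V t : ℝ}
    (hM : ∀ z, |ξ z| ≤ M) (hvar : ∫ z, ξ z ^ 2 ∂Q ≤ V) (ht : 0 ≤ t) (htM : t * (2 * M) ≤ 1)
    (n : ℕ) (ε : ℝ) :
    P.real {ω | n * ε ≤ |∑ i ∈ Finset.range n, (ξ (Z i ω) - ∫ z, ξ z ∂Q)|}
      ≤ 2 * Real.exp (n * (t ^ 2 * V - t * ε)) := by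
  have hQ : IsProbabilityMeasure Q := by
    rw [← hlaw 0]
    exact Measure.isProbabilityMeasure_map (hZ 0).aemeasurable
  have hint : Integrable ξ Q :=
    Integrable.of_bound hξ.aestronglyMeasurable M (Eventually.of_forall hM)
  have hint2 : Integrable (fun z => ξ z ^ 2) Q :=
    Integrable.of_bound (hξ.pow_const 2).aestronglyMeasurable (M ^ 2)
      (Eventually.of_forall fun ω => by
        rw [Real.norm_eq_abs, abs_pow]
        exact pow_le_pow_left₀ (abs_nonneg _) (hM ω) 2)
  set e := ∫ z, ξ z ∂Q with he
  have heM : |e| ≤ M := by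
    have h1 := norm_integral_le_of_norm_le_const (μ := Q) (f := ξ) (C := M)
      (Eventually.of_forall hM)
    simpa using h1
  have hone : ∀ σ : ℝ, σ = 1 ∨ σ = -1 →
      P.real {ω | n * ε ≤ ∑ i ∈ Finset.range n, σ * (ξ (Z i ω) - e)}
        ≤ Real.exp (n * (t ^ 2 * V - t * ε)) := by
    intro σ hσ
    have hσ2 : σ ^ 2 = 1 := by rcases hσ with rfl | rfl <;> norm_num
    have hσa : |σ| = 1 := by rcases hσ with rfl | rfl <;> norm_num
    have hmeas : Measurable fun z => σ * (ξ z - e) := (hξ.sub_const e).const_mul σ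
    have hint' : ∀ (φ : E → ℝ) (i : ℕ), Measurable φ → ∫ ω, φ (Z i ω) ∂P = ∫ z, φ z ∂Q :=
      fun φ i hφ => by
        rw [← hlaw i, integral_map (hZ i).aemeasurable hφ.aestronglyMeasurable]
    refine measure_sum_ge_le_exp (X := fun i ω => σ * (ξ (Z i ω) - e)) (M := 2 * M)
      (fun i => hmeas.comp (hZ i)) (hind.comp (fun _ z => σ * (ξ z - e)) fun _ => hmeas)
      (fun i ω => ?_) (fun i => ?_) (fun i => ?_) ht htM n ε
    · rw [abs_mul, hσa, one_mul]
      exact (abs_sub _ _).trans (by linarith [hM (Z i ω)])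
    · rw [hint' _ i hmeas, integral_const_mul, integral_sub hint (integrable_const e)]
      simp [he]
    · rw [hint' (fun z => (σ * (ξ z - e)) ^ 2) i (hmeas.pow_const 2)]
      have h1 : ∀ z, (σ * (ξ z - e)) ^ 2 = ξ z ^ 2 - 2 * e * ξ z + e ^ 2 := fun z => by
        rw [mul_pow, hσ2]
        ring
      have h2 : Integrable (fun z => ξ z ^ 2 - 2 * e * ξ z) Q := hint2.sub (hint.const_mul _)
      simp_rw [h1]
      rw [integral_add h2 (integrable_const _),
        integral_sub hint2 (hint.const_mul _), integral_const_mul]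
      simp only [integral_const, probReal_univ, smul_eq_mul, one_mul, ← he]
      nlinarith [sq_nonneg e]
  have hsub : {ω | n * ε ≤ |∑ i ∈ Finset.range n, (ξ (Z i ω) - e)|}
      ⊆ {ω | n * ε ≤ ∑ i ∈ Finset.range n, 1 * (ξ (Z i ω) - e)}
        ∪ {ω | n * ε ≤ ∑ i ∈ Finset.range n, (-1) * (ξ (Z i ω) - e)} := by
    intro ω hω
    simp only [mem_ofPred_eq, mem_union, one_mul, neg_mul, Finset.sum_neg_distrib] at hω ⊢
    exact le_abs.1 hω
  refine (measureReal_mono hsub).trans ((measureReal_union_le _ _).trans ?_)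
  have h1 := hone 1 (Or.inl rfl)
  have h2 := hone (-1) (Or.inr rfl)
  linarith

end Deviation

/-! ### Discretization of the unit cube and uniform deviations -/

section Uniform

variable {d : ℕ}

/-- The points of the regular grid of mesh `1 / N`. -/
def gridPoint (N : ℕ) (g : Fin (N + 1) × (Fin d → Fin (N + 1))) : ℝ × (Fin d → ℝ) :=
  ((g.1 : ℕ) / (N : ℝ), fun j => (g.2 j : ℕ) / (N : ℝ))

theorem exists_grid_near {N : ℕ} (hN : 0 < N) {t : ℝ} (ht : t ∈ Icc (0 : ℝ) 1) :
    ∃ k : Fin (N + 1), |t - (k : ℕ) / (N : ℝ)| ≤ 1 / N := by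
  have hN' : (0 : ℝ) < N := by exact_mod_cast hN
  have h0 : 0 ≤ t * N := mul_nonneg ht.1 hN'.le
  have hle : ⌊t * N⌋₊ ≤ N := by
    refine Nat.floor_le_of_le ?_
    nlinarith [ht.2]
  refine ⟨⟨⌊t * N⌋₊, Nat.lt_succ_of_le hle⟩, ?_⟩
  have h1 := Nat.floor_le h0
  have h2 := Nat.lt_floor_add_one (t * N)
  have h3 : t - (⌊t * N⌋₊ : ℝ) / N = (t * N - ⌊t * N⌋₊) / N := by field_simp
  rw [h3, abs_div, abs_of_pos hN', div_le_div_iff_of_pos_right hN', abs_le]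
  constructor <;> linarith

theorem exists_gridPoint_near {N : ℕ} (hN : 0 < N) {τ : ℝ × (Fin d → ℝ)}
    (hτ : τ ∈ unitY ×ˢ unitX d) : ∃ g, dist τ (gridPoint N g) ≤ 1 / N := by
  obtain ⟨k, hk⟩ := exists_grid_near hN hτ.1
  choose r hr using fun j => exists_grid_near hN (mem_unitX.1 hτ.2 j)
  refine ⟨(k, r), ?_⟩
  rw [Prod.dist_eq, max_le_iff]
  exact ⟨hk, (dist_pi_le_iff (by positivity)).2 fun j => hr j⟩

theorem gridPoint_mem {N : ℕ} (hN : 0 < N) (g : Fin (N + 1) × (Fin d → Fin (N + 1))) :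
    gridPoint N g ∈ unitY ×ˢ unitX d := by
  have hN' : (0 : ℝ) < N := by exact_mod_cast hN
  have h1 : ∀ k : Fin (N + 1), ((k : ℕ) / (N : ℝ)) ∈ Icc (0 : ℝ) 1 := fun k =>
    ⟨by positivity, (div_le_one hN').2 (by exact_mod_cast Nat.lt_succ_iff.1 k.2)⟩
  exact ⟨h1 _, mem_unitX.2 fun j => h1 _⟩

variable {Ω : Type*} [MeasurableSpace Ω] {P : Measure Ω} [IsProbabilityMeasure P]
  {Z : ℕ → Ω → ℝ × (Fin d → ℝ)} {Q : Measure (ℝ × (Fin d → ℝ))}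

/-- The deviation of an empirical mean from its expectation. -/
def empDev (Q : Measure (ℝ × (Fin d → ℝ))) (n : ℕ) (z : ℕ → ℝ × (Fin d → ℝ))
    (ξ : ℝ × (Fin d → ℝ) → ℝ) : ℝ :=
  (∑ i ∈ Finset.range n, ξ (z i)) / n - ∫ z, ξ z ∂Q

/-- Uniform deviations of empirical means over a family indexed by the unit cube, with polynomial
Lipschitz constants. -/
theorem exists_uniform_deviation_bound (hZ : ∀ i, Measurable (Z i)) (hind : iIndepFun Z P)
    (hlaw : ∀ i, P.map (Z i) = Q) (ξ : ℕ → ℝ × (Fin d → ℝ) → ℝ × (Fin d → ℝ) → ℝ)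
    (hξ : ∀ n, ∀ τ ∈ unitY ×ˢ unitX d, Measurable (ξ n τ)) {M V : ℕ → ℝ} {L v : ℝ} {B : ℕ} (hv : 0 < v)
    (hM : ∀ᶠ n in atTop, ∀ τ ∈ unitY ×ˢ unitX d, ∀ z, |ξ n τ z| ≤ M n)
    (hvar : ∀ᶠ n in atTop, ∀ τ ∈ unitY ×ˢ unitX d, ∫ z, ξ n τ z ^ 2 ∂Q ≤ V n)
    (hlip : ∀ᶠ n : ℕ in atTop, ∀ τ ∈ unitY ×ˢ unitX d, ∀ τ' ∈ unitY ×ˢ unitX d, ∀ z,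
      |ξ n τ z - ξ n τ' z| ≤ L * (n : ℝ) ^ B * dist τ τ')
    (hV : ∀ᶠ n in atTop, v ≤ V n)
    (hMV : Tendsto (fun n : ℕ => M n ^ 2 * Real.log n / (n * V n)) atTop (𝓝 0))
    {c₁ : ℝ} (hc₁ : 0 < c₁) :
    ∃ c₂ : ℝ, 0 < c₂ ∧ ∀ᶠ n : ℕ in atTop,
      P {ω | ∃ τ ∈ unitY ×ˢ unitX d, c₂ * Real.sqrt (V n * Real.log n / n)
        < |empDev Q n (fun i => Z i ω) (ξ n τ)|} ≤ ENNReal.ofReal ((n : ℝ) ^ (-c₁)) := by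
  have hQ : IsProbabilityMeasure Q := by
    rw [← hlaw 0]
    exact Measure.isProbabilityMeasure_map (hZ 0).aemeasurable
  -- The exponent pays for the union bound: (B+1)(d+1) for the number of grid points, d + 2 for the
  -- constant 2^(d+2) made of the grid count and the two-sided tail. What remains is n^(-c₁).
  set A : ℝ := (B + 1) * (d + 1) + c₁ + (d + 2) with hA
  have hApos : 0 < A := by positivity
  set c : ℝ := 2 * Real.sqrt A with hc
  have hcpos : 0 < c := by positivity
  have hc2 : c ^ 2 = 4 * A := by rw [hc, mul_pow, Real.sq_sqrt hApos.le]; norm_num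
  have hev1 : ∀ᶠ n : ℕ in atTop, M n ^ 2 * Real.log n / (n * V n) < 1 / c ^ 2 :=
    hMV.eventually (gt_mem_nhds (by positivity))
  have hev2 : ∀ᶠ n : ℕ in atTop, 4 * L ^ 2 / v ≤ n :=
    tendsto_natCast_atTop_atTop.eventually (eventually_ge_atTop _)
  refine ⟨c + 1, by positivity, ?_⟩
  filter_upwards [hM, hvar, hlip, hV, hev1, hev2, eventually_ge_atTop 3] with n hM hvar hlip hV h1 h2
    hn3
  have hn0 : (0 : ℝ) < n := by positivity
  have hn1 : (1 : ℝ) ≤ n := by exact_mod_cast (by omega : 1 ≤ n)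
  have hn2 : (2 : ℝ) ≤ n := by exact_mod_cast (by omega : 2 ≤ n)
  have hlog : 1 ≤ Real.log n := by
    rw [Real.le_log_iff_exp_le hn0]
    have : Real.exp 1 < 3 := by linarith [Real.exp_one_lt_d9]
    exact this.le.trans (by exact_mod_cast hn3)
  have hVpos : 0 < V n := hv.trans_le hV
  set s := Real.sqrt (V n * Real.log n / n) with hs
  have hs2 : s ^ 2 = V n * Real.log n / n := Real.sq_sqrt (by positivity)
  have hspos : 0 < s := Real.sqrt_pos.2 (by positivity)
  set N := n ^ (B + 1) with hN
  have hNpos : 0 < N := by positivity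
  have hNr : (N : ℝ) = (n : ℝ) ^ B * n := by rw [hN, Nat.cast_pow, pow_succ]
  have hτ0 := gridPoint_mem (d := d) hNpos (0, fun _ => 0)
  have hM0 : 0 ≤ M n := (abs_nonneg _).trans (hM _ hτ0 0)
  -- This t minimizes t² V - t c s, with minimum -c² s² / (4 V) = -A log n / n. The hypothesis `hMV`
  -- makes it admissible in the moment generating function bound.
  set t := c * s / (2 * V n) with ht
  have htM : t * (2 * M n) ≤ 1 := by
    have h3 : t * (2 * M n) = c * s * M n / V n := by rw [ht]; field_simp
    rw [h3]
    refine (abs_le_one_iff_mul_self_le_one.2 ?_ |> le_trans (le_abs_self _))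
    have h4 : c * s * M n / V n * (c * s * M n / V n) = c ^ 2 * (M n ^ 2 * Real.log n / (n * V n)) := by
      have : c * s * M n / V n * (c * s * M n / V n) = c ^ 2 * s ^ 2 * M n ^ 2 / V n ^ 2 := by
        field_simp
      rw [this, hs2]
      field_simp
    rw [h4]
    rw [lt_div_iff₀ (by positivity)] at h1
    linarith
  have hexp : Real.exp (n * (t ^ 2 * V n - t * (c * s))) = (n : ℝ) ^ (-A) := by
    rw [Real.rpow_def_of_pos hn0]
    congr 1
    have h3 : (n : ℝ) * (t ^ 2 * V n - t * (c * s)) = - (c ^ 2 * s ^ 2 * n / (4 * V n)) := by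
      rw [ht]
      field_simp
      ring
    rw [h3, hs2, hc2]
    field_simp
  have hpt : ∀ g : Fin (N + 1) × (Fin d → Fin (N + 1)),
      P {ω | c * s ≤ |empDev Q n (fun i => Z i ω) (ξ n (gridPoint N g))|}
        ≤ ENNReal.ofReal (2 * (n : ℝ) ^ (-A)) := fun g => by
    have h3 := measure_deviation_le_exp hZ hind hlaw (hξ n _ (gridPoint_mem hNpos g))
      (hM _ (gridPoint_mem hNpos g)) (hvar _ (gridPoint_mem hNpos g)) (by positivity) htM n (c * s)
    rw [hexp] at h3
    rw [← ofReal_measureReal]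
    refine ENNReal.ofReal_le_ofReal (le_trans (measureReal_mono ?_) h3)
    intro ω hω
    simp only [mem_ofPred_eq, empDev] at hω ⊢
    have h4 : ∑ i ∈ Finset.range n, (ξ n (gridPoint N g) (Z i ω) - ∫ z, ξ n (gridPoint N g) z ∂Q)
        = n * ((∑ i ∈ Finset.range n, ξ n (gridPoint N g) (Z i ω)) / n
          - ∫ z, ξ n (gridPoint N g) z ∂Q) := by
      rw [Finset.sum_sub_distrib, Finset.sum_const, Finset.card_range, nsmul_eq_mul]
      field_simp
    rw [h4, abs_mul, abs_of_pos hn0]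
    exact mul_le_mul_of_nonneg_left hω hn0.le
  -- The mesh n^(-(B+1)) reduces the Lipschitz bound L n^B to L / n. Moving to a grid point costs
  -- this twice, in the mean and in the expectation, and s is at least of order n^(-1/2) because V ≥
  -- v.
  have hmesh : 2 * (L * (n : ℝ) ^ B * (1 / N)) ≤ s := by
    have h3 : 2 * (L * (n : ℝ) ^ B * (1 / N)) = 2 * L / n := by
      rw [hNr]
      field_simp
    rw [h3]
    refine Real.le_sqrt_of_sq_le ?_
    rw [div_pow, mul_pow, div_le_div_iff₀ (by positivity) hn0]
    rw [div_le_iff₀ hv] at h2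
    have h5 : n * v ≤ n * (V n * Real.log n) :=
      mul_le_mul_of_nonneg_left (hV.trans (le_mul_of_one_le_right hVpos.le hlog)) hn0.le
    have h6 : 2 ^ 2 * L ^ 2 * n ≤ n * (V n * Real.log n) * n :=
      mul_le_mul_of_nonneg_right (by linarith) hn0.le
    calc _ ≤ _ := h6
      _ = _ := by ring
  have hL : ∀ τ ∈ unitY ×ˢ unitX d, ∀ τ' ∈ unitY ×ˢ unitX d, dist τ τ' ≤ 1 / N → ∀ z,
      |ξ n τ z - ξ n τ' z| ≤ L * (n : ℝ) ^ B * (1 / N) := by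
    intro τ hτ τ' hτ' hd z
    -- A negative L is impossible: the Lipschitz bound fails at two distinct points.
    rcases le_or_gt 0 L with hL | hL
    · exact (hlip τ hτ τ' hτ' z).trans (mul_le_mul_of_nonneg_left hd (by positivity))
    · have h3 := hlip (0, fun _ => 0) ⟨⟨le_rfl, zero_le_one⟩, mem_unitX.2 fun _ => ⟨le_rfl, zero_le_one⟩⟩
        (1, fun _ => 0) ⟨⟨zero_le_one, le_rfl⟩, mem_unitX.2 fun _ => ⟨le_rfl, zero_le_one⟩⟩ z
      have h4 : dist ((0 : ℝ), fun _ : Fin d => (0 : ℝ)) (1, fun _ => 0) = 1 := by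
        simp [Prod.dist_eq]
      rw [h4] at h3
      have h5 : L * (n : ℝ) ^ B < 0 := mul_neg_of_neg_of_pos hL (by positivity)
      have := (abs_nonneg _).trans h3
      linarith
  -- The event over all τ is included in a finite union over the grid, so its own measurability
  -- plays no role.
  have hsub : {ω | ∃ τ ∈ unitY ×ˢ unitX d, (c + 1) * s < |empDev Q n (fun i => Z i ω) (ξ n τ)|}
      ⊆ ⋃ g : Fin (N + 1) × (Fin d → Fin (N + 1)),
        {ω | c * s ≤ |empDev Q n (fun i => Z i ω) (ξ n (gridPoint N g))|} := by
    rintro ω ⟨τ, hτ, hω⟩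
    obtain ⟨g, hg⟩ := exists_gridPoint_near hNpos hτ
    have hg' := gridPoint_mem (d := d) hNpos g
    refine mem_iUnion.2 ⟨g, ?_⟩
    simp only [mem_ofPred_eq]
    have hL' := hL τ hτ _ hg' hg
    set ℓ := L * (n : ℝ) ^ B * (1 / N)
    have hi : ∀ τ ∈ unitY ×ˢ unitX d, Integrable (ξ n τ) Q := fun τ hτ =>
      Integrable.of_bound (hξ n τ hτ).aestronglyMeasurable (M n) (Eventually.of_forall (hM τ hτ))
    have h3 : |empDev Q n (fun i => Z i ω) (ξ n τ) - empDev Q n (fun i => Z i ω) (ξ n (gridPoint N g))|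
        ≤ 2 * ℓ := by
      have h4 : empDev Q n (fun i => Z i ω) (ξ n τ)
          - empDev Q n (fun i => Z i ω) (ξ n (gridPoint N g))
          = (∑ i ∈ Finset.range n, (ξ n τ (Z i ω) - ξ n (gridPoint N g) (Z i ω))) / n
            - ∫ z, (ξ n τ z - ξ n (gridPoint N g) z) ∂Q := by
        rw [integral_sub (hi τ hτ) (hi _ hg'), Finset.sum_sub_distrib]
        simp only [empDev]
        ring
      rw [h4]
      have h5 : |(∑ i ∈ Finset.range n, (ξ n τ (Z i ω) - ξ n (gridPoint N g) (Z i ω))) / n| ≤ ℓ := by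
        rw [abs_div, abs_of_pos hn0, div_le_iff₀ hn0]
        refine (Finset.abs_sum_le_sum_abs _ _).trans
          ((Finset.sum_le_sum fun i _ => hL' (Z i ω)).trans (le_of_eq ?_))
        rw [Finset.sum_const, Finset.card_range, nsmul_eq_mul, mul_comm]
      have h6 : |∫ z, (ξ n τ z - ξ n (gridPoint N g) z) ∂Q| ≤ ℓ := by
        have := norm_integral_le_of_norm_le_const (μ := Q) (C := ℓ)
          (f := fun z => ξ n τ z - ξ n (gridPoint N g) z) (Eventually.of_forall hL')
        simpa using this
      exact (abs_sub _ _).trans (by linarith)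
    have h7 := abs_sub_abs_le_abs_sub (empDev Q n (fun i => Z i ω) (ξ n τ))
      (empDev Q n (fun i => Z i ω) (ξ n (gridPoint N g)))
    have h8 : (c + 1) * s = c * s + s := by ring
    linarith
  refine (measure_mono hsub).trans ((measure_iUnion_le _).trans ?_)
  rw [tsum_fintype]
  refine (Finset.sum_le_sum fun g _ => hpt g).trans ?_
  rw [Finset.sum_const, nsmul_eq_mul, ← ENNReal.ofReal_natCast, ← ENNReal.ofReal_mul (by positivity)]
  refine ENNReal.ofReal_le_ofReal ?_
  have hcard : ((Finset.univ : Finset (Fin (N + 1) × (Fin d → Fin (N + 1)))).card : ℝ)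
      = ((N : ℝ) + 1) ^ (d + 1) := by
    simp [pow_succ, mul_comm]
  rw [hcard]
  have h3 : ((N : ℝ) + 1) ^ (d + 1) ≤ 2 ^ (d + 1) * (n : ℝ) ^ ((B + 1) * (d + 1)) := by
    rw [pow_mul, ← mul_pow]
    refine pow_le_pow_left₀ (by positivity) ?_ _
    have h4 : (1 : ℝ) ≤ N := by exact_mod_cast hNpos
    have h5 : (N : ℝ) = (n : ℝ) ^ (B + 1) := by rw [hN, Nat.cast_pow]
    linarith
  have h4 : (2 : ℝ) ^ (d + 2) ≤ (n : ℝ) ^ (d + 2) := pow_le_pow_left₀ (by norm_num) hn2 _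
  calc ((N : ℝ) + 1) ^ (d + 1) * (2 * (n : ℝ) ^ (-A))
      ≤ (2 ^ (d + 1) * (n : ℝ) ^ ((B + 1) * (d + 1))) * (2 * (n : ℝ) ^ (-A)) :=
        mul_le_mul_of_nonneg_right h3 (by positivity)
    _ = 2 ^ (d + 2) * ((n : ℝ) ^ ((B + 1) * (d + 1)) * (n : ℝ) ^ (-A)) := by ring
    _ ≤ (n : ℝ) ^ (d + 2) * ((n : ℝ) ^ ((B + 1) * (d + 1)) * (n : ℝ) ^ (-A)) :=
        mul_le_mul_of_nonneg_right h4 (by positivity)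
    _ = (n : ℝ) ^ (-c₁) := by
        rw [← Real.rpow_natCast, ← Real.rpow_natCast, ← Real.rpow_add hn0, ← Real.rpow_add hn0]
        congr 1
        rw [hA]
        push_cast
        ring

end Uniform

/-! ### Bounded Lipschitz functions and kernels -/

section BddLip

variable {E : Type*} [PseudoMetricSpace E]

/-- Bounded Lipschitz real functions. -/
def BddLip (φ : E → ℝ) : Prop :=
  ∃ C, 0 ≤ C ∧ (∀ x, |φ x| ≤ C) ∧ ∀ x y, |φ x - φ y| ≤ C * dist x y

theorem BddLip.const (c : ℝ) : BddLip fun _ : E => c :=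
  ⟨|c|, abs_nonneg _, fun _ => le_rfl, fun x y => by
    rw [sub_self, abs_zero]
    positivity⟩

theorem BddLip.mul {φ ψ : E → ℝ} (hφ : BddLip φ) (hψ : BddLip ψ) : BddLip fun x => φ x * ψ x := by
  obtain ⟨A, hA0, hA, hA'⟩ := hφ
  obtain ⟨B, hB0, hB, hB'⟩ := hψ
  refine ⟨2 * (A * B), by positivity, fun x => ?_, fun x y => ?_⟩
  · rw [abs_mul]
    have := mul_le_mul (hA x) (hB x) (abs_nonneg _) hA0
    nlinarith [mul_nonneg hA0 hB0]
  · have e : φ x * ψ x - φ y * ψ y = φ x * (ψ x - ψ y) + (φ x - φ y) * ψ y := by ring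
    rw [e]
    refine (abs_add_le _ _).trans ?_
    rw [abs_mul, abs_mul]
    have h1 := mul_le_mul (hA x) (hB' x y) (abs_nonneg _) hA0
    have h2 := mul_le_mul (hA' x y) (hB y) (abs_nonneg _) (mul_nonneg hA0 dist_nonneg)
    linarith

theorem BddLip.pow {φ : E → ℝ} (hφ : BddLip φ) (k : ℕ) : BddLip fun x => φ x ^ k := by
  induction k with
  | zero => simpa using BddLip.const (E := E) 1
  | succ k ih => simpa only [pow_succ] using ih.mul hφ

theorem BddLip.prod {α : Type*} (s : Finset α) {φ : α → E → ℝ} (hφ : ∀ i, BddLip (φ i)) :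
    BddLip fun x => ∏ i ∈ s, φ i x := by
  classical
  induction s using Finset.induction_on with
  | empty => simpa using BddLip.const (E := E) 1
  | insert i s hi ih => simpa only [Finset.prod_insert hi] using (hφ i).mul ih

theorem BddLip.comp {F : Type*} [PseudoMetricSpace F] {φ : E → ℝ} (hφ : BddLip φ) {g : F → E}
    (hg : ∀ x y, dist (g x) (g y) ≤ dist x y) : BddLip fun x => φ (g x) := by
  obtain ⟨A, hA0, hA, hA'⟩ := hφ
  exact ⟨A, hA0, fun x => hA _, fun x y =>
    (hA' _ _).trans (mul_le_mul_of_nonneg_left (hg x y) hA0)⟩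

theorem BddLip.continuous {φ : E → ℝ} (hφ : BddLip φ) : Continuous φ := by
  obtain ⟨A, hA0, _, hA⟩ := hφ
  exact (LipschitzWith.of_dist_le_mul (K := ⟨A, hA0⟩) fun x y => hA x y).continuous

end BddLip

section Kernel

variable {K : ℝ → ℝ}

/-- The kernel vanishes at 2, and |u - 2| ≤ 3 on its support; this gives the bound 3 C. -/
theorem IsKernel.bddLip (hK : IsKernel K) : BddLip K := by
  obtain ⟨C, hC⟩ := hK.lipschitz
  refine ⟨3 * C, by positivity, fun u => ?_, fun x y => ?_⟩
  · by_cases hu : 1 < |u|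
    · rw [hK.support u hu, abs_zero]
      positivity
    · have h1 := hC.dist_le_mul u 2
      rw [Real.dist_eq, Real.dist_eq, hK.support 2 (by norm_num), sub_zero] at h1
      refine h1.trans ?_
      rw [mul_comm]
      refine mul_le_mul_of_nonneg_right ?_ C.2
      have := abs_le.1 (not_lt.1 hu)
      rw [abs_le]
      constructor <;> linarith
  · have h1 := hC.dist_le_mul x y
    rw [Real.dist_eq] at h1
    refine h1.trans (mul_le_mul_of_nonneg_right ?_ dist_nonneg)
    linarith [C.2, show (0 : ℝ) ≤ C from C.2]

/-- On the support of K the factor s may be replaced by its truncation to [-1, 1], which is bounded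
and Lipschitz. -/
theorem IsKernel.bddLip_pow_mul (hK : IsKernel K) (k : ℕ) : BddLip fun s => s ^ k * K s := by
  have h1 : BddLip fun s : ℝ => max (-1) (min s 1) := by
    refine ⟨1, zero_le_one, fun s => abs_le.2 ⟨le_max_left _ _, max_le (by norm_num)
      (min_le_right _ _)⟩, fun x y => ?_⟩
    rw [one_mul, Real.dist_eq]
    refine (abs_max_sub_max_le_max _ _ _ _).trans ?_
    rw [sub_self, abs_zero]
    refine max_le (abs_nonneg _) ((abs_min_sub_min_le_max _ _ _ _).trans ?_)
    simp
  have h2 := (h1.pow k).mul hK.bddLip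
  convert h2 using 2 with s
  by_cases hs : 1 < |s|
  · rw [hK.support s hs, mul_zero, mul_zero]
  · have := abs_le.1 (not_lt.1 hs)
    rw [min_eq_left this.2, max_eq_right this.1]

/-- Symmetry moves a point of positivity to the right half-line and continuity spreads it to an
interval. Having the interval, and by symmetry its mirror image, on one side of 0 is what makes the
faces of the cube harmless. -/
theorem IsKernel.exists_interval (hK : IsKernel K) : ∃ α β κ : ℝ, 0 ≤ α ∧ α < β ∧ β ≤ 1 ∧ 0 < κ ∧
    ∀ u ∈ Ioo α β, κ ≤ K u := by
  have h1 : ∃ u, 0 < K u := by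
    by_contra! h
    have h2 : K = fun _ => 0 := funext fun u => le_antisymm (h u) (hK.nonneg u)
    have := hK.integral_eq_one
    rw [h2] at this
    simp at this
  obtain ⟨u, hu⟩ := h1
  have hu' : 0 < K |u| := by
    rcases abs_choice u with h | h <;> rw [h]
    · exact hu
    · rwa [hK.symm]
  have hle : |u| ≤ 1 := by
    by_contra! h
    rw [hK.support u h] at hu
    exact lt_irrefl _ hu
  have hopen : IsOpen {s | K |u| / 2 < K s} := isOpen_lt continuous_const hK.bddLip.continuous
  obtain ⟨ε, hε, hball⟩ := Metric.isOpen_iff.1 hopen |u| (by simpa using hu')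
  have h0 := abs_nonneg u
  refine ⟨max (|u| - ε) 0, min (|u| + ε) 1, K |u| / 2, le_max_right _ _, ?_, min_le_right _ _,
    by positivity, fun s hs => ?_⟩
  · rw [max_lt_iff, lt_min_iff, lt_min_iff]
    exact ⟨⟨by linarith, by linarith⟩, ⟨by linarith, one_pos⟩⟩
  · obtain ⟨h3, h4⟩ := hs
    rw [max_lt_iff] at h3
    rw [lt_min_iff] at h4
    have : s ∈ Metric.ball |u| ε := by
      rw [Metric.mem_ball, Real.dist_eq, abs_lt]
      constructor <;> linarith [h3.1, h4.1]
    exact (hball this).le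

/-! ### Local Gram matrices -/

/-- Substituting x = y + h v, the integral dominates κ times the squared combination integrated over
one of finitely many fixed sets `B s`, chosen so that y + h B s stays in S. The constant thus
depends neither on y nor on h, at the boundary as in the interior. -/
theorem exists_local_gram_bound {E : Type*} [NormedAddCommGroup E] [NormedSpace ℝ E]
    [FiniteDimensional ℝ E] [MeasurableSpace E] [BorelSpace E] (m : Measure E) [m.IsAddHaarMeasure]
    {ι σ : Type*} [Fintype ι] [Finite σ] {B : σ → Set E} (hB : ∀ i, IsOpen (B i))
    (hBb : ∀ i, Bornology.IsBounded (B i)) {φ : ι → E → ℝ} (hφ : ∀ i, Continuous (φ i))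
    (hind : ∀ (s : σ) (c : ι → ℝ), (∀ x ∈ B s, ∑ i, c i * φ i x = 0) → c = 0)
    {k : E → ℝ} (hk : Continuous k) (hk0 : ∀ v, 0 ≤ k v) {κ : ℝ} (hκ : 0 < κ)
    (hkB : ∀ s, ∀ v ∈ B s, κ ≤ k v) {S : Set E} (hS : IsCompact S)
    (hBS : ∀ y ∈ S, ∀ h : ℝ, 0 < h → h ≤ 1 / 2 → ∃ s, ∀ v ∈ B s, y + h • v ∈ S) :
    ∃ l : ℝ, 0 < l ∧ ∀ y ∈ S, ∀ h : ℝ, 0 < h → h ≤ 1 / 2 → ∀ c : ι → ℝ,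
      l * ∑ i, c i ^ 2 ≤ ∫ x in S, (∑ i, c i * φ i (h⁻¹ • (x - y))) ^ 2
        * (k (h⁻¹ • (x - y)) / h ^ Module.finrank ℝ E) ∂m := by
  have hint : ∀ (s : σ) (i j : ι), IntegrableOn (fun x => φ i x * φ j x) (B s) m := fun s i j =>
    (((hφ i).mul (hφ j)).continuousOn.integrableOn_compact (hBb s).isCompact_closure).mono_set
      subset_closure
  choose l hl0 hl using fun s => exists_gram_lower_bound m (hB s) φ hφ (hint s) (hind s)
  obtain ⟨l', hl'0, hl'⟩ : ∃ l' : ℝ, 0 < l' ∧ ∀ s, l' ≤ l s := by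
    rcases isEmpty_or_nonempty σ with he | hne
    · exact ⟨1, one_pos, fun s => he.elim s⟩
    · obtain ⟨s0, hs0⟩ := Finite.exists_min l
      exact ⟨l s0, hl0 s0, hs0⟩
  refine ⟨l' * κ, by positivity, fun y hy h hh hh2 c => ?_⟩
  obtain ⟨s, hs⟩ := hBS y hy h hh hh2
  set r := Module.finrank ℝ E with hr
  set p : E → ℝ := fun v => ∑ i, c i * φ i v with hp
  have hpc : Continuous p := continuous_finsetSum _ fun i _ => continuous_const.mul (hφ i)
  set G : E → ℝ := (B s).indicator fun v => p v ^ 2 * κ with hG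
  have hrpos : 0 < h ^ r := by positivity
  have h1 : ∫ x, G (h⁻¹ • (x - y)) / h ^ r ∂m = ∫ v in B s, p v ^ 2 * κ ∂m := by
    rw [integral_div, integral_sub_right_eq_self (μ := m) (fun x => G (h⁻¹ • x)) y,
      Measure.integral_comp_inv_smul_of_nonneg m G hh.le, ← hr, smul_eq_mul,
      mul_div_cancel_left₀ _ hrpos.ne', hG, integral_indicator (hB s).measurableSet]
  have hpt : ∀ x, G (h⁻¹ • (x - y)) / h ^ r
      ≤ p (h⁻¹ • (x - y)) ^ 2 * (k (h⁻¹ • (x - y)) / h ^ r) := fun x => by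
    rw [← mul_div_assoc]
    refine div_le_div_of_nonneg_right ?_ hrpos.le
    simp only [hG, indicator]
    split_ifs with hx
    · exact mul_le_mul_of_nonneg_left (hkB s _ hx) (sq_nonneg _)
    · exact mul_nonneg (sq_nonneg _) (hk0 _)
  have hzero : ∀ x ∉ S, G (h⁻¹ • (x - y)) / h ^ r = 0 := fun x hx => by
    have : h⁻¹ • (x - y) ∉ B s := fun hB' => hx (by
      have := hs _ hB'
      rwa [smul_inv_smul₀ hh.ne', add_sub_cancel] at this)
    simp [hG, this]
  have h2 : ∫ x, G (h⁻¹ • (x - y)) / h ^ r ∂m = ∫ x in S, G (h⁻¹ • (x - y)) / h ^ r ∂m :=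
    (setIntegral_eq_integral_of_forall_compl_eq_zero hzero).symm
  calc l' * κ * ∑ i, c i ^ 2 ≤ (l s * ∑ i, c i ^ 2) * κ := by
        have h3 : 0 ≤ ∑ i, c i ^ 2 := Finset.sum_nonneg fun _ _ => sq_nonneg _
        have h4 := mul_le_mul_of_nonneg_right (hl' s) (mul_nonneg h3 hκ.le)
        linarith
    _ ≤ (∫ v in B s, p v ^ 2 ∂m) * κ := mul_le_mul_of_nonneg_right (hl s c) hκ.le
    _ = ∫ x in S, G (h⁻¹ • (x - y)) / h ^ r ∂m := by
        rw [← h2, h1, integral_mul_const]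
    _ ≤ _ := by
        refine integral_mono_of_nonneg (Eventually.of_forall fun x => ?_) ?_
          (Eventually.of_forall hpt)
        · refine div_nonneg ?_ hrpos.le
          exact indicator_nonneg (fun v _ => mul_nonneg (sq_nonneg _) hκ.le) _
        · refine (Continuous.continuousOn ?_).integrableOn_compact hS
          fun_prop

/-- Half-lines of the two orientations. -/
def orient (α β : ℝ) (b : Bool) : Set ℝ := if b then Ioo α β else Ioo (-β) (-α)

theorem isOpen_orient (α β : ℝ) (b : Bool) : IsOpen (orient α β b) := by
  unfold orient
  split_ifs <;> exact isOpen_Ioo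

theorem orient_subset {α β : ℝ} (hα : 0 ≤ α) (hβ : β ≤ 1) (b : Bool) :
    orient α β b ⊆ Icc (-1) 1 := by
  unfold orient
  split_ifs <;> exact fun u hu => ⟨by linarith [hu.1, hu.2], by linarith [hu.1, hu.2]⟩

theorem orient_infinite {α β : ℝ} (h : α < β) (b : Bool) : (orient α β b).Infinite := by
  unfold orient
  split_ifs
  · exact Ioo_infinite h
  · exact Ioo_infinite (by linarith)

theorem le_kernel_of_mem_orient (hK : IsKernel K) {α β κ : ℝ} (hκ : ∀ u ∈ Ioo α β, κ ≤ K u)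
    {b : Bool} {u : ℝ} (hu : u ∈ orient α β b) : κ ≤ K u := by
  unfold orient at hu
  split_ifs at hu
  · exact hκ u hu
  · rw [← hK.symm]
    exact hκ _ ⟨by linarith [hu.2], by linarith [hu.1]⟩

/-- From the left half of [0,1] there is room h ≤ 1/2 to the right, and from the right half to the
left. -/
theorem exists_orient_add_mem {α β : ℝ} (hα : 0 ≤ α) (hβ : β ≤ 1) {y h : ℝ}
    (hy : y ∈ Icc (0 : ℝ) 1) (hh : 0 < h) (hh2 : h ≤ 1 / 2) :
    ∃ b, ∀ v ∈ orient α β b, y + h * v ∈ Icc (0 : ℝ) 1 := by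
  by_cases hy2 : y ≤ 1 / 2
  · refine ⟨true, fun v hv => ?_⟩
    have hv' : v ∈ Ioo α β := by simpa [orient] using hv
    constructor <;> nlinarith [hv'.1, hv'.2, hy.1]
  · refine ⟨false, fun v hv => ?_⟩
    have hv' : v ∈ Ioo (-β) (-α) := by simpa [orient] using hv
    constructor <;> nlinarith [hv'.1, hv'.2, hy.2]

/-- The monomial `t^k / k!`. -/
def monomialY (k : ℕ) (t : ℝ) : ℝ := t ^ k / k.factorial

theorem continuous_monomialY (k : ℕ) : Continuous (monomialY k) := by
  unfold monomialY
  fun_prop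

theorem continuous_monomialX {d : ℕ} (m : Fin d → ℕ) : Continuous (monomialX m) := by
  unfold monomialX
  fun_prop

theorem IsKernel.exists_gram_bound_y (hK : IsKernel K) (p : ℕ) :
    ∃ l : ℝ, 0 < l ∧ ∀ y ∈ unitY, ∀ h : ℝ, 0 < h → h ≤ 1 / 2 → ∀ c : Fin (p + 1) → ℝ,
      l * ∑ i, c i ^ 2 ≤ ∫ u in unitY,
        (∑ i : Fin (p + 1), c i * monomialY i ((u - y) / h)) ^ 2 * scaledKernelY K h u y := by
  obtain ⟨α, β, κ, hα, hαβ, hβ, hκ, hκK⟩ := hK.exists_interval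
  obtain ⟨l, hl, H⟩ := exists_local_gram_bound (volume : Measure ℝ) (B := orient α β)
    (isOpen_orient α β) (fun b => (Metric.isBounded_Icc (-1) 1).subset (orient_subset hα hβ b))
    (φ := fun (i : Fin (p + 1)) => monomialY i) (fun i => continuous_monomialY i)
    (fun b c hc => by
      unfold orient at hc
      split_ifs at hc
      · exact monomial_linearIndependent_on_Ioo hαβ c hc
      · exact monomial_linearIndependent_on_Ioo (by linarith) c hc)
    hK.bddLip.continuous hK.nonneg hκ (fun b v hv => le_kernel_of_mem_orient hK hκK hv)
    (S := unitY) isCompact_Icc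
    (fun y hy h hh hh2 => exists_orient_add_mem hα hβ hy hh hh2)
  refine ⟨l, hl, fun y hy h hh hh2 c => (H y hy h hh hh2 c).trans (le_of_eq ?_)⟩
  simp only [Module.finrank_self, pow_one, smul_eq_mul, scaledKernelY, div_eq_inv_mul]

theorem scaledKernelX_eq {d : ℕ} (K : ℝ → ℝ) (h : ℝ) (a x : Fin d → ℝ) :
    scaledKernelX K h a x = (∏ j, K ((h⁻¹ • (a - x)) j)) / h ^ d := by
  simp [scaledKernelX, div_eq_inv_mul]

theorem IsKernel.exists_gram_bound_x (hK : IsKernel K) (d q : ℕ) :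
    ∃ l : ℝ, 0 < l ∧ ∀ x ∈ unitX d, ∀ h : ℝ, 0 < h → h ≤ 1 / 2 → ∀ c : multiIndices d q → ℝ,
      l * ∑ i, c i ^ 2 ≤ ∫ a in unitX d,
        (∑ m, c m * monomialX m.1 (h⁻¹ • (a - x))) ^ 2 * scaledKernelX K h a x := by
  obtain ⟨α, β, κ, hα, hαβ, hβ, hκ, hκK⟩ := hK.exists_interval
  obtain ⟨l, hl, H⟩ := exists_local_gram_bound (volume : Measure (Fin d → ℝ))
    (B := fun b : Fin d → Bool => Set.pi univ fun j => orient α β (b j))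
    (fun b => isOpen_set_pi finite_univ fun j _ => isOpen_orient α β (b j))
    (fun b => (isCompact_univ_pi fun _ => isCompact_Icc).isBounded.subset
      (Set.pi_mono fun j _ => orient_subset hα hβ (b j)))
    (φ := fun (m : multiIndices d q) => monomialX m.1) (fun m => continuous_monomialX m.1)
    (fun b c hc => monomialX_linearIndependent_on_box (fun j => orient_infinite hαβ (b j)) c hc)
    (k := fun v => ∏ j, K (v j))
    (continuous_finsetProd _ fun j _ => hK.bddLip.continuous.comp (continuous_apply j))
    (fun v => Finset.prod_nonneg fun j _ => hK.nonneg _) (pow_pos hκ d)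
    (fun b v hv => by
      calc κ ^ d = ∏ _j : Fin d, κ := by simp
        _ ≤ ∏ j, K (v j) := Finset.prod_le_prod (fun _ _ => hκ.le) fun j _ =>
            le_kernel_of_mem_orient hK hκK (hv j (mem_univ j)))
    (S := unitX d) isCompact_Icc
    (fun y hy h hh hh2 => by
      choose b hb using fun j => exists_orient_add_mem hα hβ (mem_unitX.1 hy j) hh hh2
      exact ⟨b, fun v hv => mem_unitX.2 fun j => hb j _ (hv j (mem_univ j))⟩)
  refine ⟨l, hl, fun y hy h hh hh2 c => (H y hy h hh hh2 c).trans (le_of_eq ?_)⟩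
  simp only [Module.finrank_fin_fun, scaledKernelX_eq]

end Kernel

/-! ### The law of the data -/

section Law

variable {d : ℕ}

/-- The projection of the real line to `[0,1]`. -/
def clamp (t : ℝ) : ℝ := max 0 (min t 1)

theorem continuous_clamp : Continuous clamp := by
  unfold clamp
  fun_prop

theorem clamp_mem (t : ℝ) : clamp t ∈ Icc (0 : ℝ) 1 :=
  ⟨le_max_left _ _, max_le zero_le_one (min_le_right _ _)⟩

theorem clamp_of_mem {t : ℝ} (ht : t ∈ Icc (0 : ℝ) 1) : clamp t = t := by
  rw [clamp, min_eq_left ht.2, max_eq_right ht.1]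

/-- The extension of a function on the unit cube which is constant along the fibres of the
projection. -/
def extDensity (f : ℝ → (Fin d → ℝ) → ℝ) (y : ℝ) (x : Fin d → ℝ) : ℝ :=
  f (clamp y) fun j => clamp (x j)

theorem extDensity_of_mem {f : ℝ → (Fin d → ℝ) → ℝ} {y : ℝ} (hy : y ∈ unitY) {x : Fin d → ℝ}
    (hx : x ∈ unitX d) : extDensity f y x = f y x := by
  have h1 : (fun j => clamp (x j)) = x := funext fun j => clamp_of_mem (mem_unitX.1 hx j)
  rw [extDensity, h1, clamp_of_mem hy]

theorem clampX_mem (x : Fin d → ℝ) : (fun j => clamp (x j)) ∈ unitX d :=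
  mem_unitX.2 fun j => clamp_mem (x j)

/-- A density on the unit cube, continuous and between two positive constants. -/
structure IsRegularDensity (f : ℝ → (Fin d → ℝ) → ℝ) (a b : ℝ) : Prop where
  continuous : ContinuousOn (fun z : ℝ × (Fin d → ℝ) => f z.1 z.2) (unitY ×ˢ unitX d)
  pos : 0 < a
  lower : ∀ y ∈ unitY, ∀ x ∈ unitX d, a ≤ f y x
  upper : ∀ y ∈ unitY, ∀ x ∈ unitX d, f y x ≤ b

variable {f : ℝ → (Fin d → ℝ) → ℝ} {a b : ℝ}

namespace IsRegularDensity

theorem continuous_ext (hf : IsRegularDensity f a b) :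
    Continuous fun z : ℝ × (Fin d → ℝ) => extDensity f z.1 z.2 := by
  have h1 : Continuous fun z : ℝ × (Fin d → ℝ) => (clamp z.1, fun j => clamp (z.2 j)) := by
    have := continuous_clamp
    fun_prop
  exact hf.continuous.comp_continuous h1 fun z => ⟨clamp_mem _, clampX_mem _⟩

theorem ext_lower (hf : IsRegularDensity f a b) (y : ℝ) (x : Fin d → ℝ) : a ≤ extDensity f y x :=
  hf.lower _ (clamp_mem _) _ (clampX_mem _)

theorem ext_upper (hf : IsRegularDensity f a b) (y : ℝ) (x : Fin d → ℝ) : extDensity f y x ≤ b :=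
  hf.upper _ (clamp_mem _) _ (clampX_mem _)

theorem ext_abs_le (hf : IsRegularDensity f a b) (y : ℝ) (x : Fin d → ℝ) :
    |extDensity f y x| ≤ b := by
  rw [abs_of_nonneg (hf.pos.le.trans (hf.ext_lower y x))]
  exact hf.ext_upper y x

theorem intervalIntegrable (hf : IsRegularDensity f a b) (x : Fin d → ℝ) (s t : ℝ) :
    IntervalIntegrable (fun y => extDensity f y x) volume s t :=
  (hf.continuous_ext.comp (by fun_prop : Continuous fun y : ℝ => (y, x))).intervalIntegrable _ _

theorem total_lower (hf : IsRegularDensity f a b) (x : Fin d → ℝ) :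
    a ≤ ∫ t in (0 : ℝ)..1, extDensity f t x := by
  have h1 := intervalIntegral.integral_mono_on (μ := volume) zero_le_one
    (intervalIntegrable_const (c := a)) (hf.intervalIntegrable x 0 1)
    fun t _ => hf.ext_lower t x
  simpa using h1

end IsRegularDensity

/-- A continuous extension `F` of the conditional distribution function. -/
structure IsCdfExtension (f F : ℝ → (Fin d → ℝ) → ℝ) (L : ℝ) : Prop where
  continuous : Continuous fun z : ℝ × (Fin d → ℝ) => F z.1 z.2
  mem : ∀ u ∈ unitY, ∀ x, F u x ∈ Icc (0 : ℝ) 1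
  eq : ∀ u ∈ unitY, ∀ x ∈ unitX d, F u x = condDistFun f u x
  lip : ∀ u ∈ unitY, ∀ y ∈ unitY, ∀ x, |F u x - F y x| ≤ L * |u - y|
  centered : ∀ u ∈ unitY, ∀ x, ∫ y in unitY, ((if y ≤ u then 1 else 0) - F u x) * extDensity f y x = 0

/-- Nothing is known of f outside the cube. Extending it through the projection makes the noise
measurable, bounded and conditionally centered at every x, without exceptional sets. The constant b
/ a is an upper bound of the density over a lower bound of its total mass in y. -/
theorem IsRegularDensity.cdfExtension (hf : IsRegularDensity f a b) :
    IsCdfExtension f (condDistFun (extDensity f)) (b / a) := by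
  have hpos : ∀ x, 0 < ∫ t in (0 : ℝ)..1, extDensity f t x := fun x =>
    hf.pos.trans_le (hf.total_lower x)
  have hint := hf.intervalIntegrable
  refine ⟨?_, fun u hu x => ?_, fun u hu x hx => ?_, fun u hu y hy x => ?_, fun u hu x => ?_⟩
  · have hc : Continuous (Function.uncurry fun (x : Fin d → ℝ) t => extDensity f t x) :=
      hf.continuous_ext.comp continuous_swap
    have h1 := intervalIntegral.continuous_parametric_intervalIntegral_of_continuous
      (μ := volume) (a₀ := 0) (f := fun (z : ℝ × (Fin d → ℝ)) t => extDensity f t z.2)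
      (hc.comp (by fun_prop : Continuous fun p : (ℝ × (Fin d → ℝ)) × ℝ => (p.1.2, p.2)))
      (continuous_fst (X := ℝ) (Y := Fin d → ℝ))
    have h2 := intervalIntegral.continuous_parametric_intervalIntegral_of_continuous
      (μ := volume) (a₀ := 0) (f := fun (z : ℝ × (Fin d → ℝ)) t => extDensity f t z.2)
      (hc.comp (by fun_prop : Continuous fun p : (ℝ × (Fin d → ℝ)) × ℝ => (p.1.2, p.2)))
      (continuous_const (y := (1 : ℝ)))
    exact h1.div h2 fun z => (hpos z.2).ne'
  · constructor
    · refine div_nonneg ?_ (hpos x).le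
      exact intervalIntegral.integral_nonneg hu.1 fun t _ => hf.pos.le.trans (hf.ext_lower t x)
    · rw [condDistFun, div_le_one (hpos x)]
      refine intervalIntegral.integral_mono_interval le_rfl hu.1 hu.2
        (Eventually.of_forall fun t => hf.pos.le.trans (hf.ext_lower t x)) (hint x 0 1)
  · have h1 : ∀ u ∈ unitY, ∫ t in (0 : ℝ)..u, extDensity f t x = ∫ t in (0 : ℝ)..u, f t x :=
      fun u hu => intervalIntegral.integral_congr fun t ht => by
        rw [uIcc_of_le hu.1] at ht
        exact extDensity_of_mem ⟨ht.1, ht.2.trans hu.2⟩ hx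
    rw [condDistFun, condDistFun, h1 u hu, h1 1 ⟨zero_le_one, le_rfl⟩]
  · rw [condDistFun, condDistFun, ← sub_div,
      intervalIntegral.integral_interval_sub_left (hint x 0 u) (hint x 0 y), abs_div,
      abs_of_pos (hpos x)]
    have h1 := intervalIntegral.norm_integral_le_of_norm_le_const (a := y) (b := u) (C := b)
      (f := fun t => extDensity f t x) fun t _ => hf.ext_abs_le t x
    rw [div_mul_eq_mul_div]
    have hb : 0 ≤ b := (abs_nonneg _).trans (hf.ext_abs_le 0 0)
    exact div_le_div₀ (by positivity) h1 hf.pos (hf.total_lower x)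
  · have hi : IntegrableOn (fun y => extDensity f y x) unitY := by
      refine Continuous.integrableOn_Icc ?_
      exact hf.continuous_ext.comp (by fun_prop : Continuous fun y : ℝ => (y, x))
    have h1 : ∀ y, ((if y ≤ u then 1 else 0) - condDistFun (extDensity f) u x) * extDensity f y x
        = (Iic u).indicator (fun y => extDensity f y x) y
          - condDistFun (extDensity f) u x * extDensity f y x := fun y => by
      simp only [indicator, mem_Iic, sub_mul, ite_mul, one_mul, zero_mul]
    simp_rw [h1]
    rw [integral_sub (hi.indicator measurableSet_Iic) (hi.const_mul _), integral_const_mul,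
      setIntegral_indicator measurableSet_Iic]
    have h2 : unitY ∩ Iic u = Icc 0 u := by
      ext t
      simp only [unitY, mem_inter_iff, mem_Icc, mem_Iic]
      exact ⟨fun h => ⟨h.1.1, h.2⟩, fun h => ⟨⟨h.1, h.2.trans hu.2⟩, h.2⟩⟩
    rw [h2, unitY, integral_Icc_eq_integral_Ioc, integral_Icc_eq_integral_Ioc,
      ← intervalIntegral.integral_of_le hu.1, ← intervalIntegral.integral_of_le zero_le_one,
      condDistFun, div_mul_cancel₀ _ (hpos x).ne', sub_self]

/-- The common law of the observations. -/
def dataLaw (f : ℝ → (Fin d → ℝ) → ℝ) : Measure (ℝ × (Fin d → ℝ)) :=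
  (volume.restrict (unitY ×ˢ unitX d)).withDensity fun z => ENNReal.ofReal (f z.1 z.2)

theorem measurableSet_cube : MeasurableSet (unitY ×ˢ unitX d) :=
  measurableSet_Icc.prod measurableSet_Icc

theorem dataLaw_eq : dataLaw f = (volume.restrict (unitY ×ˢ unitX d)).withDensity fun z =>
    ENNReal.ofReal (extDensity f z.1 z.2) := by
  refine withDensity_congr_ae ?_
  filter_upwards [ae_restrict_mem measurableSet_cube] with z hz
  rw [extDensity_of_mem hz.1 hz.2]

instance : IsFiniteMeasure ((volume : Measure (ℝ × (Fin d → ℝ))).restrict (unitY ×ˢ unitX d)) :=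
  ⟨by rw [Measure.restrict_apply_univ]; exact isCompact_cube.measure_lt_top⟩

instance : IsFiniteMeasure ((volume : Measure ℝ).restrict unitY) :=
  ⟨by rw [Measure.restrict_apply_univ]; exact isCompact_Icc.measure_lt_top⟩

instance : IsFiniteMeasure ((volume : Measure (Fin d → ℝ)).restrict (unitX d)) :=
  ⟨by rw [Measure.restrict_apply_univ]; exact isCompact_Icc.measure_lt_top⟩

theorem restrict_cube : (volume : Measure (ℝ × (Fin d → ℝ))).restrict (unitY ×ˢ unitX d)
    = (volume.restrict unitY).prod (volume.restrict (unitX d)) := by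
  rw [Measure.prod_restrict]
  rfl

theorem IsRegularDensity.integral_dataLaw (hf : IsRegularDensity f a b)
    (g : ℝ × (Fin d → ℝ) → ℝ) :
    ∫ z, g z ∂(dataLaw f) = ∫ z in unitY ×ˢ unitX d, extDensity f z.1 z.2 * g z := by
  rw [dataLaw_eq, integral_withDensity_eq_integral_toReal_smul
    hf.continuous_ext.measurable.ennreal_ofReal (Eventually.of_forall fun z => ENNReal.ofReal_lt_top)]
  refine integral_congr_ae (Eventually.of_forall fun z => ?_)
  simp only [smul_eq_mul]
  rw [ENNReal.toReal_ofReal (hf.pos.le.trans (hf.ext_lower _ _))]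

theorem ae_dataLaw_mem : ∀ᵐ z ∂(dataLaw f), z ∈ unitY ×ˢ unitX d :=
  (withDensity_absolutelyContinuous _ _).ae_le (ae_restrict_mem measurableSet_cube)

theorem IsRegularDensity.dataLaw_real_le (hf : IsRegularDensity f a b)
    {A : Set (ℝ × (Fin d → ℝ))} (hA : MeasurableSet A) :
    (dataLaw f).real A ≤ b * (volume.restrict (unitY ×ˢ unitX d)).real A := by
  have hb : 0 ≤ b := (abs_nonneg _).trans (hf.ext_abs_le 0 0)
  have h1 : dataLaw f A ≤ ENNReal.ofReal b * (volume.restrict (unitY ×ˢ unitX d)) A := by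
    rw [dataLaw_eq, withDensity_apply _ hA]
    calc _ ≤ ∫⁻ _z in A, ENNReal.ofReal b ∂(volume.restrict (unitY ×ˢ unitX d)) :=
          lintegral_mono fun z => ENNReal.ofReal_le_ofReal (hf.ext_upper _ _)
      _ = _ := by simp
  have h2 := ENNReal.toReal_mono (ENNReal.mul_ne_top ENNReal.ofReal_ne_top (measure_ne_top _ A)) h1
  rwa [ENNReal.toReal_mul, ENNReal.toReal_ofReal hb] at h2

theorem real_restrict_prod_le (s : Set ℝ) (t : Set (Fin d → ℝ)) :
    (volume.restrict (unitY ×ˢ unitX d)).real (s ×ˢ t)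
      = (volume.restrict unitY).real s * (volume.restrict (unitX d)).real t := by
  rw [restrict_cube, measureReal_prod_prod]

theorem real_restrict_closedBall_le (x : Fin d → ℝ) {h : ℝ} (hh : 0 ≤ h) :
    (volume.restrict (unitX d)).real (Metric.closedBall x h) ≤ (2 * h) ^ d := by
  refine (ENNReal.toReal_mono (Metric.isBounded_closedBall.measure_lt_top.ne)
      (Measure.restrict_le_self _)).trans
    (le_of_eq ?_)
  rw [Real.volume_pi_closedBall _ hh, ENNReal.toReal_ofReal (by positivity),
    Fintype.card_fin]

/-- Second moments of functions localized near `x`, with a larger bound near `(y, x)`. -/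
theorem IsRegularDensity.integral_sq_le (hf : IsRegularDensity f a b)
    [IsFiniteMeasure (dataLaw f)] {ξ : ℝ × (Fin d → ℝ) → ℝ}
    {y : ℝ} {x : Fin d → ℝ} {h A B : ℝ} (hh : 0 ≤ h) (hA : 0 ≤ A) (hB : 0 ≤ B)
    (hfar : ∀ z, h < dist z.2 x → ξ z = 0)
    (hle : ∀ z, ξ z ^ 2 ≤ (if dist z.1 y ≤ h then A else 0) + B) :
    ∫ z, ξ z ^ 2 ∂(dataLaw f) ≤ b * (2 * h) ^ d * (A * (2 * h) + B) := by
  have hb : 0 ≤ b := (abs_nonneg _).trans (hf.ext_abs_le 0 0)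
  set A1 : Set (ℝ × (Fin d → ℝ)) := Metric.closedBall y h ×ˢ Metric.closedBall x h with hA1
  set A2 : Set (ℝ × (Fin d → ℝ)) := univ ×ˢ Metric.closedBall x h with hA2
  have hm1 : MeasurableSet A1 := measurableSet_closedBall.prod measurableSet_closedBall
  have hm2 : MeasurableSet A2 := MeasurableSet.univ.prod measurableSet_closedBall
  have hpt : ∀ z, ξ z ^ 2 ≤ A1.indicator (fun _ => A) z + A2.indicator (fun _ => B) z := fun z => by
    by_cases hz : dist z.2 x ≤ h
    · refine (hle z).trans (le_of_eq ?_)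
      simp only [hA1, hA2, indicator, mem_prod, Metric.mem_closedBall, hz, and_true, mem_univ,
        if_true]
    · rw [hfar z (not_le.1 hz)]
      simp only [hA1, hA2, indicator, mem_prod, Metric.mem_closedBall, hz, and_false, if_false]
      norm_num
  have hi1 : Integrable (A1.indicator fun _ => A) (dataLaw f) := (integrable_const A).indicator hm1
  have hi2 : Integrable (A2.indicator fun _ => B) (dataLaw f) := (integrable_const B).indicator hm2
  have hx := real_restrict_closedBall_le x hh
  have hy : (volume.restrict unitY).real (Metric.closedBall y h) ≤ 2 * h := by
    refine (ENNReal.toReal_mono (Metric.isBounded_closedBall.measure_lt_top.ne)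
      (Measure.restrict_le_self _)).trans
      (le_of_eq ?_)
    rw [Real.volume_closedBall, ENNReal.toReal_ofReal (by positivity)]
  have hu : (volume.restrict unitY).real univ = 1 := by
    simp [measureReal_def, unitY]
  have hp1 : (dataLaw f).real A1 ≤ b * ((2 * h) * (2 * h) ^ d) := by
    refine (hf.dataLaw_real_le hm1).trans (mul_le_mul_of_nonneg_left ?_ hb)
    rw [hA1, real_restrict_prod_le]
    exact mul_le_mul hy hx measureReal_nonneg (by positivity)
  have hp2 : (dataLaw f).real A2 ≤ b * (2 * h) ^ d := by
    refine (hf.dataLaw_real_le hm2).trans (mul_le_mul_of_nonneg_left ?_ hb)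
    rw [hA2, real_restrict_prod_le, hu, one_mul]
    exact hx
  calc ∫ z, ξ z ^ 2 ∂(dataLaw f)
      ≤ ∫ z, (A1.indicator (fun _ => A) z + A2.indicator (fun _ => B) z) ∂(dataLaw f) :=
        integral_mono_of_nonneg (Eventually.of_forall fun z => sq_nonneg _) (hi1.add hi2)
          (Eventually.of_forall hpt)
    _ = (dataLaw f).real A1 * A + (dataLaw f).real A2 * B := by
        rw [integral_add hi1 hi2, integral_indicator_const _ hm1, integral_indicator_const _ hm2,
          smul_eq_mul, smul_eq_mul]
    _ ≤ b * ((2 * h) * (2 * h) ^ d) * A + b * (2 * h) ^ d * B :=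
        add_le_add (mul_le_mul_of_nonneg_right hp1 hA) (mul_le_mul_of_nonneg_right hp2 hB)
    _ = _ := by ring

theorem IsRegularDensity.le_integral_snd (hf : IsRegularDensity f a b) {g : (Fin d → ℝ) → ℝ}
    (hg : Continuous g) (hg0 : ∀ x, 0 ≤ g x) :
    a * ∫ x in unitX d, g x ≤ ∫ z, g z.2 ∂(dataLaw f) := by
  have hc := hf.continuous_ext
  rw [hf.integral_dataLaw]
  have h1 : ∫ z in unitY ×ˢ unitX d, a * g z.2 = a * ∫ x in unitX d, g x := by
    rw [integral_const_mul, restrict_cube, integral_fun_snd]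
    simp [measureReal_def, unitY]
  rw [← h1]
  refine integral_mono_of_nonneg
    (Eventually.of_forall fun z => mul_nonneg hf.pos.le (hg0 _)) ?_
    (Eventually.of_forall fun z => mul_le_mul_of_nonneg_right (hf.ext_lower _ _) (hg0 _))
  exact (Continuous.continuousOn (by fun_prop)).integrableOn_compact isCompact_cube

/-! ### The centered indicators -/

/-- `1(y ≤ u) - F(u|x)`. -/
def noise (F : ℝ → (Fin d → ℝ) → ℝ) (z : ℝ × (Fin d → ℝ)) (u : ℝ) : ℝ :=
  (if z.1 ≤ u then 1 else 0) - F u z.2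

variable {F : ℝ → (Fin d → ℝ) → ℝ} {L : ℝ}

theorem IsCdfExtension.abs_noise_le (hF : IsCdfExtension f F L) {u : ℝ} (hu : u ∈ unitY)
    (z : ℝ × (Fin d → ℝ)) : |noise F z u| ≤ 1 := by
  have h1 := hF.mem u hu z.2
  rw [noise, abs_le]
  split_ifs <;> constructor <;> linarith [h1.1, h1.2]

theorem IsCdfExtension.measurable_noise (hF : IsCdfExtension f F L) :
    Measurable fun r : (ℝ × (Fin d → ℝ)) × ℝ => noise F r.1 r.2 := by
  unfold noise
  refine Measurable.sub (Measurable.ite ?_ measurable_const measurable_const) ?_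
  · exact measurableSet_le (by fun_prop) (by fun_prop)
  · exact hF.continuous.measurable.comp
      (by fun_prop : Measurable fun r : (ℝ × (Fin d → ℝ)) × ℝ => (r.2, r.1.2))

theorem IsCdfExtension.integrableOn_mul_noise (hF : IsCdfExtension f F L) {w : ℝ → ℝ}
    (hw : IntegrableOn w unitY) (z : ℝ × (Fin d → ℝ)) :
    IntegrableOn (fun u => w u * noise F z u) unitY := by
  refine Integrable.mul_bdd (c := 1) hw ?_ ?_
  · exact (hF.measurable_noise.comp
      (by fun_prop : Measurable fun u : ℝ => (z, u))).aestronglyMeasurable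
  · filter_upwards [ae_restrict_mem measurableSet_unitY] with u hu
    exact hF.abs_noise_le hu z

theorem IsCdfExtension.abs_integral_noise_le (hF : IsCdfExtension f F L) {w : ℝ → ℝ}
    (hw : IntegrableOn w unitY) (z : ℝ × (Fin d → ℝ)) :
    |∫ u in unitY, w u * noise F z u| ≤ ∫ u in unitY, |w u| := by
  refine norm_integral_le_of_norm_le (f := fun u => w u * noise F z u) hw.norm ?_
  filter_upwards [ae_restrict_mem measurableSet_unitY] with u hu
  rw [Real.norm_eq_abs, abs_mul]
  exact mul_le_of_le_one_right (abs_nonneg _) (hF.abs_noise_le hu z)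

theorem IsCdfExtension.measurable_integral_noise (hF : IsCdfExtension f F L) {w : ℝ → ℝ}
    (hw : Measurable w) : Measurable fun z => ∫ u in unitY, w u * noise F z u := by
  have h1 : StronglyMeasurable fun r : (ℝ × (Fin d → ℝ)) × ℝ => w r.2 * noise F r.1 r.2 :=
    ((hw.comp measurable_snd).mul hF.measurable_noise).stronglyMeasurable
  exact (h1.integral_prod_right (ν := volume.restrict unitY)).measurable

/-- By Fubini the integral over y can be taken innermost: for fixed u and x, the centered indicator
integrates to zero against the density, and φ does not involve y. -/
theorem IsRegularDensity.integral_noise_eq_zero (hf : IsRegularDensity f a b)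
    (hF : IsCdfExtension f F L) {w : ℝ → ℝ} (hw : IntegrableOn w unitY)
    {φ : (Fin d → ℝ) → ℝ} (hφ : Continuous φ) {C : ℝ} (hC : ∀ x, |φ x| ≤ C) :
    ∫ z, φ z.2 * (∫ u in unitY, w u * noise F z u) ∂(dataLaw f) = 0 := by
  rw [hf.integral_dataLaw]
  have hcont := hf.continuous_ext
  have hb : 0 ≤ b := (abs_nonneg _).trans (hf.ext_abs_le 0 0)
  have h1 : ∀ z : ℝ × (Fin d → ℝ),
      extDensity f z.1 z.2 * (φ z.2 * ∫ u in unitY, w u * noise F z u)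
        = ∫ u in unitY, w u * (extDensity f z.1 z.2 * φ z.2 * noise F z u) := fun z => by
    rw [← mul_assoc, ← integral_const_mul]
    exact integral_congr_ae (Eventually.of_forall fun u => by ring)
  have hmeas : Measurable fun r : (ℝ × (Fin d → ℝ)) × ℝ =>
      extDensity f r.1.1 r.1.2 * φ r.1.2 * noise F r.1 r.2 :=
    (((hcont.measurable).comp measurable_fst).mul
      (hφ.measurable.comp (measurable_snd.comp measurable_fst))).mul hF.measurable_noise
  have hbd : ∀ u ∈ unitY, ∀ z : ℝ × (Fin d → ℝ),
      |extDensity f z.1 z.2 * φ z.2 * noise F z u| ≤ b * C := fun u hu z => by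
    rw [abs_mul, abs_mul]
    refine (mul_le_of_le_one_right (by positivity) (hF.abs_noise_le hu z)).trans ?_
    exact mul_le_mul (hf.ext_abs_le _ _) (hC _) (abs_nonneg _) hb
  simp_rw [h1]
  rw [integral_integral_swap]
  · refine integral_eq_zero_of_ae ?_
    filter_upwards [ae_restrict_mem measurableSet_unitY] with u hu
    rw [Pi.zero_apply, integral_const_mul, restrict_cube, integral_prod_symm]
    · have h2 : ∀ x, ∫ y in unitY, extDensity f y x * φ x * noise F (y, x) u = 0 := fun x => by
        have h3 : ∀ y, extDensity f y x * φ x * noise F (y, x) u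
            = φ x * (((if y ≤ u then 1 else 0) - F u x) * extDensity f y x) := fun y => by
          rw [noise]
          ring
        simp_rw [h3]
        rw [integral_const_mul, hF.centered u hu x, mul_zero]
      simp [h2]
    · refine Integrable.of_bound (C := b * C) ?_ (Eventually.of_forall fun z => hbd u hu z)
      exact (hmeas.comp
        (by fun_prop : Measurable fun z : ℝ × (Fin d → ℝ) => (z, u))).aestronglyMeasurable
  · have hw' : Integrable (fun r : (ℝ × (Fin d → ℝ)) × ℝ => w r.2)
        ((volume.restrict (unitY ×ˢ unitX d)).prod (volume.restrict unitY)) := hw.comp_snd _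
    refine Integrable.mul_bdd (c := b * C) hw' hmeas.aestronglyMeasurable ?_
    have h4 : ∀ᵐ r ∂((volume.restrict (unitY ×ˢ unitX d)).prod (volume.restrict unitY)),
        r.2 ∈ unitY :=
      (Measure.quasiMeasurePreserving_snd).ae (ae_restrict_mem measurableSet_unitY)
    filter_upwards [h4] with r hr
    exact hbd r.2 hr r.1

end Law

/-! ### Smoothing in the scalar variable -/

theorem exists_uniform_bddLip {E ι : Type*} [PseudoMetricSpace E] [Fintype ι] {φ : ι → E → ℝ}
    (hφ : ∀ i, BddLip (φ i)) : ∃ C, 0 ≤ C ∧ (∀ i x, |φ i x| ≤ C) ∧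
      ∀ i x y, |φ i x - φ i y| ≤ C * dist x y := by
  choose C hC0 hC hC' using hφ
  have hle : ∀ i, C i ≤ ∑ i, C i := fun i =>
    Finset.single_le_sum (fun i _ => hC0 i) (Finset.mem_univ i)
  exact ⟨∑ i, C i, Finset.sum_nonneg fun i _ => hC0 i, fun i x => (hC i x).trans (hle i),
    fun i x y => (hC' i x y).trans (mul_le_mul_of_nonneg_right (hle i) dist_nonneg)⟩

/-- The criteria use monomials in x_i - x and u - y, not divided by h, so their quadratic forms
degenerate as h → 0. In the coefficients multiplied by r, later powers of h, the matrix is S, whose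
coercivity is uniform. The poorer constant l ρ² only serves to identify the minimizer. -/
theorem argmin_quadratic_scaled {ι : Type*} [Fintype ι] {l A : ℝ} {S : ι → ι → ℝ} {b r : ι → ℝ}
    {Q : (ι → ℝ) → ℝ} (hS : Coercive l S) (hl : 0 < l) (hsymm : ∀ i j, S i j = S j i)
    (hr : ∀ i, 0 < r i)
    (hQ : ∀ c, Q c = A - 2 * ∑ i, (r i * b i) * c i + ∑ i, ∑ j, c i * (r i * S i j * r j) * c j)
    (i : ι) : ∑ j, S i j * (r j * argmin Q j) = b i := by
  obtain ⟨ρ, hρ0, hρ⟩ : ∃ ρ : ℝ, 0 < ρ ∧ ∀ i, ρ ≤ r i := by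
    rcases isEmpty_or_nonempty ι with he | hne
    · exact ⟨1, one_pos, fun i => he.elim i⟩
    · obtain ⟨i0, hi0⟩ := Finite.exists_min r
      exact ⟨r i0, hr i0, hi0⟩
  have hS' : Coercive (l * ρ ^ 2) fun i j => r i * S i j * r j := fun c => by
    have h1 := hS fun i => r i * c i
    calc l * ρ ^ 2 * ∑ i, c i ^ 2 ≤ l * ∑ i, (r i * c i) ^ 2 := by
          rw [mul_assoc, Finset.mul_sum]
          refine mul_le_mul_of_nonneg_left (Finset.sum_le_sum fun i _ => ?_) hl.le
          rw [mul_pow]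
          exact mul_le_mul_of_nonneg_right (pow_le_pow_left₀ hρ0.le (hρ i) 2) (sq_nonneg _)
      _ ≤ _ := h1
      _ = _ := Finset.sum_congr rfl fun i _ => Finset.sum_congr rfl fun j _ => by ring
  have h2 := argmin_quadratic hS' (by positivity) (fun i j => by rw [hsymm i j]; ring) hQ i
  have h3 : r i * ∑ j, S i j * (r j * argmin Q j) = r i * b i := by
    rw [← h2, Finset.mul_sum]
    exact Finset.sum_congr rfl fun j _ => by ring
  exact mul_left_cancel₀ (hr i).ne' h3

/-- A continuous function between two positive constants. -/
structure IsPositiveWeight (g : ℝ → ℝ) (g₀ g₁ : ℝ) : Prop where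
  continuous : Continuous g
  pos : 0 < g₀
  lower : ∀ u, g₀ ≤ g u
  upper : ∀ u, g u ≤ g₁

/-- The weighted local monomials. -/
def psi (K g : ℝ → ℝ) (h : ℝ) (k : ℕ) (y u : ℝ) : ℝ :=
  monomialY k ((u - y) / h) * scaledKernelY K h u y * g u

/-- Weights whose integrals against the centered indicators determine the stochastic error of the
`μ`-th coefficient; for `μ > 0` they integrate to zero. -/
def zetaWeight (K g : ℝ → ℝ) (h : ℝ) (μ k : ℕ) (y u : ℝ) : ℝ :=
  if μ = 0 then psi K g h k y u
  else (∫ v in unitY, psi K g h 0 y v) * psi K g h k y u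
    - (∫ v in unitY, psi K g h k y v) * psi K g h 0 y u

section Smoothing

variable {K g : ℝ → ℝ} {g₀ g₁ : ℝ} {p : ℕ}

theorem IsKernel.bddLip_monomialY_mul (hK : IsKernel K) (k : ℕ) :
    BddLip fun s => monomialY k s * K s := by
  convert (BddLip.const (E := ℝ) (1 / (k.factorial : ℝ))).mul (hK.bddLip_pow_mul k) using 2 with s
  rw [monomialY]
  ring

theorem continuous_psi (hK : IsKernel K) (hg : IsPositiveWeight g g₀ g₁) (h : ℝ) (k : ℕ) (y : ℝ) :
    Continuous (psi K g h k y) := by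
  have h1 := continuous_monomialY k
  have h2 := hK.bddLip.continuous
  have h3 := hg.continuous
  unfold psi scaledKernelY
  fun_prop

theorem integrableOn_unitY {φ : ℝ → ℝ} (hφ : Continuous φ) : IntegrableOn φ unitY :=
  hφ.integrableOn_Icc

theorem psi_eq_zero (hK : IsKernel K) {h : ℝ} (hh : 0 < h) {k : ℕ} {y u : ℝ} (hu : h < |u - y|) :
    psi K g h k y u = 0 := by
  have : K ((u - y) / h) = 0 := hK.support _ (by
    rw [abs_div, abs_of_pos hh, lt_div_iff₀ hh, one_mul]
    exact hu)
  simp [psi, scaledKernelY, this]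

theorem real_restrict_unitY_closedBall_le (y : ℝ) {h : ℝ} (hh : 0 ≤ h) :
    (volume.restrict unitY).real (Metric.closedBall y h) ≤ 2 * h := by
  refine (ENNReal.toReal_mono (Metric.isBounded_closedBall.measure_lt_top.ne)
    (Measure.restrict_le_self _)).trans (le_of_eq ?_)
  rw [Real.volume_closedBall, ENNReal.toReal_ofReal (by positivity)]

/-- `psi` is of size 1/h on an interval of length 2h, and its slope in y is of order 1/h². Integral
bounds are the right ones, since these weights are paired with a noise bounded by 1. -/
theorem exists_psi_bounds (hK : IsKernel K) (hg : IsPositiveWeight g g₀ g₁) (p : ℕ) :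
    ∃ C, 0 ≤ C ∧ ∀ h : ℝ, 0 < h → ∀ k : Fin (p + 1),
      (∀ y, ∫ u in unitY, |psi K g h k y u| ≤ C) ∧
      ∀ y y', ∫ u in unitY, |psi K g h k y u - psi K g h k y' u| ≤ C / h ^ 2 * |y - y'| := by
  obtain ⟨C, hC0, hC, hC'⟩ := exists_uniform_bddLip (φ := fun (k : Fin (p + 1)) s => monomialY k s * K s)
    (fun k => hK.bddLip_monomialY_mul k)
  have hg1 : 0 ≤ g₁ := hg.pos.le.trans ((hg.lower 0).trans (hg.upper 0))
  have hgabs : ∀ u, |g u| ≤ g₁ := fun u => by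
    rw [abs_of_nonneg (hg.pos.le.trans (hg.lower u))]
    exact hg.upper u
  have hpsi : ∀ h k y u, psi K g h k y u
      = (monomialY k ((u - y) / h) * K ((u - y) / h)) / h * g u := fun h k y u => by
    rw [psi, scaledKernelY]
    ring
  refine ⟨2 * (C * g₁), by positivity, fun h hh k => ⟨fun y => ?_, fun y y' => ?_⟩⟩
  · have h1 : ∀ u, |psi K g h k y u|
        ≤ (Metric.closedBall y h).indicator (fun _ => C / h * g₁) u := fun u => by
      by_cases hu : |u - y| ≤ h
      · rw [indicator_of_mem (by simpa [Real.dist_eq] using hu), hpsi, abs_mul, abs_div,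
          abs_of_pos hh]
        exact mul_le_mul (div_le_div_of_nonneg_right (hC k _) hh.le) (hgabs u) (abs_nonneg _)
          (by positivity)
      · rw [psi_eq_zero hK hh (not_le.1 hu), abs_zero]
        exact indicator_nonneg (fun _ _ => by positivity) _
    calc ∫ u in unitY, |psi K g h k y u|
        ≤ ∫ u in unitY, (Metric.closedBall y h).indicator (fun _ => C / h * g₁) u :=
          integral_mono_of_nonneg (Eventually.of_forall fun _ => abs_nonneg _)
            ((integrable_const _).indicator measurableSet_closedBall) (Eventually.of_forall h1)
      _ = (volume.restrict unitY).real (Metric.closedBall y h) * (C / h * g₁) := by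
          rw [integral_indicator_const _ measurableSet_closedBall, smul_eq_mul]
      _ ≤ (2 * h) * (C / h * g₁) :=
          mul_le_mul_of_nonneg_right (real_restrict_unitY_closedBall_le y hh.le) (by positivity)
      _ = _ := by field_simp
  · have h1 : ∀ u ∈ unitY, ‖|psi K g h k y u - psi K g h k y' u|‖ ≤ C * g₁ / h ^ 2 * |y - y'| := by
      intro u _
      rw [Real.norm_eq_abs, abs_abs, hpsi, hpsi, ← sub_mul, ← sub_div, abs_mul, abs_div,
        abs_of_pos hh]
      have h2 := hC' k ((u - y) / h) ((u - y') / h)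
      have h3 : dist ((u - y) / h) ((u - y') / h) = |y - y'| / h := by
        rw [Real.dist_eq, ← sub_div, abs_div, abs_of_pos hh, abs_sub_comm]
        congr 2
        ring
      rw [h3] at h2
      calc _ ≤ C * (|y - y'| / h) / h * g₁ :=
            mul_le_mul (div_le_div_of_nonneg_right h2 hh.le) (hgabs u) (abs_nonneg _)
              (by positivity)
        _ = _ := by field_simp
    have h2 := norm_setIntegral_le_of_norm_le_const (μ := volume) (s := unitY)
      (by simp [unitY]) h1
    have h3 : volume.real unitY = 1 := by simp [unitY]
    rw [h3, mul_one] at h2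
    refine (le_abs_self _).trans (h2.trans ?_)
    refine mul_le_mul_of_nonneg_right (div_le_div_of_nonneg_right ?_ (by positivity))
      (abs_nonneg _)
    nlinarith [mul_nonneg hC0 hg1]

theorem continuous_zetaWeight (hK : IsKernel K) (hg : IsPositiveWeight g g₀ g₁) (h : ℝ) (μ k : ℕ)
    (y : ℝ) : Continuous (zetaWeight K g h μ k y) := by
  have h1 := continuous_psi hK hg h k y
  have h2 := continuous_psi hK hg h 0 y
  unfold zetaWeight
  split_ifs <;> fun_prop

variable {d : ℕ} {f F : ℝ → (Fin d → ℝ) → ℝ} {L : ℝ}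

/-- The smoothed centered indicators. -/
def zeta (F : ℝ → (Fin d → ℝ) → ℝ) (K g : ℝ → ℝ) (h : ℝ) (μ k : ℕ) (y : ℝ)
    (z : ℝ × (Fin d → ℝ)) : ℝ :=
  ∫ u in unitY, zetaWeight K g h μ k y u * noise F z u

theorem zeta_eq (hK : IsKernel K) (hg : IsPositiveWeight g g₀ g₁) (hF : IsCdfExtension f F L)
    (h : ℝ) {μ : ℕ} (hμ : μ ≠ 0) (k : ℕ) (y : ℝ) (z : ℝ × (Fin d → ℝ)) :
    zeta F K g h μ k y z
      = (∫ v in unitY, psi K g h 0 y v) * (∫ u in unitY, psi K g h k y u * noise F z u)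
        - (∫ v in unitY, psi K g h k y v) * ∫ u in unitY, psi K g h 0 y u * noise F z u := by
  have hi : ∀ k, IntegrableOn (fun u => psi K g h k y u * noise F z u) unitY := fun k =>
    hF.integrableOn_mul_noise (integrableOn_unitY (continuous_psi hK hg h k y)) z
  rw [zeta, ← integral_const_mul, ← integral_const_mul,
    ← integral_sub ((hi k).const_mul _) ((hi 0).const_mul _)]
  refine integral_congr_ae (Eventually.of_forall fun u => ?_)
  simp only [zetaWeight, if_neg hμ]
  ring

/-- The indicators at u and y differ only if z.1 lies between them, hence within h of y; the
Lipschitz bound on F accounts for the rest. -/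
theorem IsCdfExtension.abs_noise_sub_le (hF : IsCdfExtension f F L) {u y h : ℝ}
    (hu : u ∈ unitY) (hy : y ∈ unitY) (huy : |u - y| ≤ h) (hL : 0 ≤ L) (z : ℝ × (Fin d → ℝ)) :
    |noise F z u - noise F z y| ≤ (if dist z.1 y ≤ h then 1 else 0) + L * h := by
  have h1 := (hF.lip u hu y hy z.2).trans (mul_le_mul_of_nonneg_left huy hL)
  have e : noise F z u - noise F z y = ((if z.1 ≤ u then 1 else 0) - (if z.1 ≤ y then 1 else 0))
      - (F u z.2 - F y z.2) := by
    rw [noise, noise]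
    ring
  rw [e]
  refine (abs_sub _ _).trans (add_le_add ?_ h1)
  by_cases hz : dist z.1 y ≤ h
  · rw [if_pos hz]
    split_ifs <;> norm_num
  · rw [if_neg hz]
    rw [Real.dist_eq, not_le, lt_abs] at hz
    have h2 := abs_le.1 huy
    rcases hz with hz | hz
    · rw [if_neg (by linarith), if_neg (by linarith [abs_nonneg (u - y)])]
      simp
    · rw [if_pos (by linarith), if_pos (by linarith [abs_nonneg (u - y)])]
      simp

/-- Size, localization and Lipschitz bounds for the smoothed centered indicators. -/
theorem exists_zeta_bounds (hK : IsKernel K) (hg : IsPositiveWeight g g₀ g₁)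
    (hF : IsCdfExtension f F L) (hL : 0 ≤ L) (p μ : ℕ) :
    ∃ C, 0 ≤ C ∧ ∀ h : ℝ, 0 < h → h ≤ 1 → ∀ k : Fin (p + 1),
      (∀ y z, |zeta F K g h μ k y z| ≤ C) ∧
      (∀ y y' z, |zeta F K g h μ k y z - zeta F K g h μ k y' z| ≤ C / h ^ 2 * |y - y'|) ∧
      (μ ≠ 0 → ∀ y ∈ unitY, ∀ z,
        zeta F K g h μ k y z ^ 2 ≤ (if dist z.1 y ≤ h then C else 0) + C * h ^ 2) := by
  obtain ⟨C, hC0, hC⟩ := exists_psi_bounds hK hg p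
  have hzero : ((0 : Fin (p + 1)) : ℕ) = 0 := rfl
  have hi : ∀ h k y, IntegrableOn (psi K g h k y) unitY := fun h k y =>
    integrableOn_unitY (continuous_psi hK hg h k y)
  have hin : ∀ h k y z, IntegrableOn (fun u => psi K g h k y u * noise F z u) unitY :=
    fun h k y z => hF.integrableOn_mul_noise (hi h k y) z
  -- the unsmoothed quantities
  have ha : ∀ h : ℝ, 0 < h → ∀ (k : Fin (p + 1)) y, |∫ u in unitY, psi K g h k y u| ≤ C :=
    fun h hh k y => (abs_integral_le_integral_abs).trans ((hC h hh k).1 y)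
  have hN : ∀ h : ℝ, 0 < h → ∀ (k : Fin (p + 1)) y z,
      |∫ u in unitY, psi K g h k y u * noise F z u| ≤ C := fun h hh k y z =>
    (hF.abs_integral_noise_le (hi h k y) z).trans ((hC h hh k).1 y)
  have ha' : ∀ h : ℝ, 0 < h → ∀ (k : Fin (p + 1)) y y',
      |(∫ u in unitY, psi K g h k y u) - ∫ u in unitY, psi K g h k y' u| ≤ C / h ^ 2 * |y - y'| :=
    fun h hh k y y' => by
      rw [← integral_sub (hi h k y) (hi h k y')]
      exact (abs_integral_le_integral_abs).trans ((hC h hh k).2 y y')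
  have hN' : ∀ h : ℝ, 0 < h → ∀ (k : Fin (p + 1)) y y' z,
      |(∫ u in unitY, psi K g h k y u * noise F z u) - ∫ u in unitY, psi K g h k y' u * noise F z u|
        ≤ C / h ^ 2 * |y - y'| := fun h hh k y y' z => by
    rw [← integral_sub (hin h k y z) (hin h k y' z)]
    simp_rw [← sub_mul]
    exact (hF.abs_integral_noise_le ((hi h k y).sub (hi h k y')) z).trans ((hC h hh k).2 y y')
  rcases eq_or_ne μ 0 with rfl | hμ
  · refine ⟨C, hC0, fun h hh _ k => ⟨fun y z => ?_, fun y y' z => ?_, fun h => absurd rfl h⟩⟩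
    · simpa [zeta, zetaWeight] using hN h hh k y z
    · simpa [zeta, zetaWeight] using hN' h hh k y y' z
  -- D covers the sup bound 2 C², the Lipschitz constant 4 C² and, through δ² ≤ 2 · 1(|z.1 - y| ≤ h)
  -- + 2 L² h², the bounds 8 C⁴ and 8 C⁴ L² for the square.
  · set D := 4 * C ^ 2 + 8 * C ^ 4 * (1 + L ^ 2) with hD
    have hD0 : 0 ≤ D := by positivity
    have hD1 : 4 * C ^ 2 ≤ D := by rw [hD]; linarith [show 0 ≤ 8 * C ^ 4 * (1 + L ^ 2) by positivity]
    have hD2 : 8 * C ^ 4 * (1 + L ^ 2) ≤ D := by rw [hD]; linarith [show 0 ≤ 4 * C ^ 2 by positivity]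
    refine ⟨D, hD0, fun h hh hh1 k => ⟨fun y z => ?_, fun y y' z => ?_, fun _ y hy z => ?_⟩⟩
    · rw [zeta_eq hK hg hF h hμ]
      refine (abs_sub _ _).trans ?_
      rw [abs_mul, abs_mul]
      have h1 := mul_le_mul (ha h hh 0 y) (hN h hh k y z) (abs_nonneg _) hC0
      have h2 := mul_le_mul (ha h hh k y) (hN h hh 0 y z) (abs_nonneg _) hC0
      rw [hzero] at h1 h2
      nlinarith
    · rw [zeta_eq hK hg hF h hμ, zeta_eq hK hg hF h hμ]
      have key : ∀ a b c e a' b' c' e' r : ℝ, |a| ≤ C → |b'| ≤ C → |c| ≤ C → |e'| ≤ C → 0 ≤ r →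
          |a - a'| ≤ r → |b - b'| ≤ r → |c - c'| ≤ r → |e - e'| ≤ r →
          |a * b - c * e - (a' * b' - c' * e')| ≤ 4 * (C * r) := by
        intro a b c e a' b' c' e' r h1 h2 h3 h4 hr h5 h6 h7 h8
        have e1 : a * b - c * e - (a' * b' - c' * e')
            = (a * (b - b') + (a - a') * b') - (c * (e - e') + (c - c') * e') := by ring
        rw [e1]
        refine (abs_sub _ _).trans ?_
        have i1 := abs_add_le (a * (b - b')) ((a - a') * b')
        have i2 := abs_add_le (c * (e - e')) ((c - c') * e')
        rw [abs_mul, abs_mul] at i1 i2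
        have j1 := mul_le_mul h1 h6 (abs_nonneg _) hC0
        have j2 := mul_le_mul h5 h2 (abs_nonneg _) hr
        have j3 := mul_le_mul h3 h8 (abs_nonneg _) hC0
        have j4 := mul_le_mul h7 h4 (abs_nonneg _) hr
        linarith
      refine (key _ _ _ _ _ _ _ _ (C / h ^ 2 * |y - y'|) (ha h hh 0 y) (hN h hh k y' z)
        (ha h hh k y) (hN h hh 0 y' z) (by positivity) (ha' h hh 0 y y') (hN' h hh k y y' z)
        (ha' h hh k y y') (hN' h hh 0 y y' z)).trans ?_
      have e2 : 4 * (C * (C / h ^ 2 * |y - y'|)) = 4 * C ^ 2 / h ^ 2 * |y - y'| := by ring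
      rw [e2]
      exact mul_le_mul_of_nonneg_right (div_le_div_of_nonneg_right hD1 (by positivity))
        (abs_nonneg _)
    · -- subtracting the value at `y` does not change `zeta`
      set δ : ℝ := (if dist z.1 y ≤ h then 1 else 0) + L * h with hδ
      have hδ0 : 0 ≤ δ := by rw [hδ]; split_ifs <;> positivity
      have hloc : ∀ k : Fin (p + 1), IsLocalWeight (psi K g h k y) y h C := fun k =>
        ⟨hi h k y, (hC h hh k).1 y, fun u _ hu => psi_eq_zero hK hh hu⟩
      have hM : ∀ k : Fin (p + 1),
          |(∫ u in unitY, psi K g h k y u * noise F z u)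
            - (∫ u in unitY, psi K g h k y u) * noise F z y| ≤ δ * C := fun k => by
        rw [← integral_mul_const, ← integral_sub (hin h k y z) ((hi h k y).mul_const _)]
        simp_rw [← mul_sub]
        exact (hloc k).abs_integral_le hδ0 fun u hu huy => hF.abs_noise_sub_le hu hy huy hL z
      have hz : |zeta F K g h μ k y z| ≤ 2 * C ^ 2 * δ := by
        rw [zeta_eq hK hg hF h hμ]
        -- The determinant is unchanged when the noise is shifted by a constant r; the choice r =
        -- noise at y makes both factors small.
        have e1 : ∀ a b c e r : ℝ, a * b - c * e = a * (b - c * r) - c * (e - a * r) :=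
          fun a b c e r => by ring
        rw [e1 _ _ _ _ (noise F z y)]
        refine (abs_sub _ _).trans ?_
        rw [abs_mul, abs_mul]
        have h1 := mul_le_mul (ha h hh 0 y) (hM k) (abs_nonneg _) hC0
        have h2 := mul_le_mul (ha h hh k y) (hM 0) (abs_nonneg _) hC0
        rw [hzero] at h1 h2
        linarith
      have hz2 : zeta F K g h μ k y z ^ 2 ≤ (2 * C ^ 2 * δ) ^ 2 := by
        rw [← sq_abs]
        exact pow_le_pow_left₀ (abs_nonneg _) hz 2
      refine hz2.trans ?_
      have h3 : δ ^ 2 ≤ 2 * (if dist z.1 y ≤ h then 1 else 0) + 2 * (L ^ 2 * h ^ 2) := by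
        rw [hδ]
        split_ifs
        · nlinarith [sq_nonneg (1 - L * h)]
        · nlinarith [mul_nonneg (sq_nonneg L) (sq_nonneg h)]
      have h4 : (2 * C ^ 2 * δ) ^ 2 = 4 * C ^ 4 * δ ^ 2 := by ring
      rw [h4]
      have h5 := mul_le_mul_of_nonneg_left h3 (show 0 ≤ 4 * C ^ 4 by positivity)
      have h6 : 8 * C ^ 4 ≤ D := by
        refine le_trans ?_ hD2
        nlinarith [mul_nonneg (show 0 ≤ 8 * C ^ 4 by positivity) (sq_nonneg L)]
      have h7 : 8 * C ^ 4 * L ^ 2 ≤ D := by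
        refine le_trans ?_ hD2
        nlinarith [show 0 ≤ 8 * C ^ 4 by positivity]
      have h8 := mul_le_mul_of_nonneg_right h7 (sq_nonneg h)
      split_ifs at h5 ⊢ <;> nlinarith

/-- The local Gram matrix in the scalar variable. -/
def gramY (K g : ℝ → ℝ) (h : ℝ) (y : ℝ) (i j : Fin (p + 1)) : ℝ :=
  ∫ u in unitY, monomialY i ((u - y) / h) * monomialY j ((u - y) / h)
    * (scaledKernelY K h u y * g u)

theorem integral_gram {X ι : Type*} [MeasurableSpace X] {m : Measure X} [Fintype ι] {φ : ι → X → ℝ}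
    {κ : X → ℝ} (hint : ∀ i j, Integrable (fun x => φ i x * φ j x * κ x) m) (c : ι → ℝ) :
    ∫ x, (∑ i, c i * φ i x) ^ 2 * κ x ∂m
      = ∑ i, ∑ j, c i * (∫ x, φ i x * φ j x * κ x ∂m) * c j := by
  have hexp : ∀ x, (∑ i, c i * φ i x) ^ 2 * κ x
      = ∑ i, ∑ j, c i * c j * (φ i x * φ j x * κ x) := fun x => by
    rw [sq, Finset.sum_mul_sum, Finset.sum_mul]
    refine Finset.sum_congr rfl fun i _ => ?_
    rw [Finset.sum_mul]
    exact Finset.sum_congr rfl fun j _ => by ring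
  simp_rw [hexp]
  rw [integral_finsetSum _ fun i _ => integrable_finsetSum _ fun j _ => (hint i j).const_mul _]
  refine Finset.sum_congr rfl fun i _ => ?_
  rw [integral_finsetSum _ fun j _ => (hint i j).const_mul _]
  refine Finset.sum_congr rfl fun j _ => ?_
  rw [integral_const_mul]
  ring

theorem integral_criterion {X ι : Type*} [MeasurableSpace X] {m : Measure X} [Fintype ι]
    {φ : ι → X → ℝ} {κ γ : X → ℝ} (hint : ∀ i j, Integrable (fun x => φ i x * φ j x * κ x) m)
    (h1 : ∀ i, Integrable (fun x => γ x * φ i x * κ x) m) (h2 : Integrable (fun x => γ x ^ 2 * κ x) m)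
    (c : ι → ℝ) :
    ∫ x, (γ x - ∑ i, φ i x * c i) ^ 2 * κ x ∂m
      = (∫ x, γ x ^ 2 * κ x ∂m) - 2 * ∑ i, (∫ x, γ x * φ i x * κ x ∂m) * c i
        + ∑ i, ∑ j, c i * (∫ x, φ i x * φ j x * κ x ∂m) * c j := by
  have hexp : ∀ x, (γ x - ∑ i, φ i x * c i) ^ 2 * κ x
      = γ x ^ 2 * κ x - 2 * ∑ i, (γ x * φ i x * κ x) * c i + (∑ i, c i * φ i x) ^ 2 * κ x := fun x => by
    have e1 : ∑ i, (γ x * φ i x * κ x) * c i = γ x * κ x * ∑ i, φ i x * c i := by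
      rw [Finset.mul_sum]
      exact Finset.sum_congr rfl fun i _ => by ring
    have e2 : ∑ i, c i * φ i x = ∑ i, φ i x * c i := Finset.sum_congr rfl fun i _ => mul_comm _ _
    rw [e1, e2]
    ring
  have i1 : Integrable (fun x => ∑ i, (γ x * φ i x * κ x) * c i) m :=
    integrable_finsetSum _ fun i _ => (h1 i).mul_const _
  have i2 : Integrable (fun x => (∑ i, c i * φ i x) ^ 2 * κ x) m := by
    have hexp2 : ∀ x, (∑ i, c i * φ i x) ^ 2 * κ x
        = ∑ i, ∑ j, c i * c j * (φ i x * φ j x * κ x) := fun x => by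
      rw [sq, Finset.sum_mul_sum, Finset.sum_mul]
      refine Finset.sum_congr rfl fun i _ => ?_
      rw [Finset.sum_mul]
      exact Finset.sum_congr rfl fun j _ => by ring
    simp_rw [hexp2]
    exact integrable_finsetSum _ fun i _ => integrable_finsetSum _ fun j _ =>
      (hint i j).const_mul _
  have i3 : Integrable (fun x => γ x ^ 2 * κ x - 2 * ∑ i, (γ x * φ i x * κ x) * c i) m :=
    h2.sub (i1.const_mul 2)
  simp_rw [hexp]
  rw [integral_add i3 i2, integral_sub h2 (i1.const_mul 2), integral_const_mul, integral_gram hint,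
    integral_finsetSum _ fun i _ => (h1 i).mul_const _]
  simp_rw [integral_mul_const]

theorem continuous_gramY_integrand (hK : IsKernel K) (hg : IsPositiveWeight g g₀ g₁) (h y : ℝ)
    (i j : ℕ) : Continuous fun u => monomialY i ((u - y) / h) * monomialY j ((u - y) / h)
      * (scaledKernelY K h u y * g u) := by
  have hKc := hK.bddLip.continuous
  have hgc := hg.continuous
  have hi := continuous_monomialY i
  have hj := continuous_monomialY j
  unfold scaledKernelY
  fun_prop

theorem exists_coercive_gramY (hK : IsKernel K) (hg : IsPositiveWeight g g₀ g₁) (p : ℕ) :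
    ∃ l, 0 < l ∧ ∀ y ∈ unitY, ∀ h : ℝ, 0 < h → h ≤ 1 / 2 → Coercive l (gramY (p := p) K g h y) := by
  obtain ⟨l, hl, H⟩ := hK.exists_gram_bound_y p
  refine ⟨g₀ * l, mul_pos hg.pos hl, fun y hy h hh hh2 c => ?_⟩
  have hKc := hK.bddLip.continuous
  have hgc := hg.continuous
  have hmc := continuous_monomialY
  unfold gramY
  rw [← integral_gram (m := volume.restrict unitY)
    (φ := fun (i : Fin (p + 1)) u => monomialY i ((u - y) / h)) (fun i j =>
    integrableOn_unitY (continuous_gramY_integrand hK hg h y i j)), mul_assoc]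
  refine (mul_le_mul_of_nonneg_left (H y hy h hh hh2 c) hg.pos.le).trans ?_
  rw [← integral_const_mul]
  have hs : ∀ u, 0 ≤ (∑ i : Fin (p + 1), c i * monomialY i ((u - y) / h)) ^ 2
      * scaledKernelY K h u y := fun u =>
    mul_nonneg (sq_nonneg _) (div_nonneg (hK.nonneg _) hh.le)
  refine integral_mono_of_nonneg (Eventually.of_forall fun u => mul_nonneg hg.pos.le (hs u)) ?_
    (Eventually.of_forall fun u => ?_)
  · unfold scaledKernelY
    exact integrableOn_unitY (by fun_prop)
  · simp only
    rw [mul_comm, ← mul_assoc]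
    exact mul_le_mul_of_nonneg_left (hg.lower u) (hs u)

theorem gramY_symm (h y : ℝ) (i j : Fin (p + 1)) : gramY K g h y i j = gramY K g h y j i := by
  unfold gramY
  exact integral_congr_ae (Eventually.of_forall fun u => by
    simp only [mul_comm (monomialY i ((u - y) / h))])

theorem gramY_eq (h y : ℝ) (i j : Fin (p + 1)) :
    gramY K g h y i j = ∫ u in unitY, psi K g h i y u * monomialY j ((u - y) / h) := by
  unfold gramY psi
  exact integral_congr_ae (Eventually.of_forall fun u => by ring)

/-- The coefficients of the local polynomial smoother in `y` are integrals against local weights. -/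
theorem exists_dual_weight (hK : IsKernel K) (hg : IsPositiveWeight g g₀ g₁) (p : ℕ) :
    ∃ C, 0 ≤ C ∧ ∀ y ∈ unitY, ∀ h : ℝ, 0 < h → h ≤ 1 / 2 → ∀ μ : Fin (p + 1), ∃ w : ℝ → ℝ,
      IsLocalWeight w y h C ∧
      (∀ j : Fin (p + 1), ∫ u in unitY, w u * (u - y) ^ (j : ℕ)
        = if j = μ then h ^ (μ : ℕ) * (μ : ℕ).factorial else 0) ∧
      (∀ (γ : ℝ → ℝ) (B : ℝ), Measurable γ → (∀ u, |γ u| ≤ B) →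
        h ^ (μ : ℕ) * argmin (fun b : Fin (p + 1) → ℝ => ∫ u in unitY,
          (γ u - ∑ k : Fin (p + 1), (u - y) ^ (k : ℕ) / (k : ℕ).factorial * b k) ^ 2
            * scaledKernelY K h u y * g u) μ = ∫ u in unitY, w u * γ u) ∧
      ∀ {d : ℕ} {f F : ℝ → (Fin d → ℝ) → ℝ} {L : ℝ}, IsCdfExtension f F L →
        ∃ c : Fin (p + 1) → ℝ, (∀ k, |c k| ≤ C) ∧
          ∀ z, ∫ u in unitY, w u * noise F z u = ∑ k, c k * zeta F K g h μ k y z := by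
  obtain ⟨l, hl, hcoer⟩ := exists_coercive_gramY hK hg p
  obtain ⟨D, hD0, hD⟩ := exists_psi_bounds hK hg p
  set C := (p + 1) * (1 / l * D) + 1 / l + 1 / l * (1 / l) with hC
  have hC1 : (p + 1) * (1 / l * D) ≤ C := by
    have h1 : 0 ≤ 1 / l := by positivity
    rw [hC]
    nlinarith
  have hC2 : 1 / l ≤ C := by
    have h1 : 0 ≤ 1 / l := by positivity
    have h2 : 0 ≤ (p + 1) * (1 / l * D) := by positivity
    rw [hC]
    nlinarith
  have hC3 : 1 / l * (1 / l) ≤ C := by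
    have h1 : 0 ≤ 1 / l := by positivity
    have h2 : 0 ≤ (p + 1) * (1 / l * D) := by positivity
    rw [hC]
    linarith
  refine ⟨C, by positivity, fun y hy h hh hh2 μ => ?_⟩
  have hM := hcoer y hy h hh hh2
  obtain ⟨α, hα, hdual⟩ := hM.exists_dual hl (gramY_symm h y) μ
  have hpc : ∀ k, Continuous (psi K g h k y) := fun k => continuous_psi hK hg h k y
  have hpi : ∀ k, IntegrableOn (psi K g h k y) unitY := fun k => integrableOn_unitY (hpc k)
  have hpa : ∀ k, IntegrableOn (fun u => |psi K g h k y u|) unitY := fun k => (hpi k).norm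
  -- The vector α is the row μ of the inverse Gram matrix. Pairing it with the columns gives the
  -- moments of the weight w defined from it.
  have hδ : ∀ j, ∑ i, α i * gramY K g h y i j = if j = μ then 1 else 0 := fun j => by
    have h1 := hdual (Pi.single j 1) (fun i => gramY K g h y i j) (fun i => by
      simp [Pi.single_apply])
    rw [← h1, Pi.single_apply]
    simp only [eq_comm]
  set w : ℝ → ℝ := fun u => ∑ i : Fin (p + 1), α i * psi K g h i y u with hw
  have hwint : ∀ φ : ℝ → ℝ, (∀ i : Fin (p + 1), IntegrableOn (fun u => psi K g h i y u * φ u) unitY) →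
      ∫ u in unitY, w u * φ u = ∑ i : Fin (p + 1), α i * ∫ u in unitY, psi K g h i y u * φ u :=
    fun φ hφ => by
      simp_rw [hw, Finset.sum_mul, mul_assoc]
      rw [integral_finsetSum _ fun i _ => (hφ i).const_mul _]
      simp_rw [integral_const_mul]
  have hmom : ∀ j : Fin (p + 1), ∫ u in unitY, w u * monomialY j ((u - y) / h)
      = if j = μ then 1 else 0 := fun j => by
    have hj := continuous_monomialY j
    rw [hwint (fun u => monomialY j ((u - y) / h)) fun i =>
      integrableOn_unitY ((hpc i).mul (hj.comp (by fun_prop))), ← hδ]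
    simp_rw [gramY_eq]
  refine ⟨w, ⟨?_, ?_, ?_⟩, fun j => ?_, fun γ B hγ hB => ?_, fun {d f F L} hF => ?_⟩
  · exact integrable_finsetSum _ fun i _ => (hpi i).const_mul _
  · calc ∫ u in unitY, |w u| ≤ ∫ u in unitY, ∑ i : Fin (p + 1), 1 / l * |psi K g h i y u| := by
          refine integral_mono_of_nonneg (Eventually.of_forall fun _ => abs_nonneg _)
            (integrable_finsetSum _ fun i _ => (hpa i).const_mul _)
            (Eventually.of_forall fun u => ?_)
          refine (Finset.abs_sum_le_sum_abs _ _).trans (Finset.sum_le_sum fun i _ => ?_)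
          rw [abs_mul]
          exact mul_le_mul_of_nonneg_right (hα i) (abs_nonneg _)
      _ = ∑ i : Fin (p + 1), 1 / l * ∫ u in unitY, |psi K g h i y u| := by
          rw [integral_finsetSum _ fun (i : Fin (p + 1)) _ => (hpa i).const_mul _]
          simp_rw [integral_const_mul]
      _ ≤ ∑ _i : Fin (p + 1), 1 / l * D := Finset.sum_le_sum fun i _ =>
          mul_le_mul_of_nonneg_left ((hD h hh i).1 y) (by positivity)
      _ = (p + 1) * (1 / l * D) := by simp
      _ ≤ C := hC1
  · intro u _ hu
    exact Finset.sum_eq_zero fun i _ => by rw [psi_eq_zero hK hh hu, mul_zero]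
  · have h1 : ∀ u, w u * (u - y) ^ (j : ℕ)
        = h ^ (j : ℕ) * (j : ℕ).factorial * (w u * monomialY j ((u - y) / h)) := fun u => by
      rw [monomialY, div_pow]
      have : ((j : ℕ).factorial : ℝ) ≠ 0 := by positivity
      field_simp
    simp_rw [h1]
    rw [integral_const_mul, hmom]
    split_ifs with hj
    · rw [hj, mul_one]
    · rw [mul_zero]
  · have hγi : ∀ φ : ℝ → ℝ, Continuous φ → IntegrableOn (fun u => γ u * φ u) unitY := fun φ hφ =>
      Integrable.bdd_mul (c := B) (integrableOn_unitY hφ) hγ.aestronglyMeasurable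
        (Eventually.of_forall hB)
    have hKc := hK.bddLip.continuous
    have hgc := hg.continuous
    have hmc := continuous_monomialY
    set κ : ℝ → ℝ := fun u => scaledKernelY K h u y * g u with hκ
    have hκc : Continuous κ := by
      simp only [hκ, scaledKernelY]
      fun_prop
    set φ : Fin (p + 1) → ℝ → ℝ := fun k u => (u - y) ^ (k : ℕ) / (k : ℕ).factorial with hφ
    have hφm : ∀ k u, φ k u = h ^ (k : ℕ) * monomialY k ((u - y) / h) := fun k u => by
      simp only [hφ, monomialY, div_pow]
      field_simp
    have hQ : ∀ b : Fin (p + 1) → ℝ, (∫ u in unitY,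
          (γ u - ∑ k : Fin (p + 1), (u - y) ^ (k : ℕ) / (k : ℕ).factorial * b k) ^ 2
            * scaledKernelY K h u y * g u)
        = (∫ u in unitY, γ u ^ 2 * κ u)
          - 2 * ∑ k : Fin (p + 1), (h ^ (k : ℕ) * ∫ u in unitY, psi K g h k y u * γ u) * b k
          + ∑ i, ∑ j, b i * (h ^ (i : ℕ) * gramY K g h y i j * h ^ (j : ℕ)) * b j := fun b => by
      have h1 := integral_criterion (m := volume.restrict unitY) (φ := φ) (κ := κ) (γ := γ)
        (fun i j => integrableOn_unitY (by simp only [hφ]; fun_prop))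
        (fun i => (hγi (fun u => φ i u * κ u) (by simp only [hφ]; fun_prop)).congr
          (Eventually.of_forall fun u => by simp only; ring))
        ((Integrable.bdd_mul (c := B) (hγi κ hκc) hγ.aestronglyMeasurable
            (Eventually.of_forall hB)).congr (Eventually.of_forall fun u => by simp only; ring)) b
      simp only [mul_assoc] at h1 ⊢
      rw [h1]
      congr 1
      · congr 2
        refine Finset.sum_congr rfl fun k _ => ?_
        rw [← mul_assoc, ← integral_const_mul]
        congr 1
        refine integral_congr_ae (Eventually.of_forall fun u => ?_)
        simp only [hφm, psi, hκ]
        ring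
      · refine Finset.sum_congr rfl fun i _ => Finset.sum_congr rfl fun j _ => ?_
        have h2 : ∫ u in unitY, φ i u * (φ j u * κ u)
            = h ^ (i : ℕ) * (gramY K g h y i j * h ^ (j : ℕ)) := by
          rw [gramY, ← integral_mul_const, ← integral_const_mul]
          refine integral_congr_ae (Eventually.of_forall fun u => ?_)
          simp only [hφm, hκ]
          ring
        rw [h2]
        ring
    have h2 := argmin_quadratic_scaled hM hl (gramY_symm h y) (fun i => pow_pos hh (i : ℕ)) hQ
    rw [hdual _ _ h2, hwint γ fun i => by simpa only [mul_comm] using hγi _ (hpc i)]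
  · have hin : ∀ (k : ℕ) z, IntegrableOn (fun u => psi K g h k y u * noise F z u) unitY :=
      fun k z => hF.integrableOn_mul_noise (hpi k) z
    by_cases hμ : (μ : ℕ) = 0
    · refine ⟨α, fun k => (hα k).trans hC2, fun z => ?_⟩
      rw [hwint _ fun i => hin i z]
      simp only [zeta, zetaWeight, if_pos hμ]
    -- For μ > 0 the row α is orthogonal to the column 0, that is, Σ α_k ∫ ψ_k = 0. The subtracted
    -- terms of `zetaWeight` therefore cancel in the combination, and dividing by A recovers w.
    -- Coercivity at the first basis vector gives A ≥ l, so the coefficients stay bounded.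
    · set A := ∫ u in unitY, psi K g h 0 y u with hA
      have hone : ∀ t, monomialY 0 t = 1 := fun t => by simp [monomialY]
      have hA00 : gramY K g h y (0 : Fin (p + 1)) 0 = A := by
        rw [gramY_eq]
        simp [hone, hA]
      have hAl : l ≤ A := by
        have h1 := hM (Pi.single 0 1)
        rw [← hA00]
        simpa [Pi.single_apply] using h1
      have hA0 : 0 < A := hl.trans_le hAl
      refine ⟨fun k => 1 / A * α k, fun k => ?_, fun z => ?_⟩
      · rw [abs_mul, abs_of_pos (by positivity : 0 < 1 / A)]
        exact (mul_le_mul (one_div_le_one_div_of_le hl hAl) (hα k) (abs_nonneg _)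
          (by positivity)).trans hC3
      · rw [hwint _ fun i => hin i z]
        have hsum0 : ∑ k : Fin (p + 1), α k * ∫ u in unitY, psi K g h k y u = 0 := by
          have h1 := hδ 0
          rw [if_neg (fun h0 => hμ (by rw [← h0]; rfl))] at h1
          rw [← h1]
          refine Finset.sum_congr rfl fun k _ => ?_
          rw [gramY_eq]
          simp [hone]
        have h1 : ∀ k : Fin (p + 1), 1 / A * α k * zeta F K g h μ k y z
            = α k * (∫ u in unitY, psi K g h k y u * noise F z u)
              - 1 / A * (∫ u in unitY, psi K g h 0 y u * noise F z u)
                * (α k * ∫ u in unitY, psi K g h k y u) := fun k => by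
          rw [zeta_eq hK hg hF h hμ, ← hA]
          field_simp
        simp_rw [h1]
        rw [Finset.sum_sub_distrib, ← Finset.mul_sum, hsum0, mul_zero, sub_zero]

end Smoothing

/-! ### Error bound for given observations -/

section Deterministic

variable {d q : ℕ} {K : ℝ → ℝ}

/-- Products of monomials with the product kernel. -/
def gramKernel (K : ℝ → ℝ) (m m' : Fin d → ℕ) (t : Fin d → ℝ) : ℝ :=
  monomialX m t * monomialX m' t * ∏ j, K (t j)

/-- The summands of the local Gram matrix of the regression on `x`. -/
def gramX (K : ℝ → ℝ) (h : ℝ) (m m' : Fin d → ℕ) (x : Fin d → ℝ) (z : ℝ × (Fin d → ℝ)) : ℝ :=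
  gramKernel K m m' (h⁻¹ • (z.2 - x)) / h ^ d

theorem monomialX_zero (t : Fin d → ℝ) : monomialX 0 t = 1 := by simp [monomialX]

theorem gramX_zero_zero (h : ℝ) (x : Fin d → ℝ) (z : ℝ × (Fin d → ℝ)) :
    gramX K h 0 0 x z = scaledKernelX K h z.2 x := by
  rw [gramX, gramKernel, scaledKernelX_eq, monomialX_zero, one_mul, one_mul]

theorem gramX_eq (h : ℝ) (m m' : Fin d → ℕ) (x : Fin d → ℝ) (z : ℝ × (Fin d → ℝ)) :
    gramX K h m m' x z = monomialX m' (h⁻¹ • (z.2 - x)) * gramX K h m 0 x z := by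
  rw [gramX, gramX, gramKernel, gramKernel, monomialX_zero]
  ring

theorem scaledKernelX_nonneg (hK : IsKernel K) {h : ℝ} (hh : 0 < h) (a x : Fin d → ℝ) :
    0 ≤ scaledKernelX K h a x :=
  div_nonneg (Finset.prod_nonneg fun _ _ => hK.nonneg _) (by positivity)

theorem scaledKernelX_eq_zero (hK : IsKernel K) {h : ℝ} (hh : 0 < h) {a x : Fin d → ℝ} {j : Fin d}
    (hj : h < |a j - x j|) : scaledKernelX K h a x = 0 := by
  rw [scaledKernelX, Finset.prod_eq_zero (Finset.mem_univ j), zero_div]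
  refine hK.support _ ?_
  rwa [abs_div, abs_of_pos hh, lt_div_iff₀ hh, one_mul]

theorem abs_monomialX_le_one (m : Fin d → ℕ) {t : Fin d → ℝ} (ht : ∀ j, |t j| ≤ 1) :
    |monomialX m t| ≤ 1 := by
  rw [monomialX, Finset.abs_prod]
  refine Finset.prod_le_one (fun _ _ => abs_nonneg _) fun j _ => ?_
  rw [abs_div, abs_pow, Nat.abs_cast]
  refine div_le_one_of_le₀ ((pow_le_one₀ (abs_nonneg _) (ht j)).trans ?_) (by positivity)
  exact_mod_cast Nat.one_le_iff_ne_zero.2 (Nat.factorial_ne_zero _)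

theorem abs_gramX_le (hK : IsKernel K) {h : ℝ} (hh : 0 < h) (m : Fin d → ℕ) (x : Fin d → ℝ)
    (z : ℝ × (Fin d → ℝ)) : |gramX K h m 0 x z| ≤ scaledKernelX K h z.2 x := by
  have h0 := scaledKernelX_nonneg hK hh z.2 x
  have e : gramX K h m 0 x z = monomialX m (h⁻¹ • (z.2 - x)) * scaledKernelX K h z.2 x := by
    rw [gramX, gramKernel, scaledKernelX_eq, monomialX_zero]
    ring
  rw [e, abs_mul, abs_of_nonneg h0]
  by_cases hz : ∀ j, |z.2 j - x j| ≤ h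
  · refine mul_le_of_le_one_left h0 (abs_monomialX_le_one m fun j => ?_)
    simp only [Pi.smul_apply, Pi.sub_apply, smul_eq_mul]
    rw [abs_mul, abs_of_pos (inv_pos.2 hh), inv_mul_le_iff₀ hh, mul_one]
    exact hz j
  · push Not at hz
    obtain ⟨j, hj⟩ := hz
    rw [scaledKernelX_eq_zero hK hh hj, mul_zero]

theorem monomialX_smul (m : Fin d → ℕ) (r : ℝ) (t : Fin d → ℝ) :
    monomialX m (r • t) = r ^ (∑ j, m j) * monomialX m t := by
  simp only [monomialX, Pi.smul_apply, smul_eq_mul, mul_pow]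
  rw [← Finset.prod_pow_eq_pow_sum, ← Finset.prod_mul_distrib]
  exact Finset.prod_congr rfl fun j _ => by ring

theorem monomialX_sub_eq {h : ℝ} (hh : 0 < h) (m : Fin d → ℕ) (a x : Fin d → ℝ) :
    monomialX m (a - x) = h ^ (∑ j, m j) * monomialX m (h⁻¹ • (a - x)) := by
  rw [← monomialX_smul, smul_inv_smul₀ hh.ne']

/-- The empirical local Gram matrix. -/
def empGram (K : ℝ → ℝ) (h : ℝ) (n : ℕ) (z : ℕ → ℝ × (Fin d → ℝ)) (x : Fin d → ℝ)
    (m m' : multiIndices d q) : ℝ :=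
  (∑ i ∈ Finset.range n, gramX K h m.1 m'.1 x (z i)) / n

theorem gramX_symm (h : ℝ) (m m' : Fin d → ℕ) (x : Fin d → ℝ) (z : ℝ × (Fin d → ℝ)) :
    gramX K h m m' x z = gramX K h m' m x z := by
  rw [gramX, gramX, gramKernel, gramKernel, mul_comm (monomialX m _)]

theorem empGram_symm (h : ℝ) (n : ℕ) (z : ℕ → ℝ × (Fin d → ℝ)) (x : Fin d → ℝ)
    (m m' : multiIndices d q) : empGram K h n z x m m' = empGram K h n z x m' m := by
  simp only [empGram, gramX_symm h m.1 m'.1]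

/-- For the coefficients scaled by h^|m|, the matrix does not depend on u and the right-hand side is
linear in the indicators. This is what allows the smoothing in u to be carried out before the
regression. -/
theorem gammaHat_normal_equations {l h : ℝ} {n : ℕ} {z : ℕ → ℝ × (Fin d → ℝ)} {x : Fin d → ℝ}
    (hS : Coercive l (empGram (q := q) K h n z x)) (hl : 0 < l) (hn : 0 < n) (hh : 0 < h) (u : ℝ)
    (m : multiIndices d q) :
    ∑ m' : multiIndices d q,
        empGram K h n z x m m' * (h ^ (∑ j, m'.1 j) * gammaHat q K h n z u x m')
      = (∑ i ∈ Finset.range n, gramX K h m.1 0 x (z i) * (if (z i).1 ≤ u then 1 else 0)) / n := by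
  have hn' : (0 : ℝ) < n := by exact_mod_cast hn
  set T : multiIndices d q → multiIndices d q → ℝ := fun m m' =>
    ∑ i ∈ Finset.range n, gramX K h m.1 m'.1 x (z i) with hT
  have hTS : ∀ m m', T m m' = n * empGram K h n z x m m' := fun m m' => by
    rw [empGram, mul_div_cancel₀ _ hn'.ne']
  have hTc : Coercive (n * l) T := fun c => by
    have h1 := mul_le_mul_of_nonneg_left (hS c) hn'.le
    rw [mul_assoc]
    refine h1.trans (le_of_eq ?_)
    simp_rw [Finset.mul_sum, hTS]
    exact Finset.sum_congr rfl fun i _ => Finset.sum_congr rfl fun j _ => by ring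
  set ι : ℕ → ℝ := fun i => if (z i).1 ≤ u then 1 else 0 with hι
  have hpt : ∀ (i : ℕ) (c : multiIndices d q → ℝ),
      (ι i - ∑ m : multiIndices d q, monomialX m.1 ((z i).2 - x) * c m) ^ 2
          * scaledKernelX K h (z i).2 x
        = ι i ^ 2 * scaledKernelX K h (z i).2 x
          - 2 * ∑ m : multiIndices d q, h ^ (∑ j, m.1 j) * (gramX K h m.1 0 x (z i) * ι i) * c m
          + ∑ m : multiIndices d q, ∑ m' : multiIndices d q,
            c m * (h ^ (∑ j, m.1 j) * gramX K h m.1 m'.1 x (z i) * h ^ (∑ j, m'.1 j)) * c m' := by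
    intro i c
    set s := ∑ m : multiIndices d q, monomialX m.1 ((z i).2 - x) * c m with hs
    have e1 : ∑ m : multiIndices d q, h ^ (∑ j, m.1 j) * (gramX K h m.1 0 x (z i) * ι i) * c m
        = ι i * scaledKernelX K h (z i).2 x * s := by
      rw [hs, Finset.mul_sum]
      refine Finset.sum_congr rfl fun m _ => ?_
      rw [monomialX_sub_eq hh, gramX_symm, gramX_eq, gramX_zero_zero]
      ring
    have e2 : ∑ m : multiIndices d q, ∑ m' : multiIndices d q,
        c m * (h ^ (∑ j, m.1 j) * gramX K h m.1 m'.1 x (z i) * h ^ (∑ j, m'.1 j)) * c m'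
        = s * s * scaledKernelX K h (z i).2 x := by
      rw [hs, Finset.sum_mul_sum, Finset.sum_mul]
      refine Finset.sum_congr rfl fun m _ => ?_
      rw [Finset.sum_mul]
      refine Finset.sum_congr rfl fun m' _ => ?_
      rw [monomialX_sub_eq hh, monomialX_sub_eq hh m'.1, gramX_eq, gramX_symm, gramX_eq,
        gramX_zero_zero]
      ring
    rw [e1, e2]
    ring
  have hQ : ∀ c : multiIndices d q → ℝ, criterionX q K h n z u x c
      = (∑ i ∈ Finset.range n, ι i ^ 2 * scaledKernelX K h (z i).2 x)
        - 2 * ∑ m : multiIndices d q, (h ^ (∑ j, m.1 j)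
          * ∑ i ∈ Finset.range n, gramX K h m.1 0 x (z i) * ι i) * c m
        + ∑ m : multiIndices d q, ∑ m' : multiIndices d q,
          c m * (h ^ (∑ j, m.1 j) * T m m' * h ^ (∑ j, m'.1 j)) * c m' := fun c => by
    have e0 : criterionX q K h n z u x c = ∑ i ∈ Finset.range n,
        (ι i - ∑ m : multiIndices d q, monomialX m.1 ((z i).2 - x) * c m) ^ 2
          * scaledKernelX K h (z i).2 x := rfl
    rw [e0]
    simp_rw [hpt]
    rw [Finset.sum_add_distrib, Finset.sum_sub_distrib, ← Finset.mul_sum]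
    congr 1
    · congr 2
      rw [Finset.sum_comm]
      refine Finset.sum_congr rfl fun m _ => ?_
      rw [Finset.mul_sum, Finset.sum_mul]
    · rw [Finset.sum_comm]
      refine Finset.sum_congr rfl fun m _ => ?_
      rw [Finset.sum_comm]
      refine Finset.sum_congr rfl fun m' _ => ?_
      simp only [hT, Finset.mul_sum, Finset.sum_mul]
  have h2 := argmin_quadratic_scaled hTc (mul_pos hn' hl)
    (fun m m' => by rw [hTS, hTS, empGram_symm]) (fun m => pow_pos hh (∑ j, m.1 j)) hQ m
  rw [eq_div_iff hn'.ne', ← h2, Finset.sum_mul]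
  refine Finset.sum_congr rfl fun m' _ => ?_
  rw [hTS, gammaHat]
  ring

variable {f F : ℝ → (Fin d → ℝ) → ℝ} {L : ℝ} {G g : ℝ → ℝ} {g₀ g₁ : ℝ}

/-- The error of the estimator in terms of the deviations of local empirical means. -/
theorem exists_error_bound (hK : IsKernel K) (hg : IsPositiveWeight g g₀ g₁)
    (hgG : ∀ u ∈ unitY, weightDensity G u = g u) (hF : IsCdfExtension f F L) {s p : ℕ}
    (hs : SmoothOfOrder f s) (h0 : ∃ A, ∀ y ∈ unitY, ∀ x ∈ unitX d, |condDistFun f y x| ≤ A)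
    (μ : Fin (p + 1)) (ν : multiIndices d q) (hq : q + 1 + μ ≤ s) (hp : p + 1 + ∑ j, ν.1 j ≤ s)
    {l : ℝ} (hl : 0 < l) {Γ : ℝ} (hΓ : 0 ≤ Γ) :
    ∃ C, 0 ≤ C ∧ ∀ (h : ℝ) (n : ℕ) (z : ℕ → ℝ × (Fin d → ℝ)) (ε : ℝ), 0 < h → h ≤ 1 / 2 → 0 < n →
      (∀ i, z i ∈ unitY ×ˢ unitX d) →
      (∀ x ∈ unitX d, Coercive l (empGram (q := q) K h n z x)) →
      (∀ x ∈ unitX d, (∑ i ∈ Finset.range n, scaledKernelX K h (z i).2 x) / n ≤ Γ) →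
      (∀ y ∈ unitY, ∀ x ∈ unitX d, ∀ (m : multiIndices d q) (k : Fin (p + 1)),
        |(∑ i ∈ Finset.range n, gramX K h m.1 0 x (z i) * zeta F K g h μ k y (z i)) / n| ≤ ε) →
      ∀ y ∈ unitY, ∀ x ∈ unitX d,
        |thetaCheck p q K G h n z μ ν y x - theta f μ ν.1 y x|
          ≤ C * (h ^ (q + 1 - ∑ j, ν.1 j) + h ^ (p + 1 - (μ : ℕ))
            + ε / h ^ ((μ : ℕ) + ∑ j, ν.1 j)) := by
  obtain ⟨W, hW0, hW⟩ := exists_dual_weight hK hg p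
  obtain ⟨Cx, hCx0, hCx⟩ := hs.exists_bias_x h0 hq
  obtain ⟨Cy, hCy0, hCy⟩ := hs.exists_bias_y h0 hp
  set κ : ℝ := (Fintype.card (multiIndices d q) : ℝ) with hκ
  set C1 : ℝ := κ * (1 / l) * ((p + 1) * W) with hC1
  set C2 : ℝ := κ * (1 / l) * (Γ * (Cx * W)) with hC2
  have hκ0 : 0 ≤ κ := by positivity
  have hC10 : 0 ≤ C1 := by positivity
  have hC20 : 0 ≤ C2 := by positivity
  refine ⟨C1 + C2 + Cy * W, by positivity,
    fun h n z ε hh hh2 hn hz hS hKΓ hε y hy x hx => ?_⟩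
  have hn' : (0 : ℝ) < n := by exact_mod_cast hn
  obtain ⟨w, hw, hmom, hγ, hnoise⟩ := hW y hy h hh hh2 μ
  obtain ⟨b, hb, hbz⟩ := hnoise hF
  obtain ⟨a, ha, hdual⟩ := (hS x hx).exists_dual hl (empGram_symm h n z x) ν
  set r := ∑ j, ν.1 j with hr
  set ind : ℕ → ℝ → ℝ := fun i u => if (z i).1 ≤ u then 1 else 0 with hind
  have hindm : ∀ i, Measurable (ind i) := fun i =>
    Measurable.ite (measurableSet_le measurable_const measurable_id) measurable_const
      measurable_const
  have hindb : ∀ i u, |ind i u| ≤ 1 := fun i u => by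
    simp only [hind]
    split_ifs <;> norm_num
  have hgam : ∀ u, h ^ r * gammaHat q K h n z u x ν
      = ∑ m, a m * ((∑ i ∈ Finset.range n, gramX K h m.1 0 x (z i) * ind i u) / n) := fun u =>
    hdual (fun m => h ^ (∑ j, m.1 j) * gammaHat q K h n z u x m) _
      (fun m => gammaHat_normal_equations (hS x hx) hl hn hh u m)
  have hhr : 0 < h ^ r := by positivity
  have hgam' : ∀ u, gammaHat q K h n z u x ν
      = (h ^ r)⁻¹ * ∑ m, a m * ((∑ i ∈ Finset.range n, gramX K h m.1 0 x (z i) * ind i u) / n) :=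
    fun u => by rw [← hgam u, inv_mul_cancel_left₀ hhr.ne']
  -- As an explicit combination of indicators, the first-stage estimate is measurable and bounded in
  -- u, as the formula for the second-stage minimizer requires.
  have hgm : Measurable fun u => gammaHat q K h n z u x ν := by
    rw [funext hgam']
    refine Measurable.const_mul (Finset.measurable_sum _ fun m _ => Measurable.const_mul
      (Measurable.div_const (Finset.measurable_sum _ fun i _ => (hindm i).const_mul _) _) _) _
  obtain ⟨B, hB⟩ : ∃ B, ∀ u, |gammaHat q K h n z u x ν| ≤ B := by
    refine ⟨(h ^ r)⁻¹ * ∑ m : multiIndices d q,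
      |a m| * ((∑ i ∈ Finset.range n, |gramX K h m.1 0 x (z i)|) / n), fun u => ?_⟩
    rw [hgam', abs_mul, abs_of_pos (inv_pos.2 hhr)]
    refine mul_le_mul_of_nonneg_left ?_ (inv_pos.2 hhr).le
    refine (Finset.abs_sum_le_sum_abs _ _).trans (Finset.sum_le_sum fun m _ => ?_)
    rw [abs_mul, abs_div, abs_of_pos hn']
    refine mul_le_mul_of_nonneg_left (div_le_div_of_nonneg_right ?_ hn'.le) (abs_nonneg _)
    refine (Finset.abs_sum_le_sum_abs _ _).trans (Finset.sum_le_sum fun i _ => ?_)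
    rw [abs_mul]
    exact mul_le_of_le_one_right (abs_nonneg _) (hindb i u)
  have hwind : ∀ i, IntegrableOn (fun u => w u * ind i u) unitY := fun i =>
    Integrable.mul_bdd (c := 1) hw.integrable (hindm i).aestronglyMeasurable
      (Eventually.of_forall (hindb i))
  -- the estimator as a weighted mean
  have hcheck : h ^ (μ : ℕ) * thetaCheck p q K G h n z μ ν y x
      = ∫ u in unitY, w u * gammaHat q K h n z u x ν := by
    have hcrit : criterionY p q K G h n z ν y x = fun b => ∫ u in unitY,
        (gammaHat q K h n z u x ν
          - ∑ k : Fin (p + 1), (u - y) ^ (k : ℕ) / (k : ℕ).factorial * b k) ^ 2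
          * scaledKernelY K h u y * g u := by
      funext c
      exact setIntegral_congr_fun measurableSet_unitY fun u hu => by simp only [hgG u hu]
    rw [← hγ _ B hgm hB, thetaCheck, betaCheck, hcrit]
  have hcheck2 : h ^ r * (h ^ (μ : ℕ) * thetaCheck p q K G h n z μ ν y x)
      = ∑ m, a m * ((∑ i ∈ Finset.range n, gramX K h m.1 0 x (z i)
        * ∫ u in unitY, w u * ind i u) / n) := by
    rw [hcheck, ← integral_const_mul]
    have e1 : ∀ u, h ^ r * (w u * gammaHat q K h n z u x ν)
        = ∑ m, a m * ((∑ i ∈ Finset.range n, gramX K h m.1 0 x (z i) * (w u * ind i u)) / n) :=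
      fun u => by
        rw [mul_left_comm, hgam, Finset.mul_sum]
        refine Finset.sum_congr rfl fun m _ => ?_
        rw [mul_left_comm, mul_div_assoc', Finset.mul_sum]
        congr 3
        funext i
        ring
    simp_rw [e1]
    rw [integral_finsetSum _ fun m _ => ((integrable_finsetSum _ fun i _ =>
      (hwind i).const_mul _).div_const _).const_mul _]
    refine Finset.sum_congr rfl fun m _ => ?_
    rw [integral_const_mul, integral_div, integral_finsetSum _ fun i _ => (hwind i).const_mul _]
    simp_rw [integral_const_mul]
  -- decomposition of each term
  set T : (Fin d → ℕ) → ℝ := fun m => ∫ u in unitY, w u * theta f 0 m u x with hT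
  set R : ℕ → ℝ := fun i => (∫ u in unitY, w u * condDistFun f u (z i).2)
    - ∑ m ∈ multiIndices d q, monomialX m ((z i).2 - x) * T m with hR
  have hterm : ∀ i, ∫ u in unitY, w u * ind i u = (∫ u in unitY, w u * noise F (z i) u) + R i
      + ∑ m : multiIndices d q,
        monomialX m.1 (h⁻¹ • ((z i).2 - x)) * (h ^ (∑ j, m.1 j) * T m.1) := fun i => by
    have e1 : ∫ u in unitY, w u * ind i u = (∫ u in unitY, w u * noise F (z i) u)
        + ∫ u in unitY, w u * F u (z i).2 := by
      have hFi : IntegrableOn (fun u => w u * F u (z i).2) unitY :=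
        hw.integrable_mul (Continuous.continuousOn (hF.continuous.comp
          (by fun_prop : Continuous fun u : ℝ => (u, (z i).2))))
      rw [← integral_add (hF.integrableOn_mul_noise hw.integrable (z i)) hFi]
      refine integral_congr_ae (Eventually.of_forall fun u => ?_)
      simp only [noise, hind]
      ring
    have e2 : ∫ u in unitY, w u * F u (z i).2 = ∫ u in unitY, w u * condDistFun f u (z i).2 :=
      setIntegral_congr_fun measurableSet_unitY fun u hu => by
        simp only [hF.eq u hu _ (hz i).2]
    have e3 : ∑ m ∈ multiIndices d q, monomialX m ((z i).2 - x) * T m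
        = ∑ m : multiIndices d q,
          monomialX m.1 (h⁻¹ • ((z i).2 - x)) * (h ^ (∑ j, m.1 j) * T m.1) := by
      rw [← Finset.sum_coe_sort (multiIndices d q)]
      refine Finset.sum_congr rfl fun m _ => ?_
      rw [monomialX_sub_eq hh]
      ring
    rw [e1, e2, ← e3]
    simp only [hR]
    ring
  have hgramsum : ∀ m : multiIndices d q,
      (∑ i ∈ Finset.range n, gramX K h m.1 0 x (z i) * ∫ u in unitY, w u * ind i u) / n
        = (∑ i ∈ Finset.range n, gramX K h m.1 0 x (z i) * ∫ u in unitY, w u * noise F (z i) u) / n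
          + (∑ i ∈ Finset.range n, gramX K h m.1 0 x (z i) * R i) / n
          + ∑ m', empGram K h n z x m m' * (h ^ (∑ j, m'.1 j) * T m'.1) := fun m => by
    simp_rw [hterm, mul_add, Finset.sum_add_distrib, add_div]
    congr 1
    simp_rw [empGram, Finset.mul_sum, div_mul_eq_mul_div, ← Finset.sum_div, Finset.sum_mul]
    rw [Finset.sum_comm]
    congr 1
    refine Finset.sum_congr rfl fun m' _ => Finset.sum_congr rfl fun i _ => ?_
    rw [gramX_eq h m.1 m'.1]
    ring
  -- The regression reproduces polynomials: the scaled coefficients h^|m| T_m solve the normal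
  -- equations whose right-hand side is the polynomial part.
  have hTν : h ^ r * T ν.1
      = ∑ m, a m * ∑ m', empGram K h n z x m m' * (h ^ (∑ j, m'.1 j) * T m'.1) :=
    hdual (fun m => h ^ (∑ j, m.1 j) * T m.1) _ fun m => rfl
  have hmain : h ^ r * (h ^ (μ : ℕ) * thetaCheck p q K G h n z μ ν y x) - h ^ r * T ν.1
      = ∑ m, a m * ((∑ i ∈ Finset.range n, gramX K h m.1 0 x (z i)
          * ∫ u in unitY, w u * noise F (z i) u) / n
        + (∑ i ∈ Finset.range n, gramX K h m.1 0 x (z i) * R i) / n) := by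
    rw [hcheck2, hTν, ← Finset.sum_sub_distrib]
    refine Finset.sum_congr rfl fun m _ => ?_
    rw [hgramsum]
    ring
  -- stochastic part
  have hstoch : ∀ m : multiIndices d q, |(∑ i ∈ Finset.range n, gramX K h m.1 0 x (z i)
      * ∫ u in unitY, w u * noise F (z i) u) / n| ≤ (p + 1) * W * ε := fun m => by
    have e1 : (∑ i ∈ Finset.range n, gramX K h m.1 0 x (z i)
        * ∫ u in unitY, w u * noise F (z i) u) / n
        = ∑ k, b k * ((∑ i ∈ Finset.range n,
          gramX K h m.1 0 x (z i) * zeta F K g h μ k y (z i)) / n) := by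
      simp_rw [hbz, Finset.mul_sum, mul_div_assoc', Finset.mul_sum, ← Finset.sum_div]
      rw [Finset.sum_comm]
      congr 1
      exact Finset.sum_congr rfl fun k _ => Finset.sum_congr rfl fun i _ => by ring
    rw [e1]
    refine (Finset.abs_sum_le_sum_abs _ _).trans ?_
    calc _ ≤ ∑ _k : Fin (p + 1), W * ε := Finset.sum_le_sum fun k _ => by
          rw [abs_mul]
          exact mul_le_mul (hb k) (hε y hy x hx m k) (abs_nonneg _) hW0
      _ = _ := by simp; ring
  -- bias part
  have hRb : ∀ i, (∀ j, |(z i).2 j - x j| ≤ h) → |R i| ≤ Cx * W * h ^ ((μ : ℕ) + q + 1) :=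
    fun i hi => hCx w y h W hw hy hh.le (fun k hk => by
      have hk' : k < p + 1 := hk.trans μ.2
      have := hmom ⟨k, hk'⟩
      rwa [if_neg (fun h => by rw [← h] at hk; exact lt_irrefl _ hk)] at this) x hx _ (hz i).2 hi
  have hbias : ∀ m : multiIndices d q, |(∑ i ∈ Finset.range n, gramX K h m.1 0 x (z i) * R i) / n|
      ≤ Γ * (Cx * W * h ^ ((μ : ℕ) + q + 1)) := fun m => by
    rw [abs_div, abs_of_pos hn']
    refine le_trans ?_ (mul_le_mul_of_nonneg_right (hKΓ x hx) (by positivity))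
    rw [div_mul_eq_mul_div]
    refine div_le_div_of_nonneg_right ?_ hn'.le
    rw [Finset.sum_mul]
    refine (Finset.abs_sum_le_sum_abs _ _).trans (Finset.sum_le_sum fun i _ => ?_)
    rw [abs_mul]
    by_cases hi : ∀ j, |(z i).2 j - x j| ≤ h
    · exact mul_le_mul (abs_gramX_le hK hh m.1 x (z i)) (hRb i hi) (abs_nonneg _)
        (scaledKernelX_nonneg hK hh _ _)
    · push Not at hi
      obtain ⟨j, hj⟩ := hi
      have e1 := abs_gramX_le hK hh m.1 x (z i)
      rw [scaledKernelX_eq_zero hK hh hj] at e1 ⊢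
      rw [le_antisymm e1 (abs_nonneg _), zero_mul, zero_mul]
  have hfirst : |h ^ r * (h ^ (μ : ℕ) * thetaCheck p q K G h n z μ ν y x) - h ^ r * T ν.1|
      ≤ C1 * ε + C2 * h ^ ((μ : ℕ) + q + 1) := by
    rw [hmain]
    refine (Finset.abs_sum_le_sum_abs _ _).trans ?_
    calc _ ≤ ∑ _m : multiIndices d q,
          1 / l * ((p + 1) * W * ε + Γ * (Cx * W * h ^ ((μ : ℕ) + q + 1))) :=
          Finset.sum_le_sum fun m _ => by
            rw [abs_mul]
            exact mul_le_mul (ha m) ((abs_add_le _ _).trans (add_le_add (hstoch m) (hbias m)))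
              (abs_nonneg _) (by positivity)
      _ = _ := by
          rw [Finset.sum_const, Finset.card_univ, nsmul_eq_mul, ← hκ, hC1, hC2]
          ring
  -- Among the moments of w of degree at most p, only the one of degree μ survives, equal to μ! h^μ.
  have hsecond : |T ν.1 - h ^ (μ : ℕ) * theta f μ ν.1 y x| ≤ Cy * W * h ^ (p + 1) := by
    have h1 := hCy w y h W hw hy hh.le x hx
    have h2 : ∑ k ∈ Finset.range (p + 1),
        theta f k ν.1 y x / k.factorial * ∫ u in unitY, w u * (u - y) ^ k
        = h ^ (μ : ℕ) * theta f μ ν.1 y x := by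
      rw [Finset.sum_range fun k =>
        theta f k ν.1 y x / (k.factorial : ℝ) * ∫ u in unitY, w u * (u - y) ^ k]
      simp_rw [hmom]
      simp only [mul_ite, mul_zero, Finset.sum_ite_eq', Finset.mem_univ, if_true]
      have : ((μ : ℕ).factorial : ℝ) ≠ 0 := by positivity
      field_simp
    rwa [h2] at h1
  -- conclusion
  have hrq : r ≤ q := mem_multiIndices.1 ν.2
  have hμp : (μ : ℕ) ≤ p := Nat.lt_succ_iff.1 μ.2
  have hε0 : 0 ≤ ε := (abs_nonneg _).trans (hε y hy x hx ν μ)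
  set e := thetaCheck p q K G h n z μ ν y x - theta f μ ν.1 y x with he
  have hpw : 0 < h ^ ((μ : ℕ) + r) := by positivity
  have htot : h ^ ((μ : ℕ) + r) * |e|
      ≤ C1 * ε + C2 * h ^ ((μ : ℕ) + q + 1) + h ^ r * (Cy * W * h ^ (p + 1)) := by
    have e1 : h ^ ((μ : ℕ) + r) * e
        = (h ^ r * (h ^ (μ : ℕ) * thetaCheck p q K G h n z μ ν y x) - h ^ r * T ν.1)
          + h ^ r * (T ν.1 - h ^ (μ : ℕ) * theta f μ ν.1 y x) := by
      rw [he, pow_add]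
      ring
    have e0 : h ^ ((μ : ℕ) + r) * |e| = |h ^ ((μ : ℕ) + r) * e| := by
      rw [abs_mul, abs_of_pos hpw]
    rw [e0, e1]
    refine (abs_add_le _ _).trans (add_le_add hfirst ?_)
    rw [abs_mul, abs_of_pos hhr]
    exact mul_le_mul_of_nonneg_left hsecond hhr.le
  have e2 : h ^ ((μ : ℕ) + q + 1) = h ^ ((μ : ℕ) + r) * h ^ (q + 1 - r) := by
    rw [← pow_add]
    congr 1
    omega
  have e3 : h ^ r * h ^ (p + 1) = h ^ ((μ : ℕ) + r) * h ^ (p + 1 - (μ : ℕ)) := by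
    rw [← pow_add, ← pow_add]
    congr 1
    omega
  have e4 : h ^ ((μ : ℕ) + r) * (ε / h ^ ((μ : ℕ) + r)) = ε := mul_div_cancel₀ _ hpw.ne'
  have hfin : h ^ ((μ : ℕ) + r) * |e| ≤ h ^ ((μ : ℕ) + r) * (C1 * (ε / h ^ ((μ : ℕ) + r))
      + C2 * h ^ (q + 1 - r) + Cy * W * h ^ (p + 1 - (μ : ℕ))) := by
    refine htot.trans (le_of_eq ?_)
    rw [e2]
    linear_combination (Cy * W) * e3 - C1 * e4
  refine (le_of_mul_le_mul_left hfin hpw).trans ?_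
  have p1 : 0 ≤ ε / h ^ ((μ : ℕ) + r) := by positivity
  have p2 : 0 ≤ h ^ (q + 1 - r) := by positivity
  have p3 : 0 ≤ h ^ (p + 1 - (μ : ℕ)) := by positivity
  have p4 : 0 ≤ Cy * W := by positivity
  nlinarith [mul_nonneg hC10 p2, mul_nonneg hC10 p3, mul_nonneg hC20 p1, mul_nonneg hC20 p3,
    mul_nonneg p4 p1, mul_nonneg p4 p2]

end Deterministic

/-! ### Moments of the local Gram matrix -/

section GramMoments

variable {d q : ℕ} {K : ℝ → ℝ}

theorem IsKernel.bddLip_gramKernel (hK : IsKernel K) (m m' : Fin d → ℕ) :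
    BddLip (gramKernel K m m') := by
  have h1 : ∀ j, BddLip fun t : Fin d → ℝ =>
      1 / ((m j).factorial * (m' j).factorial : ℝ) * (t j ^ (m j + m' j) * K (t j)) := fun j =>
    (BddLip.const _).mul ((hK.bddLip_pow_mul (m j + m' j)).comp fun x y => dist_le_pi_dist x y j)
  convert BddLip.prod Finset.univ h1 using 2 with t
  rw [gramKernel, monomialX, monomialX, ← Finset.prod_mul_distrib, ← Finset.prod_mul_distrib]
  refine Finset.prod_congr rfl fun j _ => ?_
  rw [pow_add]
  field_simp

theorem continuous_gramX (hK : IsKernel K) (h : ℝ) (m m' : Fin d → ℕ) (x : Fin d → ℝ) :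
    Continuous fun a : Fin d → ℝ => gramKernel K m m' (h⁻¹ • (a - x)) / h ^ d := by
  have := (hK.bddLip_gramKernel m m').continuous
  fun_prop

theorem measurable_gramX (hK : IsKernel K) (h : ℝ) (m m' : Fin d → ℕ) (x : Fin d → ℝ) :
    Measurable (gramX K h m m' x) :=
  (continuous_gramX hK h m m' x).measurable.comp measurable_snd

theorem gramX_eq_zero (hK : IsKernel K) {h : ℝ} (hh : 0 < h) (m m' : Fin d → ℕ) {x : Fin d → ℝ}
    {z : ℝ × (Fin d → ℝ)} (hz : h < dist z.2 x) : gramX K h m m' x z = 0 := by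
  obtain ⟨j, hj⟩ : ∃ j, h < |z.2 j - x j| := by
    by_contra! hc
    exact absurd hz (not_lt.2 ((dist_pi_le_iff hh.le).2 fun j => by rw [Real.dist_eq]; exact hc j))
  rw [gramX_eq, gramX_symm, gramX_eq, gramX_zero_zero, scaledKernelX_eq_zero hK hh hj, mul_zero,
    mul_zero]

theorem exists_gramX_bounds (hK : IsKernel K) (d q : ℕ) :
    ∃ C, 0 < C ∧ ∀ h : ℝ, 0 < h → ∀ m m' : multiIndices d q,
      (∀ x z, |gramX K h m.1 m'.1 x z| ≤ C / h ^ d) ∧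
      ∀ x x' z, |gramX K h m.1 m'.1 x z - gramX K h m.1 m'.1 x' z| ≤ C / h ^ (d + 1) * dist x x' := by
  obtain ⟨C, hC0, hC, hC'⟩ := exists_uniform_bddLip
    (φ := fun i : multiIndices d q × multiIndices d q => gramKernel K i.1.1 i.2.1)
    fun i => hK.bddLip_gramKernel _ _
  refine ⟨C + 1, by positivity, fun h hh m m' => ⟨fun x z => ?_, fun x x' z => ?_⟩⟩
  · rw [gramX, abs_div, abs_of_pos (pow_pos hh d)]
    exact div_le_div_of_nonneg_right ((hC (m, m') _).trans (by linarith)) (by positivity)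
  · rw [gramX, gramX, ← sub_div, abs_div, abs_of_pos (pow_pos hh d), pow_succ', div_mul_eq_mul_div,
      mul_comm h, ← div_div, div_right_comm]
    refine div_le_div_of_nonneg_right ((hC' (m, m') _ _).trans ?_) (by positivity)
    rw [dist_smul₀, dist_sub_left, norm_inv, Real.norm_of_nonneg hh.le, div_eq_mul_inv,
      mul_comm h⁻¹, ← mul_assoc]
    have := dist_nonneg (x := x) (y := x')
    gcongr
    linarith

variable {f : ℝ → (Fin d → ℝ) → ℝ} {a b : ℝ}

theorem integrable_gramX (hK : IsKernel K) [IsFiniteMeasure (dataLaw f)] {h : ℝ} (hh : 0 < h)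
    (m m' : multiIndices d q) (x : Fin d → ℝ) :
    Integrable (gramX K h m.1 m'.1 x) (dataLaw f) := by
  obtain ⟨C, -, hC⟩ := exists_gramX_bounds hK d q
  exact Integrable.of_bound (measurable_gramX hK h _ _ x).aestronglyMeasurable (C / h ^ d)
    (Eventually.of_forall fun z => (hC h hh m m').1 x z)

/-- The lower bound of the density, together with the unit length of the range of y, reduces the
claim to Lebesgue measure on [0,1]^d. -/
theorem IsRegularDensity.exists_coercive_gram (hf : IsRegularDensity f a b)
    [IsFiniteMeasure (dataLaw f)] (hK : IsKernel K) (q : ℕ) :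
    ∃ l, 0 < l ∧ ∀ x ∈ unitX d, ∀ h, 0 < h → h ≤ 1 / 2 →
      Coercive l fun m m' : multiIndices d q => ∫ z, gramX K h m.1 m'.1 x z ∂(dataLaw f) := by
  obtain ⟨l, hl, H⟩ := hK.exists_gram_bound_x d q
  refine ⟨a * l, mul_pos hf.pos hl, fun x hx h hh hh2 c => ?_⟩
  have hcK := hK.bddLip.continuous
  have hcm : ∀ m : Fin d → ℕ, Continuous (monomialX m) := continuous_monomialX
  have hcs : Continuous fun a : Fin d → ℝ => scaledKernelX K h a x := by
    unfold scaledKernelX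
    fun_prop
  have hg : Continuous fun a : Fin d → ℝ =>
      (∑ m : multiIndices d q, c m * monomialX m.1 (h⁻¹ • (a - x))) ^ 2 * scaledKernelX K h a x := by
    fun_prop
  have hgram : ∀ (m m' : multiIndices d q) (z : ℝ × (Fin d → ℝ)),
      monomialX m.1 (h⁻¹ • (z.2 - x)) * monomialX m'.1 (h⁻¹ • (z.2 - x)) * scaledKernelX K h z.2 x
        = gramX K h m.1 m'.1 x z := fun m m' z => by
    rw [gramX, gramKernel, scaledKernelX_eq, mul_div_assoc]
  have h1 := hf.le_integral_snd hg fun x' =>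
    mul_nonneg (sq_nonneg _) (scaledKernelX_nonneg hK hh _ _)
  rw [integral_gram (κ := fun z : ℝ × (Fin d → ℝ) => scaledKernelX K h z.2 x)
    (φ := fun (m : multiIndices d q) (z : ℝ × (Fin d → ℝ)) => monomialX m.1 (h⁻¹ • (z.2 - x)))
    (fun m m' => by simp only [hgram]; exact integrable_gramX hK hh m m' x)] at h1
  simp only [hgram] at h1
  rw [mul_assoc]
  exact (mul_le_mul_of_nonneg_left (H x hx h hh hh2 c) hf.pos.le).trans h1

theorem IsRegularDensity.exists_integral_kernel_le (hf : IsRegularDensity f a b)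
    [IsFiniteMeasure (dataLaw f)] (hK : IsKernel K) :
    ∃ C, 0 ≤ C ∧ ∀ (x : Fin d → ℝ) h, 0 < h → ∫ z, gramX K h 0 0 x z ∂(dataLaw f) ≤ C := by
  have hb : 0 ≤ b := (abs_nonneg _).trans (hf.ext_abs_le 0 0)
  obtain ⟨C, hC0, hC⟩ := exists_gramX_bounds hK d 0
  refine ⟨b * 2 ^ d * C, by positivity, fun x h hh => ?_⟩
  have hnn : ∀ z, 0 ≤ gramX K h 0 0 x z := fun z => by
    rw [gramX_zero_zero]
    exact scaledKernelX_nonneg hK hh _ _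
  have h0 : (0 : Fin d → ℕ) ∈ multiIndices d 0 := mem_multiIndices.2 (by simp)
  -- The mean of a nonnegative function is the second moment of its square root.
  have h1 := hf.integral_sq_le (ξ := fun z => Real.sqrt (gramX K h 0 0 x z)) (y := 0) (x := x)
    (h := h) (A := 0) (B := C / h ^ d) hh.le le_rfl (by positivity)
    (fun z hz => by rw [gramX_eq_zero hK hh _ _ hz, Real.sqrt_zero])
    (fun z => by
      rw [Real.sq_sqrt (hnn z), ite_self, zero_add]
      exact (le_abs_self _).trans ((hC h hh ⟨0, h0⟩ ⟨0, h0⟩).1 x z))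
  simp only [Real.sq_sqrt (hnn _)] at h1
  refine h1.trans (le_of_eq ?_)
  rw [mul_pow]
  field_simp
  ring

end GramMoments

/-! ### Bandwidth sequences -/

/-- Bandwidths with `h → 0` and `n h^{d+1} / log n → ∞`. -/
structure IsBandwidth (d : ℕ) (h : ℕ → ℝ) : Prop where
  pos : ∀ n, 0 < h n
  tendsto_zero : Tendsto h atTop (𝓝 0)
  rate : Tendsto (fun n : ℕ => (n : ℝ) * h n ^ (d + 1) / Real.log n) atTop atTop

namespace IsBandwidth

variable {d : ℕ} {h : ℕ → ℝ}

theorem eventually_le_half (hh : IsBandwidth d h) : ∀ᶠ n in atTop, h n ≤ 1 / 2 :=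
  hh.tendsto_zero.eventually_le_const (by norm_num)

theorem eventually_one_le_log : ∀ᶠ n : ℕ in atTop, 1 ≤ Real.log n :=
  (Real.tendsto_log_atTop.comp tendsto_natCast_atTop_atTop).eventually_ge_atTop 1

/-- Eventually 1 ≤ log n ≤ n h^(d+1) ≤ n h. It turns Lipschitz constants polynomial in 1/h into
constants polynomial in n, as the grid argument requires. -/
theorem eventually_inv_le (hh : IsBandwidth d h) : ∀ᶠ n : ℕ in atTop, (h n)⁻¹ ≤ n := by
  filter_upwards [hh.eventually_le_half, eventually_one_le_log,
    hh.rate.eventually_ge_atTop 1] with n h1 h2 h3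
  have hp := hh.pos n
  rw [le_div_iff₀ (by linarith), one_mul] at h3
  have h4 : h n ^ (d + 1) ≤ h n := pow_le_of_le_one hp.le (by linarith) d.succ_ne_zero
  rw [inv_le_iff_one_le_mul₀ hp]
  calc 1 ≤ _ := h2
    _ ≤ _ := h3
    _ ≤ _ := mul_le_mul_of_nonneg_left h4 (Nat.cast_nonneg n)

theorem tendsto_log_div (hh : IsBandwidth d h) {e : ℕ} (he : e ≤ 1) :
    Tendsto (fun n : ℕ => Real.log n / (n * h n ^ (d + e))) atTop (𝓝 0) := by
  have h1 := hh.rate.inv_tendsto_atTop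
  refine squeeze_zero' ?_ ?_ h1
  · filter_upwards [eventually_one_le_log] with n hn
    have := hh.pos n
    positivity
  · filter_upwards [eventually_one_le_log, hh.eventually_le_half, eventually_gt_atTop 0]
      with n hn hn2 hn0
    have := hh.pos n
    have hn0' : (0 : ℝ) < n := by exact_mod_cast hn0
    simp only [Pi.inv_apply, inv_div]
    have := pow_le_pow_of_le_one this.le (by linarith) (by omega : d + e ≤ d + 1)
    gcongr

theorem tendsto_sqrt_rate (hh : IsBandwidth d h) (c : ℝ) :
    Tendsto (fun n : ℕ => c * Real.sqrt (h n ^ 0 / h n ^ d * Real.log n / n)) atTop (𝓝 0) := by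
  have h1 := (hh.tendsto_log_div zero_le_one).sqrt.const_mul c
  rw [Real.sqrt_zero, mul_zero] at h1
  refine h1.congr fun n => ?_
  congr 2
  rw [pow_zero, add_zero, div_mul_eq_mul_div, one_mul, div_div, mul_comm]

end IsBandwidth

/-! ### Deviations of kernel-weighted means -/

section Deviation

variable {Ω : Type*} [MeasurableSpace Ω] {P : Measure Ω} [IsProbabilityMeasure P]
  {d : ℕ} {Z : ℕ → Ω → ℝ × (Fin d → ℝ)} {Q : Measure (ℝ × (Fin d → ℝ))} {h : ℕ → ℝ}

/-- Uniform deviations of local empirical means. -/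
theorem exists_local_deviation_bound (hh : IsBandwidth d h) (hZ : ∀ i, Measurable (Z i))
    (hind : iIndepFun Z P) (hlaw : ∀ i, P.map (Z i) = Q) {e : ℕ} (he : e ≤ 1) (hed : e ≤ d)
    (ξ : ℕ → ℝ × (Fin d → ℝ) → ℝ × (Fin d → ℝ) → ℝ)
    (hξ : ∀ n, ∀ τ ∈ unitY ×ˢ unitX d, Measurable (ξ n τ)) {C : ℝ} (hC : 0 < C)
    (hM : ∀ n, h n ≤ 1 → ∀ τ ∈ unitY ×ˢ unitX d, ∀ z, |ξ n τ z| ≤ C / h n ^ d)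
    (hvar : ∀ n, h n ≤ 1 → ∀ τ ∈ unitY ×ˢ unitX d, ∫ z, ξ n τ z ^ 2 ∂Q ≤ C * (h n ^ e / h n ^ d))
    (hlip : ∀ n, h n ≤ 1 → ∀ τ ∈ unitY ×ˢ unitX d, ∀ τ' ∈ unitY ×ˢ unitX d, ∀ z,
      |ξ n τ z - ξ n τ' z| ≤ C / h n ^ (d + 2) * dist τ τ') {c₁ : ℝ} (hc₁ : 0 < c₁) :
    ∃ c₂ : ℝ, 0 < c₂ ∧ ∀ᶠ n : ℕ in atTop,
      P {ω | ∃ τ ∈ unitY ×ˢ unitX d, c₂ * Real.sqrt (h n ^ e / h n ^ d * Real.log n / n)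
        < |empDev Q n (fun i => Z i ω) (ξ n τ)|} ≤ ENNReal.ofReal ((n : ℝ) ^ (-c₁)) := by
  have hle : ∀ᶠ n in atTop, h n ≤ 1 := hh.eventually_le_half.mono fun n hn => by linarith
  obtain ⟨c₂, hc₂, H⟩ := exists_uniform_deviation_bound hZ hind hlaw ξ hξ
    (M := fun n => C / h n ^ d) (V := fun n => C * (h n ^ e / h n ^ d)) (L := C) (v := C)
    (B := d + 2) hC (hle.mono hM) (hle.mono hvar)
    (by
      filter_upwards [hle, hh.eventually_inv_le] with n h1 h2 τ hτ τ' hτ' z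
      refine (hlip n h1 τ hτ τ' hτ' z).trans (mul_le_mul_of_nonneg_right ?_ dist_nonneg)
      rw [div_eq_mul_inv, ← inv_pow]
      exact mul_le_mul_of_nonneg_left (pow_le_pow_left₀ (inv_nonneg.2 (hh.pos n).le) h2 _) hC.le)
    (by
      -- The variance proxy h^e / h^d is at least 1 because e ≤ d and h ≤ 1.
      filter_upwards [hle] with n h1
      refine le_mul_of_one_le_right hC.le ?_
      rw [one_le_div (pow_pos (hh.pos n) d)]
      exact pow_le_pow_of_le_one (hh.pos n).le h1 hed)
    (by
      -- Here M² log n / (n V) = C log n / (n h^(d+e)); the case e = 1 needs the full rate n h^(d+1)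
      -- / log n → ∞.
      have h1 := (hh.tendsto_log_div he).const_mul C
      rw [mul_zero] at h1
      refine h1.congr fun n => ?_
      have := (hh.pos n).ne'
      rcases eq_or_ne (n : ℝ) 0 with hn | hn
      · simp [hn]
      · rw [pow_add]
        field_simp)
    hc₁
  refine ⟨c₂ * Real.sqrt C, by positivity, H.mono fun n hn => ?_⟩
  have e1 : c₂ * Real.sqrt C * Real.sqrt (h n ^ e / h n ^ d * Real.log n / n)
      = c₂ * Real.sqrt (C * (h n ^ e / h n ^ d) * Real.log n / n) := by
    rw [mul_assoc, ← Real.sqrt_mul hC.le, mul_div_assoc, mul_div_assoc, mul_assoc]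
  rw [e1]
  exact hn

variable {q : ℕ} {K : ℝ → ℝ} {f : ℝ → (Fin d → ℝ) → ℝ} {a b : ℝ}

/-- The local Gram matrix is uniformly close to its expectation. -/
theorem eventually_gramX_deviation_le (hh : IsBandwidth d h) (hZ : ∀ i, Measurable (Z i))
    (hind : iIndepFun Z P) (hlaw : ∀ i, P.map (Z i) = dataLaw f) (hf : IsRegularDensity f a b)
    (hK : IsKernel K) (m m' : multiIndices d q) {c₁ : ℝ} (hc₁ : 0 < c₁) {δ : ℝ} (hδ : 0 < δ) :
    ∀ᶠ n : ℕ in atTop, P {ω | ∃ x ∈ unitX d,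
      δ < |empDev (dataLaw f) n (fun i => Z i ω) (gramX K (h n) m.1 m'.1 x)|}
        ≤ ENNReal.ofReal ((n : ℝ) ^ (-c₁)) := by
  have hQ : IsProbabilityMeasure (dataLaw f) := by
    rw [← hlaw 0]
    exact Measure.isProbabilityMeasure_map (hZ 0).aemeasurable
  have hb : 0 ≤ b := (abs_nonneg _).trans (hf.ext_abs_le 0 0)
  obtain ⟨C, hC0, hC⟩ := exists_gramX_bounds hK d q
  have hC1 : C ≤ C + b * 2 ^ d * C ^ 2 := le_add_of_nonneg_right (by positivity)
  obtain ⟨c₂, hc₂, H⟩ := exists_local_deviation_bound hh hZ hind hlaw (e := 0) zero_le_one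
    (Nat.zero_le d) (fun n τ => gramX K (h n) m.1 m'.1 τ.2)
    (fun n τ _ => measurable_gramX hK (h n) _ _ _)
    (C := C + b * 2 ^ d * C ^ 2) (by positivity)
    (fun n _ τ _ z => ((hC _ (hh.pos n) m m').1 τ.2 z).trans
      (div_le_div_of_nonneg_right hC1 (pow_pos (hh.pos n) d).le))
    (fun n _ τ _ => by
      have hn := hh.pos n
      refine (hf.integral_sq_le (y := 0) (x := τ.2) (h := h n) (A := 0) (B := (C / h n ^ d) ^ 2) hn.le
        le_rfl (sq_nonneg _) (fun z hz => gramX_eq_zero hK hn _ _ hz) fun z => ?_).trans ?_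
      · rw [ite_self, zero_add]
        exact sq_le_sq' (by linarith [(abs_le.1 ((hC _ hn m m').1 τ.2 z)).1])
          (abs_le.1 ((hC _ hn m m').1 τ.2 z)).2
      · have e1 : b * (2 * h n) ^ d * (0 * (2 * h n) + (C / h n ^ d) ^ 2)
            = b * 2 ^ d * C ^ 2 * (h n ^ 0 / h n ^ d) := by
          rw [mul_pow]
          field_simp
          ring
        rw [e1]
        exact mul_le_mul_of_nonneg_right (by linarith) (by positivity))
    (fun n hn1 τ _ τ' _ z => by
      have hn := hh.pos n
      refine ((hC _ hn m m').2 τ.2 τ'.2 z).trans ?_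
      refine mul_le_mul (div_le_div₀ (by positivity) hC1 (by positivity)
        (pow_le_pow_of_le_one hn.le hn1 (by omega))) ?_ dist_nonneg (by positivity)
      rw [Prod.dist_eq]
      exact le_max_right _ _)
    hc₁
  -- The deviation bound √(log n / (n h^d)) tends to 0, so it is eventually below the fixed δ.
  filter_upwards [H, (hh.tendsto_sqrt_rate c₂).eventually_le_const hδ] with n h1 h2
  refine (measure_mono fun ω hω => ?_).trans h1
  obtain ⟨x, hx, hω⟩ := hω
  exact ⟨(0, x), ⟨⟨le_rfl, zero_le_one⟩, hx⟩, h2.trans_lt hω⟩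

end Deviation

/-! ### Rates of convergence -/

/-- Polynomially decaying tail probabilities give a tail-controlled stochastic order. -/
theorem isBigOTC_of_measure_le {Ω : Type*} [MeasurableSpace Ω] {P : Measure Ω}
    {α : ℕ → Ω → ℝ≥0∞} {β : ℕ → ℝ}
    (H : ∀ c₁ : ℝ, 0 < c₁ → ∃ c₂ : ℝ, 0 < c₂ ∧ ∃ N : ℝ≥0∞, N ≠ ⊤ ∧ ∀ᶠ n : ℕ in atTop,
      P {ω | ENNReal.ofReal (c₂ * β n) ≤ α n ω} ≤ N * ENNReal.ofReal ((n : ℝ) ^ (-c₁))) :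
    IsBigOTC P α β := by
  intro c₁ hc₁
  obtain ⟨c₂, hc₂, N, hN, hle⟩ := H c₁ hc₁
  refine ⟨c₂, hc₂, lt_of_le_of_lt (limsup_le_of_le (by isBoundedDefault) (a := N) ?_) hN.lt_top⟩
  filter_upwards [hle, eventually_gt_atTop 0] with n hn hn0
  have hn0' : (0 : ℝ) < n := by exact_mod_cast hn0
  calc _ ≤ ENNReal.ofReal ((n : ℝ) ^ c₁) * (N * ENNReal.ofReal ((n : ℝ) ^ (-c₁))) := by gcongr
    _ = N * (ENNReal.ofReal ((n : ℝ) ^ c₁) * ENNReal.ofReal ((n : ℝ) ^ (-c₁))) := by ring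
    _ = N := by
      rw [← ENNReal.ofReal_mul (by positivity), ← Real.rpow_add hn0', add_neg_cancel,
        Real.rpow_zero, ENNReal.ofReal_one, mul_one]

section Main

variable {Ω : Type*} [MeasurableSpace Ω] {P : Measure Ω} [IsProbabilityMeasure P]
  {d p q : ℕ} {Z : ℕ → Ω → ℝ × (Fin d → ℝ)} {h : ℕ → ℝ} {K G g : ℝ → ℝ}
  {f F : ℝ → (Fin d → ℝ) → ℝ} {a b g₀ g₁ L : ℝ}

theorem measurable_gramX_mul_zeta (hK : IsKernel K) (hg : IsPositiveWeight g g₀ g₁)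
    (hF : IsCdfExtension f F L) (h : ℝ) (m m' : Fin d → ℕ) (μ k : ℕ) (y : ℝ) (x : Fin d → ℝ) :
    Measurable fun z => gramX K h m m' x z * zeta F K g h μ k y z :=
  (measurable_gramX hK h m m' x).mul
    (hF.measurable_integral_noise (continuous_zetaWeight hK hg h μ k y).measurable)

/-- The Gram summand depends on x only and the noise is centered given x. The empirical means of
these products are therefore already deviations from their expectation. -/
theorem integral_gramX_mul_zeta (hK : IsKernel K) (hg : IsPositiveWeight g g₀ g₁)
    (hf : IsRegularDensity f a b) (hF : IsCdfExtension f F L) {h : ℝ} (hh : 0 < h)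
    (m m' : multiIndices d q) (μ k : ℕ) (y : ℝ) (x : Fin d → ℝ) :
    ∫ z, gramX K h m.1 m'.1 x z * zeta F K g h μ k y z ∂(dataLaw f) = 0 := by
  obtain ⟨C, -, hC⟩ := exists_gramX_bounds hK d q
  exact hf.integral_noise_eq_zero hF (integrableOn_unitY (continuous_zetaWeight hK hg h μ k y))
    (continuous_gramX hK h m.1 m'.1 x) (C := C / h ^ d) fun t => (hC h hh m m').1 x (0, t)

/-- Second moments of the products of the Gram summands with the smoothed noise. -/
theorem exists_integral_sq_gramX_mul_zeta_le (hK : IsKernel K) (hg : IsPositiveWeight g g₀ g₁)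
    (hf : IsRegularDensity f a b) [IsFiniteMeasure (dataLaw f)] (hF : IsCdfExtension f F L)
    (hL : 0 ≤ L) (p q μ : ℕ) :
    ∃ C, 0 ≤ C ∧ ∀ h : ℝ, 0 < h → h ≤ 1 → ∀ (m m' : multiIndices d q) (k : Fin (p + 1)),
      ∀ y ∈ unitY, ∀ x, ∫ z, (gramX K h m.1 m'.1 x z * zeta F K g h μ k y z) ^ 2 ∂(dataLaw f)
        ≤ C * (h ^ (if μ = 0 then 0 else 1) / h ^ d) := by
  have hb : 0 ≤ b := (abs_nonneg _).trans (hf.ext_abs_le 0 0)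
  obtain ⟨A, hA0, hA⟩ := exists_gramX_bounds hK d q
  obtain ⟨D, hD0, hD⟩ := exists_zeta_bounds hK hg hF hL p μ
  refine ⟨b * 2 ^ d * (A ^ 2 * (D ^ 2 + 3 * D)), by positivity,
    fun h hh hh1 m m' k y hy x => ?_⟩
  obtain ⟨hD1, -, hD2⟩ := hD h hh hh1 k
  have hA1 : ∀ z, gramX K h m.1 m'.1 x z ^ 2 ≤ (A / h ^ d) ^ 2 := fun z =>
    sq_le_sq.2 (((hA h hh m m').1 x z).trans (le_abs_self _))
  have hfar : ∀ z, h < dist z.2 x → gramX K h m.1 m'.1 x z * zeta F K g h μ k y z = 0 := fun z hz => by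
    rw [gramX_eq_zero hK hh _ _ hz, zero_mul]
  have hs : b * (2 * h) ^ d * (A / h ^ d) ^ 2 = b * 2 ^ d * A ^ 2 / h ^ d := by
    rw [mul_pow]
    field_simp
  by_cases hμ : μ = 0
  · rw [if_pos hμ]
    refine (hf.integral_sq_le (y := y) (A := 0) (B := (A / h ^ d) ^ 2 * D ^ 2) hh.le le_rfl
      (by positivity) hfar fun z => ?_).trans ?_
    · rw [ite_self, zero_add, mul_pow]
      exact mul_le_mul (hA1 z) (sq_le_sq.2 ((hD1 y z).trans (le_abs_self _))) (sq_nonneg _)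
        (sq_nonneg _)
    · rw [zero_mul, zero_add, ← mul_assoc, hs]
      have e1 : b * 2 ^ d * A ^ 2 / h ^ d * D ^ 2 = b * 2 ^ d * (A ^ 2 * D ^ 2) * (h ^ 0 / h ^ d) := by
        field_simp
      rw [e1]
      gcongr
      linarith
  · rw [if_neg hμ]
    -- The strip |z.1 - y| ≤ h contributes an extra factor of order h, and off it ζ² ≤ D h²; both
    -- give h^(1-d) instead of h^(-d).
    refine (hf.integral_sq_le (y := y) (A := (A / h ^ d) ^ 2 * D) (B := (A / h ^ d) ^ 2 * (D * h ^ 2))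
      hh.le (by positivity) (by positivity) hfar fun z => ?_).trans ?_
    · rw [mul_pow]
      refine (mul_le_mul (hA1 z) (hD2 hμ y hy z) (sq_nonneg _) (sq_nonneg _)).trans (le_of_eq ?_)
      split_ifs <;> ring
    · have e1 : b * (2 * h) ^ d * ((A / h ^ d) ^ 2 * D * (2 * h) + (A / h ^ d) ^ 2 * (D * h ^ 2))
          = b * (2 * h) ^ d * (A / h ^ d) ^ 2 * (D * (2 * h + h ^ 2)) := by ring
      have e2 : b * 2 ^ d * A ^ 2 / h ^ d * (D * (2 * h + h ^ 2))
          = b * 2 ^ d * (A ^ 2 * (2 * D + D * h)) * (h ^ 1 / h ^ d) := by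
        field_simp
      rw [e1, hs, e2]
      have e3 : 2 * D + D * h ≤ D ^ 2 + 3 * D := by
        nlinarith [sq_nonneg D, mul_nonneg hD0 (sub_nonneg.2 hh1)]
      gcongr

/-- Uniform bounds for the stochastic part of the estimator. -/
theorem exists_zeta_deviation_bound (hh : IsBandwidth d h) (hZ : ∀ i, Measurable (Z i))
    (hind : iIndepFun Z P) (hlaw : ∀ i, P.map (Z i) = dataLaw f) (hf : IsRegularDensity f a b)
    (hK : IsKernel K) (hg : IsPositiveWeight g g₀ g₁) (hF : IsCdfExtension f F L) (hL : 0 ≤ L)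
    (hd : 0 < d) (μ : ℕ) (m m' : multiIndices d q) (k : Fin (p + 1)) {c₁ : ℝ} (hc₁ : 0 < c₁) :
    ∃ c₂ : ℝ, 0 < c₂ ∧ ∀ᶠ n : ℕ in atTop, P {ω | ∃ τ ∈ unitY ×ˢ unitX d,
      c₂ * Real.sqrt (h n ^ (if μ = 0 then 0 else 1) / h n ^ d * Real.log n / n)
        < |(∑ i ∈ Finset.range n,
          gramX K (h n) m.1 m'.1 τ.2 (Z i ω) * zeta F K g (h n) μ k τ.1 (Z i ω)) / n|}
      ≤ ENNReal.ofReal ((n : ℝ) ^ (-c₁)) := by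
  have hQ : IsProbabilityMeasure (dataLaw f) := by
    rw [← hlaw 0]
    exact Measure.isProbabilityMeasure_map (hZ 0).aemeasurable
  obtain ⟨A, hA0, hA⟩ := exists_gramX_bounds hK d q
  obtain ⟨D, hD0, hD⟩ := exists_zeta_bounds hK hg hF hL p μ
  obtain ⟨V, hV0, hV⟩ := exists_integral_sq_gramX_mul_zeta_le hK hg hf hF hL p q μ
  have he : (if μ = 0 then 0 else 1) ≤ 1 := by split_ifs <;> norm_num
  have hbd : ∀ n, h n ≤ 1 → ∀ y x z,
      |gramX K (h n) m.1 m'.1 x z * zeta F K g (h n) μ k y z| ≤ A * D / h n ^ d := fun n hn y x z => by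
    have hp := hh.pos n
    rw [abs_mul, mul_div_right_comm]
    exact mul_le_mul ((hA _ hp m m').1 x z) ((hD _ hp hn k).1 y z) (abs_nonneg _) (by positivity)
  have hAD : 0 ≤ A * D := by positivity
  obtain ⟨c₂, hc₂, H⟩ := exists_local_deviation_bound hh hZ hind hlaw he (he.trans hd)
    (fun n τ z => gramX K (h n) m.1 m'.1 τ.2 z * zeta F K g (h n) μ k τ.1 z)
    (fun n τ _ => measurable_gramX_mul_zeta hK hg hF _ _ _ _ _ _ _)
    (C := 2 * (A * D) + V + 1) (by positivity)
    (fun n hn τ _ z => (hbd n hn τ.1 τ.2 z).trans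
      (div_le_div_of_nonneg_right (by linarith) (pow_pos (hh.pos n) d).le))
    (fun n hn τ hτ => by
      have hp := hh.pos n
      refine (hV _ hp hn m m' k τ.1 hτ.1 τ.2).trans ?_
      exact mul_le_mul_of_nonneg_right (by linarith) (by positivity))
    (fun n hn τ _ τ' _ z => by
      have hp := hh.pos n
      obtain ⟨hA1, hA2⟩ := hA _ hp m m'
      obtain ⟨hD1, hD2, -⟩ := hD _ hp hn k
      have hd1 : |τ.1 - τ'.1| ≤ dist τ τ' := by
        rw [Prod.dist_eq, ← Real.dist_eq]
        exact le_max_left _ _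
      have hd2 : dist τ.2 τ'.2 ≤ dist τ τ' := by
        rw [Prod.dist_eq]
        exact le_max_right _ _
      have e1 : ∀ s t s' t' : ℝ, s * t - s' * t' = s * (t - t') + (s - s') * t' := fun _ _ _ _ => by
        ring
      have h1 : |gramX K (h n) m.1 m'.1 τ.2 z
          * (zeta F K g (h n) μ k τ.1 z - zeta F K g (h n) μ k τ'.1 z)|
          ≤ A * D / h n ^ (d + 2) * dist τ τ' := by
        rw [abs_mul]
        refine (mul_le_mul (hA1 _ z) ((hD2 _ _ z).trans (mul_le_mul_of_nonneg_left hd1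
          (by positivity))) (abs_nonneg _) (by positivity)).trans (le_of_eq ?_)
        rw [pow_add]
        field_simp
      have h2 : |(gramX K (h n) m.1 m'.1 τ.2 z - gramX K (h n) m.1 m'.1 τ'.2 z)
          * zeta F K g (h n) μ k τ'.1 z| ≤ A * D / h n ^ (d + 2) * dist τ τ' := by
        rw [abs_mul]
        refine (mul_le_mul ((hA2 _ _ z).trans (mul_le_mul_of_nonneg_left hd2 (by positivity)))
          (hD1 _ z) (abs_nonneg _) (by positivity)).trans ?_
        rw [mul_right_comm, div_mul_eq_mul_div]
        refine mul_le_mul_of_nonneg_right (div_le_div_of_nonneg_left hAD (by positivity)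
          (pow_le_pow_of_le_one hp.le hn (by omega))) dist_nonneg
      rw [e1]
      refine (abs_add_le _ _).trans ((add_le_add h1 h2).trans ?_)
      rw [← add_mul, ← add_div]
      have e2 : A * D + A * D ≤ 2 * (A * D) + V + 1 := by linarith
      gcongr)
    hc₁
  refine ⟨c₂, hc₂, H.mono fun n hn => ?_⟩
  simpa only [empDev, integral_gramX_mul_zeta hK hg hf hF (hh.pos n), sub_zero] using hn

/-- The uniform rate of convergence, in terms of the variance `h^{-d}` or `h^{1-d}` of the
smoothed noise. -/
theorem isBigOTC_uniformError (hh : IsBandwidth d h) (hZ : ∀ i, Measurable (Z i))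
    (hind : iIndepFun Z P) (hlaw : ∀ i, P.map (Z i) = dataLaw f) (hf : IsRegularDensity f a b)
    (hK : IsKernel K) (hg : IsPositiveWeight g g₀ g₁)
    (hgG : ∀ u ∈ unitY, weightDensity G u = g u) (hF : IsCdfExtension f F L) (hL : 0 ≤ L)
    (hd : 0 < d) {s : ℕ} (hs : SmoothOfOrder f s) (μ : Fin (p + 1)) (ν : multiIndices d q)
    (hq : q + 1 + μ ≤ s) (hp : p + 1 + ∑ j, ν.1 j ≤ s) :
    IsBigOTC P (fun n ω => uniformError p q K G f (h n) n (fun i => Z i ω) μ ν)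
      fun n => h n ^ (q + 1 - ∑ j, ν.1 j) + h n ^ (p + 1 - (μ : ℕ))
        + Real.sqrt (h n ^ (if (μ : ℕ) = 0 then 0 else 1) / h n ^ d * Real.log n / n)
          / h n ^ ((μ : ℕ) + ∑ j, ν.1 j) := by
  have hQ : IsProbabilityMeasure (dataLaw f) := by
    rw [← hlaw 0]
    exact Measure.isProbabilityMeasure_map (hZ 0).aemeasurable
  have h0 : ∃ A, ∀ y ∈ unitY, ∀ x ∈ unitX d, |condDistFun f y x| ≤ A := by
    refine ⟨1, fun y hy x hx => ?_⟩
    rw [← hF.eq y hy x hx, abs_of_nonneg (hF.mem y hy x).1]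
    exact (hF.mem y hy x).2
  obtain ⟨l, hl, hcoer⟩ := hf.exists_coercive_gram hK q
  obtain ⟨Γ, hΓ0, hΓ⟩ := hf.exists_integral_kernel_le hK
  set κ : ℝ := (Fintype.card (multiIndices d q) : ℝ) with hκ
  -- With this δ the entrywise error costs at most half of the coercivity constant.
  set δ : ℝ := l / (2 * (κ + 1)) with hδ
  have hκ0 : 0 ≤ κ := by positivity
  have hδ0 : 0 < δ := by positivity
  have hδκ : l / 2 ≤ l - δ * κ := by
    have : δ * κ ≤ l / 2 := by
      rw [hδ, div_mul_eq_mul_div, div_le_div_iff₀ (by positivity) two_pos]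
      nlinarith
    linarith
  obtain ⟨C, hC0, hC⟩ := exists_error_bound hK hg hgG hF hs h0 μ ν hq hp (half_pos hl)
    (add_nonneg hΓ0 hδ0.le)
  refine isBigOTC_of_measure_le fun c₁ hc₁ => ?_
  set z0 : multiIndices d q := ⟨0, mem_multiIndices.2 (by simp)⟩ with hz0
  choose c hc0 hc using fun (i : multiIndices d q × Fin (p + 1)) =>
    exists_zeta_deviation_bound hh hZ hind hlaw hf hK hg hF hL hd μ i.1 z0 i.2 hc₁
  set cs : ℝ := ∑ i, c i with hcs
  have hcs0 : 0 ≤ cs := Finset.sum_nonneg fun i _ => (hc0 i).le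
  have hcle : ∀ i, c i ≤ cs := fun i =>
    Finset.single_le_sum (fun i _ => (hc0 i).le) (Finset.mem_univ i)
  have hgram := fun (i : multiIndices d q × multiIndices d q) =>
    eventually_gramX_deviation_le hh hZ hind hlaw hf hK i.1 i.2 hc₁ hδ0
  have hcube : P {ω | ∃ i, Z i ω ∉ unitY ×ˢ unitX d} = 0 := by
    have h1 : ∀ i, ∀ᵐ ω ∂P, Z i ω ∈ unitY ×ˢ unitX d := fun i => by
      have := ae_dataLaw_mem (f := f)
      rw [← hlaw i] at this
      exact ae_of_ae_map (hZ i).aemeasurable this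
    have h2 := ae_all_iff.2 h1
    rw [ae_iff] at h2
    simpa only [not_forall] using h2
  -- The `+ 1` makes the threshold strictly larger than the error bound, β being positive, since the
  -- event in `IsBigOTC` is a non-strict inequality. The constant N counts the exceptional events.
  refine ⟨C * (1 + cs) + 1, by positivity,
    (Fintype.card (multiIndices d q × multiIndices d q) : ℝ≥0∞)
      + (Fintype.card (multiIndices d q × Fin (p + 1)) : ℝ≥0∞), by finiteness, ?_⟩
  filter_upwards [eventually_all.2 hgram, eventually_all.2 hc, hh.eventually_le_half,
    eventually_gt_atTop 0] with n hn1 hn2 hn3 hn0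
  have hpos := hh.pos n
  set v : ℝ := Real.sqrt (h n ^ (if (μ : ℕ) = 0 then 0 else 1) / h n ^ d * Real.log n / n) with hv
  set β : ℝ := h n ^ (q + 1 - ∑ j, ν.1 j) + h n ^ (p + 1 - (μ : ℕ))
    + v / h n ^ ((μ : ℕ) + ∑ j, ν.1 j) with hβ
  have hv0 : 0 ≤ v := Real.sqrt_nonneg _
  have hβ0 : 0 < β := by positivity
  set E1 := fun (i : multiIndices d q × multiIndices d q) => {ω | ∃ x ∈ unitX d,
    δ < |empDev (dataLaw f) n (fun j => Z j ω) (gramX K (h n) i.1.1 i.2.1 x)|} with hE1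
  set E2 := fun (i : multiIndices d q × Fin (p + 1)) => {ω | ∃ τ ∈ unitY ×ˢ unitX d,
    c i * v < |(∑ j ∈ Finset.range n,
      gramX K (h n) i.1.1 z0.1 τ.2 (Z j ω) * zeta F K g (h n) μ i.2 τ.1 (Z j ω)) / n|} with hE2
  have hsub : {ω | ENNReal.ofReal ((C * (1 + cs) + 1) * β)
        ≤ uniformError p q K G f (h n) n (fun i => Z i ω) μ ν}
      ⊆ ((⋃ i, E1 i) ∪ ⋃ i, E2 i) ∪ {ω | ∃ i, Z i ω ∉ unitY ×ˢ unitX d} := by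
    intro ω hω
    by_contra hbad
    simp only [hE1, hE2, mem_union, mem_iUnion, mem_ofPred_eq, not_or, not_exists, not_and,
      not_lt, not_not] at hbad
    obtain ⟨⟨hb1, hb2⟩, hb3⟩ := hbad
    have hdev : ∀ x ∈ unitX d, ∀ m m' : multiIndices d q,
        |empGram K (h n) n (fun i => Z i ω) x m m' - ∫ z, gramX K (h n) m.1 m'.1 x z ∂(dataLaw f)|
          ≤ δ := fun x hx m m' => hb1 (m, m') x hx
    have hcoer' : ∀ x ∈ unitX d,
        Coercive (l / 2) (empGram (q := q) K (h n) n (fun i => Z i ω) x) := fun x hx c =>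
      (mul_le_mul_of_nonneg_right hδκ (Finset.sum_nonneg fun i _ => sq_nonneg _)).trans
        ((hcoer x hx (h n) hpos hn3).perturb (hdev x hx) c)
    have hΓ' : ∀ x ∈ unitX d,
        (∑ i ∈ Finset.range n, scaledKernelX K (h n) (Z i ω).2 x) / n ≤ Γ + δ := fun x hx => by
      have h1 := (abs_le.1 (hdev x hx z0 z0)).2
      have h2 := hΓ x (h n) hpos
      simp only [empGram, hz0] at h1
      simp only [← gramX_zero_zero]
      linarith
    have hε : ∀ y ∈ unitY, ∀ x ∈ unitX d, ∀ (m : multiIndices d q) (k : Fin (p + 1)),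
        |(∑ i ∈ Finset.range n,
          gramX K (h n) m.1 0 x (Z i ω) * zeta F K g (h n) μ k y (Z i ω)) / n| ≤ cs * v :=
      fun y hy x hx m k => (hb2 (m, k) (y, x) ⟨hy, hx⟩).trans
        (mul_le_mul_of_nonneg_right (hcle _) hv0)
    have herr := hC (h n) n (fun i => Z i ω) (cs * v) hpos hn3 hn0 hb3 hcoer' hΓ' hε
    have hle : C * (h n ^ (q + 1 - ∑ j, ν.1 j) + h n ^ (p + 1 - (μ : ℕ))
        + cs * v / h n ^ ((μ : ℕ) + ∑ j, ν.1 j)) ≤ C * (1 + cs) * β := by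
      rw [mul_assoc]
      refine mul_le_mul_of_nonneg_left ?_ hC0
      have p1 : 0 ≤ cs * h n ^ (q + 1 - ∑ j, ν.1 j) := by positivity
      have p2 : 0 ≤ cs * h n ^ (p + 1 - (μ : ℕ)) := by positivity
      have p3 : 0 ≤ v / h n ^ ((μ : ℕ) + ∑ j, ν.1 j) := by positivity
      rw [hβ, mul_div_assoc]
      linarith
    have hun : uniformError p q K G f (h n) n (fun i => Z i ω) μ ν
        ≤ ENNReal.ofReal (C * (1 + cs) * β) :=
      iSup₂_le fun y hy => iSup₂_le fun x hx =>
        ENNReal.ofReal_le_ofReal ((herr y hy x hx).trans hle)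
    have hlt : ENNReal.ofReal (C * (1 + cs) * β) < ENNReal.ofReal ((C * (1 + cs) + 1) * β) :=
      (ENNReal.ofReal_lt_ofReal_iff (by positivity)).2 (by linarith)
    exact absurd (hω.trans hun) (not_le.2 hlt)
  refine (measure_mono hsub).trans ((measure_union_le _ _).trans ?_)
  rw [hcube, add_zero, add_mul]
  refine (measure_union_le _ _).trans (add_le_add ?_ ?_)
  · refine (measure_iUnion_fintype_le _ _).trans ?_
    rw [← nsmul_eq_mul, ← Finset.card_univ]
    exact Finset.sum_le_card_nsmul _ _ _ fun i _ => hn1 i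
  · refine (measure_iUnion_fintype_le _ _).trans ?_
    rw [← nsmul_eq_mul, ← Finset.card_univ]
    exact Finset.sum_le_card_nsmul _ _ _ fun i _ => hn2 i

end Main

/-! ### Consequences of the assumptions on the weighting and on the data -/

section Assumptions

/-- The density of G is continuous and positive on a compact interval. Composing with the projection
extends its bounds to the line without changing the criterion, whose integral runs over [0,1]. -/
theorem IsWeighting.isPositiveWeight {G : ℝ → ℝ} (hG : IsWeighting G) :
    ∃ g₀ g₁, IsPositiveWeight (fun u => weightDensity G (clamp u)) g₀ g₁ := by
  have hc : ContinuousOn (weightDensity G) unitY :=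
    hG.contDiff.continuousOn_derivWithin (uniqueDiffOn_Icc zero_lt_one) le_rfl
  have hne : unitY.Nonempty := ⟨0, le_rfl, zero_le_one⟩
  obtain ⟨u₀, hu₀, h₀⟩ := isCompact_Icc.exists_isMinOn hne hc
  obtain ⟨u₁, hu₁, h₁⟩ := isCompact_Icc.exists_isMaxOn hne hc
  exact ⟨_, _, hc.comp_continuous continuous_clamp clamp_mem, hG.density_pos u₀ hu₀,
    fun u => h₀ (clamp_mem u), fun u => h₁ (clamp_mem u)⟩

theorem IsDGP.isRegularDensity {Ω : Type*} [MeasurableSpace Ω] {P : Measure Ω} {d : ℕ}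
    {Z : ℕ → Ω → ℝ × (Fin d → ℝ)} {f : ℝ → (Fin d → ℝ) → ℝ} (hDGP : IsDGP P Z f) :
    ∃ a b, IsRegularDensity f a b := by
  obtain ⟨a, ha, hfa⟩ := hDGP.density_bounded_below
  obtain ⟨b, hb⟩ := isCompact_cube.bddAbove_image hDGP.density_continuous
  exact ⟨a, b, hDGP.density_continuous, ha, hfa,
    fun y hy x hx => hb ⟨(y, x), ⟨hy, hx⟩, rfl⟩⟩

end Assumptions

end LPCDE

end

/-! ### The two rates -/

open LPCDE
theorem mainTheorem10 {Ω : Type*} [MeasurableSpace Ω] (P : Measure Ω) [IsProbabilityMeasure P]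
    {d : ℕ} (hd : 0 < d) (p q : ℕ)
    (Z : ℕ → Ω → ℝ × (Fin d → ℝ)) (f : ℝ → (Fin d → ℝ) → ℝ) (K G : ℝ → ℝ) (h : ℕ → ℝ)
    (hDGP : IsDGP P Z f) (hK : IsKernel K) (hG : IsWeighting G)
    (hpos : ∀ n, 0 < h n) (hzero : Tendsto h atTop (𝓝 0))
    (hrate : Tendsto (fun n : ℕ => (n : ℝ) * h n ^ (d + 1) / Real.log n) atTop atTop)
    (μ : ℕ) (hμ : μ ≤ p) (ν : Fin d → ℕ) (hν : ∑ j, ν j ≤ q)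
    (hsmooth : ∀ (μ' : ℕ) (ν' : Fin d → ℕ),
      μ' + ∑ j, ν' j = max (q + 1 + μ) (p + 1 + ∑ j, ν j) → ThetaExistsContinuous f μ' ν') :
    (μ = 0 →
      IsBigOTC P
        (fun n ω => uniformError p q K G f (h n) n (fun i => Z i ω)
          ⟨μ, Nat.lt_succ_of_le hμ⟩ ⟨ν, mem_multiIndices.2 hν⟩)
        (fun n => h n ^ (q + 1 - ∑ j, ν j) + h n ^ (p + 1)
          + Real.sqrt (Real.log n / (n * h n ^ (d + 2 * ∑ j, ν j))))) ∧
    (0 < μ →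
      IsBigOTC P
        (fun n ω => uniformError p q K G f (h n) n (fun i => Z i ω)
          ⟨μ, Nat.lt_succ_of_le hμ⟩ ⟨ν, mem_multiIndices.2 hν⟩)
        (fun n => h n ^ (q + 1 - ∑ j, ν j) + h n ^ (p + 1 - μ)
          + Real.sqrt (Real.log n / (n * h n ^ (d + 2 * μ + 2 * ∑ j, ν j - 1))))) := by
  obtain ⟨a, b, hf⟩ := hDGP.isRegularDensity
  obtain ⟨g₀, g₁, hg⟩ := hG.isPositiveWeight
  have hgG : ∀ u ∈ unitY, weightDensity G u = weightDensity G (clamp u) := fun u hu => by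
    rw [clamp_of_mem hu]
  have hh : IsBandwidth d h := ⟨hpos, hzero, hrate⟩
  have hL : 0 ≤ b / a := div_nonneg ((abs_nonneg _).trans (hf.ext_abs_le 0 0)) hf.pos.le
  have key := isBigOTC_uniformError hh hDGP.measurable hDGP.indep hDGP.law hf hK hg hgG
    hf.cdfExtension hL hd hsmooth ⟨μ, Nat.lt_succ_of_le hμ⟩ ⟨ν, mem_multiIndices.2 hν⟩
    (le_max_left _ _) (le_max_right _ _)
  refine ⟨fun h0 => ?_, fun h0 => ?_⟩
  · subst h0
    convert key using 2 with n
    have hn := hpos n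
    congr 1
    -- Dividing by h^|ν| outside the root amounts to dividing by h^(2|ν|) inside.
    rw [if_pos rfl, zero_add, eq_div_iff (by positivity), ← Real.sqrt_sq (pow_pos hn (∑ j, ν j)).le,
      ← Real.sqrt_mul' _ (sq_nonneg _)]
    congr 1
    rw [pow_add, mul_comm 2, pow_mul]
    field_simp
  · convert key using 2 with n
    have hn := hpos n
    congr 1
    rw [if_neg h0.ne', eq_div_iff (by positivity), ← Real.sqrt_sq (pow_pos hn (μ + ∑ j, ν j)).le,
      ← Real.sqrt_mul' _ (sq_nonneg _)]
    congr 1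
    -- The factor h gained in the variance becomes the `- 1` in the exponent, a genuine subtraction
    -- of natural numbers because μ > 0.
    have e1 : h n ^ d * (h n ^ (μ + ∑ j, ν j)) ^ 2 = h n * h n ^ (d + 2 * μ + 2 * ∑ j, ν j - 1) := by
      rw [← pow_mul, ← pow_add, ← pow_succ']
      congr 1
      omega
    rcases eq_or_ne (n : ℝ) 0 with hn0 | hn0
    · simp [hn0]
    · rw [pow_one, div_mul_eq_mul_div, div_eq_div_iff (by positivity) (by positivity)]
      field_simp
      linear_combination Real.log n * e1
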